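/- **Problem.** A finite set $M$ of machines is given. Jobs $1,\dots,n$ arrive one by one. When job $j$ arrives, it reveals a nonempty set $\mathcal S_j\subseteq M$ of feasible machines and weights $w_{ij}\ge 0$ ($i\in\mathcal S_j$), and has to be assigned irrevocably to a machine of $\mathcal S_j$; neither later jobs nor $n$ are known. With $X_{ij}\in\{0,1\}$ the indicator that $j$ is assigned to $i$, $L_i=\sum_j w_{ij}X_{ij}$ is the load of $i$ and $\sum_{i}L_i^2$ is the cost. A randomized online algorithm is $c$-competitive if on every (fixed) instance its expected cost $\sum_i\mathbb E[L_i^2]$ is at most $c$ times the minimum cost of an offline assignment. **Algorithm.** Let $\gamma=1/4.9843$, $a=1.0326$, $b=1.6208$, $\theta=0.0535$, $\beta=\sqrt{2/5}$, $\delta=0.02602$, $\lambda=0.02753$. The algorithm keeps a vector $\nu\in\mathbb R^M$, initially $\nu^{(0)}=0$, and for each machine a current hard group of jobs, initially empty. When job $j$ arrives, let $q_{ij}=\nu^{(j-1)}(i)/w_{ij}$ (not in $[a,b]$ if $w_{ij}=0$) and $\ell_i=\sum_{k<j}w_{ik}x_{ik}$. 1. *Water-filling.* Let $$f_{ij}(t)=\gamma\,(w_{ij}^2+2w_{ij}\ell_i)+\tfrac{1}{2t}\big[(\nu^{(j-1)}(i)+w_{ij}t\,\phi_{ij})^2-\nu^{(j-1)}(i)^2\big]$$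 (continuously extended to $t=0$), where $\phi_{ij}=\beta$ if $q_{ij}\in[a,b]$ and $t<\theta$, $\phi_{ij}=\beta+\delta$ if $q_{ij}\notin[a,b]$ or $t>\theta$, and $\phi_{ij}$ may be any value in $[\beta,\beta+\delta]$ if $q_{ij}\in[a,b]$ and $t=\theta$. Choose $x_{ij}\ge 0$ ($i\in\mathcal S_j$) with $\sum_i x_{ij}=1$ (and admissible $\phi_{ij}$) such that $x_{ej}>0$ implies $f_{ej}(x_{ej})\le f_{ij}(x_{ij})$ for all $e,i\in\mathcal S_j$; put $x_{ij}=0$ for $i\notin\mathcal S_j$. 2. *Grouping and dual update.* Job $j$ is hard for $i\in\mathcal S_j$ if $q_{ij}\in[a,b]$ and $x_{ij}\le\theta$, and otherwise easy for $i$. On machine $i$ an easy job forms a group of its own, and a hard job joins the current hard group. For $i\in\mathcal S_j$ let $\hat\nu^{(j)}(i)=\nu^{(j-1)}(i)+w_{ij}x_{ij}\phi_{ij}$. If $j$ is hard for $i$ and its group $G$ now satisfies $\sum_{k\in G}x_{ik}>1-\theta$, put $\nu^{(j)}(i)=\hat\nu^{(j)}(i)+\lambda\,\nu^{(s)}(i)^2/\hat\nu^{(j)}(i)$,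 where $s+1$ is the first job of $G$, and open a new empty hard group on $i$; otherwise $\nu^{(j)}(i)=\hat\nu^{(j)}(i)$. For $i\notin\mathcal S_j$, $\nu^{(j)}(i)=\nu^{(j-1)}(i)$. 3. *Correlated rounding.* For each group $G$ on each machine and each round $r=1,2,\dots$ a uniform variable $R_{G,r}\in[0,1]$ is drawn when $G$ is created. Job $j$ goes through rounds $r=1,2,\dots$ until it is assigned. In round $r$, for each machine $i$, with $G$ the group of $j$ on $i$: if $R_{G,r}\in[0,x_{ij})$, sample $N_{ij}$ with $\mathbb P[N_{ij}=k]=e^{-x_{ij}}x_{ij}^{k-1}/k!$ for $k\ge1$ and $\mathbb P[N_{ij}=0]=1-(1-e^{-x_{ij}})/x_{ij}$, else put $N_{ij}=0$; then replace $R_{G,r}$ by $R_{G,r}-x_{ij}$. If $S=\sum_iN_{ij}>0$, assign $j$ to $i$ with probability $N_{ij}/S$. All samples are independent. **Dual program (SDP-LB)** of the semidefinite relaxation, with variables $y_j\in\mathbb R$ and $\nu,v_{ij}\in\mathbb R^M$: maximize $\sum_j y_j-\frac12\|\nu\|^2$ subject to $y_j\le w_{ij}^2-\frac12\|v_{ij}\|^2+\langle\nu,v_{ij}\rangle$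 for all $j$ and $i\in\mathcal S_j$, and $\langle v_{ij},v_{i'k}\rangle\le 2w_{ij}w_{i'k}\mathbf 1_{\{i=i'\}}$ for all $(i,j)\ne(i',k)$ with $i\in\mathcal S_j$, $i'\in\mathcal S_k$. The algorithm constructs $y_j=\sum_{e\in\mathcal S_j}x_{ej}f_{ej}(x_{ej})$, $\nu=\nu^{(n)}$, and $v_{ij}=\min\{\nu^{(j-1)}(i)/w_{ij},\sqrt2\}\,w_{ij}\,\mathbf e_i$ (with $v_{ij}=0$ if $w_{ij}=0$). **Theorem.** For every finite set of machines, step 1 can be carried out online on every instance; and whichever choices are made in step 1 (as a function of the jobs revealed so far), the algorithm is a randomized online algorithm that assigns every job to a feasible machine, with $\mathbb P[X_{ij}=1]=x_{ij}$ for all $i,j$ (so that $\ell_i$ is the expected load of $i$ before job $j$), and it is $4.9843$-competitive. Moreover, on every instance the constructed dual solution is feasible for (SDP-LB) and $$\sum_j y_j-\tfrac12\|\nu\|^2\ \ge\ \gamma\sum_{i\in M}\mathbb E[L_i^2],\qquad \gamma=\frac1{4.9843}.$$ -/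

import Mathlib

open MeasureTheory

noncomputable section

namespace OnlineLB

/-! ## The online load balancing problem on unrelated machines -/

/-- A job for the machine set `Fin m`: a nonempty set of feasible machines and a nonnegative weight
on each of them (the weights outside the feasible set play no role). -/
structure Job (m : ℕ) where
  feasible : Finset (Fin m)
  feasible_nonempty : feasible.Nonempty
  weight : Fin m → ℝ
  weight_nonneg : ∀ i ∈ feasible, 0 ≤ weight i

/-- The load of machine `i` if the jobs `J 0, …, J (n - 1)` are assigned according to `a`. -/
def load {m n : ℕ} (J : Fin n → Job m) (a : Fin n → Fin m) (i : Fin m) : ℝ :=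
  ∑ j, if a j = i then (J j).weight i else 0

/-- The objective: the sum of the squared loads. -/
def cost {m n : ℕ} (J : Fin n → Job m) (a : Fin n → Fin m) : ℝ :=
  ∑ i, load J a i ^ 2

/-- The jobs that arrive strictly before job `j`. -/
def before {m n : ℕ} (J : Fin n → Job m) (j : Fin n) : Fin (j : ℕ) → Job m :=
  fun k => J (Fin.castLE j.isLt.le k)

/-- The jobs up to and including job `j`: all that is revealed when `j` has to be assigned. -/
def upTo {m n : ℕ} (J : Fin n → Job m) (j : Fin n) : Fin ((j : ℕ) + 1) → Job m :=
  fun k => J (Fin.castLE (Nat.succ_le_of_lt j.isLt) k)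

/-- A randomized online algorithm for the machine set `Fin m`: internal random bits, drawn from a
fixed probability space, and a decision for the last job of every sequence of revealed jobs.  The
decision sees only the revealed jobs and the random bits (hence also the earlier decisions). -/
structure RandomizedAlgorithm (m : ℕ) where
  Ω : Type
  measurableSpace : MeasurableSpace Ω
  P : Measure Ω
  isProbabilityMeasure : IsProbabilityMeasure P
  choose : (n : ℕ) → (Fin (n + 1) → Job m) → Ω → Fin m

attribute [instance] RandomizedAlgorithm.measurableSpace RandomizedAlgorithm.isProbabilityMeasure

namespace RandomizedAlgorithm

variable {m : ℕ}

/-- Every decision is a random variable, and assigns the job to one of its feasible machines. -/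
def IsValid (A : RandomizedAlgorithm m) : Prop :=
  ∀ (n : ℕ) (J : Fin (n + 1) → Job m),
    Measurable (A.choose n J) ∧ ∀ ω, A.choose n J ω ∈ (J (Fin.last n)).feasible

/-- The (random) assignment of all jobs of an instance. -/
def assignment (A : RandomizedAlgorithm m) {n : ℕ} (J : Fin n → Job m) (ω : A.Ω) : Fin n → Fin m :=
  fun j => A.choose j (upTo J j) ω

/-- The expected cost `∑ i, 𝔼[L_i ^ 2]` on an instance. -/
def expectedCost (A : RandomizedAlgorithm m) {n : ℕ} (J : Fin n → Job m) : ℝ :=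
  ∫ ω, cost J (A.assignment J ω) ∂A.P

/-- `A` is `c`-competitive: on every instance its expected cost is at most `c` times the cost of
every feasible offline assignment, that is, at most `c` times the offline optimum. -/
def IsCompetitive (A : RandomizedAlgorithm m) (c : ℝ) : Prop :=
  ∀ (n : ℕ) (J : Fin n → Job m) (a : Fin n → Fin m), (∀ j, a j ∈ (J j).feasible) →
    A.expectedCost J ≤ c * cost J a

end RandomizedAlgorithm

/-! ## The dual of the semidefinite relaxation, in vector form -/

/-- The variables of the dual program. -/
structure DualSolution (m n : ℕ) where
  y : Fin n → ℝ
  nu : EuclideanSpace ℝ (Fin m)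
  v : Fin m → Fin n → EuclideanSpace ℝ (Fin m)

namespace DualSolution

variable {m n : ℕ}

def objective (D : DualSolution m n) : ℝ :=
  ∑ j, D.y j - 1 / 2 * ‖D.nu‖ ^ 2

def IsFeasible (D : DualSolution m n) (J : Fin n → Job m) : Prop :=
  (∀ j, ∀ i ∈ (J j).feasible,
    D.y j ≤ (J j).weight i ^ 2 - 1 / 2 * ‖D.v i j‖ ^ 2 + inner ℝ D.nu (D.v i j)) ∧
  (∀ j k, ∀ i ∈ (J j).feasible, ∀ i' ∈ (J k).feasible, (i, j) ≠ (i', k) →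
    inner ℝ (D.v i j) (D.v i' k) ≤
      if i = i' then 2 * (J j).weight i * (J k).weight i' else 0)

end DualSolution

/-! ## Constants -/

def gam : ℝ := 1 / 4.9843
def lowA : ℝ := 1.0326
def highB : ℝ := 1.6208
def theta : ℝ := 0.0535
def beta : ℝ := Real.sqrt (2 / 5)
def delta : ℝ := 0.02602
def lam : ℝ := 0.02753

/-! ## The deterministic part: water-filling, grouping and dual vector -/

/-- What the algorithm stores for one machine `i`. -/
structure MachineState where
  /-- the expected load, that is, the sum of `w_ij * x_ij` over the jobs so far -/
  expLoad : ℝ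
  /-- the current entry `ν(i)` of the dual vector -/
  nu : ℝ
  /-- the index of the current (not full) hard group -/
  group : ℕ
  /-- the total fractional value of the jobs in the current hard group -/
  mass : ℝ
  /-- the value of `ν(i)` just before the first job of the current hard group arrived (`none` if
  the group is still empty) -/
  start : Option ℝ

def MachineState.init : MachineState :=
  { expLoad := 0, nu := 0, group := 0, mass := 0, start := none }

/-- The outcome of water-filling for one job: the fractional assignment `x` and the rates `φ`. -/
structure Fractional (m : ℕ) where
  x : Fin m → ℝ
  phi : Fin m → ℝ

/-- The ratio `q_ij = ν(i) / w_ij` lies in the critical interval `[a, b]`. -/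
def Critical (nu w : ℝ) : Prop := nu / w ∈ Set.Icc lowA highB

/-- `φ` is a value of the rate function at the fraction `t`: it is `β` for critical ratios as long
as `t` is below the threshold `θ`, and `β + δ` otherwise.  At the threshold, where the rate jumps,
it may take every value in between: while the level of the water rises through the jump, the
fraction rests at `θ`. -/
def IsRate (nu w t φ : ℝ) : Prop :=
  (¬ Critical nu w ∨ theta < t → φ = beta + delta) ∧
  (Critical nu w ∧ t < theta → φ = beta) ∧
  (Critical nu w ∧ t = theta → beta ≤ φ ∧ φ ≤ beta + delta)

/-- The potential `γ (w² + 2 w 𝔼[L]) + ((ν + w t φ)² - ν²) / (2 t)` at the fraction `t`, with the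
factor `1 / t` cancelled so that it is also right at `t = 0`. -/
def potential (s : MachineState) (w t φ : ℝ) : ℝ :=
  gam * (w ^ 2 + 2 * w * s.expLoad) + (φ * w * s.nu + φ ^ 2 * w ^ 2 * t / 2)

/-- `F` is a water-filling solution for the job `job` in the state `s`: a fractional assignment of
total value one to feasible machines in which every used machine has the lowest potential. -/
structure IsEquilibrium {m : ℕ} (s : Fin m → MachineState) (job : Job m) (F : Fractional m) :
    Prop where
  nonneg : ∀ i, 0 ≤ F.x i
  eq_zero : ∀ i, i ∉ job.feasible → F.x i = 0
  sum_eq_one : ∑ i, F.x i = 1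
  rate : ∀ i ∈ job.feasible, IsRate (s i).nu (job.weight i) (F.x i) (F.phi i)
  le_of_pos : ∀ e ∈ job.feasible, ∀ i ∈ job.feasible, 0 < F.x e →
    potential (s e) (job.weight e) (F.x e) (F.phi e) ≤
      potential (s i) (job.weight i) (F.x i) (F.phi i)

/-- The job is hard for machine `i` (otherwise it is easy for `i`). -/
def IsHard {m : ℕ} (s : MachineState) (job : Job m) (F : Fractional m) (i : Fin m) : Prop :=
  i ∈ job.feasible ∧ Critical s.nu (job.weight i) ∧ F.x i ≤ theta

/-- `ν̂(i)`: the entry of the dual vector after the job, before a possible bonus. -/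
def nuHat {m : ℕ} (s : MachineState) (job : Job m) (F : Fractional m) (i : Fin m) : ℝ :=
  s.nu + job.weight i * F.x i * F.phi i

open Classical in
/-- The update of machine `i` when a job arrives.  An easy job is a group of its own.  A hard job
joins the current hard group; if this group becomes full (its mass exceeds `1 - θ`), then the bonus
`λ * ν(start)² / ν̂` is added to the dual vector and a new, empty hard group is opened. -/
def updateMachine {m : ℕ} (s : MachineState) (job : Job m) (F : Fractional m) (i : Fin m) :
    MachineState :=
  if i ∉ job.feasible then s
  else if ¬ IsHard s job F i then
    { s with
      expLoad := s.expLoad + job.weight i * F.x i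
      nu := nuHat s job F i }
  else if 1 - theta < s.mass + F.x i then
    { expLoad := s.expLoad + job.weight i * F.x i
      nu := nuHat s job F i + lam * (s.start.getD s.nu) ^ 2 / nuHat s job F i
      group := s.group + 1
      mass := 0
      start := none }
  else
    { expLoad := s.expLoad + job.weight i * F.x i
      nu := nuHat s job F i
      group := s.group
      mass := s.mass + F.x i
      start := some (s.start.getD s.nu) }

/-- An online rule that produces a fractional assignment for the last of the revealed jobs. -/
abbrev FractionalRule (m : ℕ) : Type := (n : ℕ) → (Fin (n + 1) → Job m) → Fractional m

/-- The states of the machines after the jobs `J 0, …, J (n - 1)` have been handled. -/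
def state {m : ℕ} (W : FractionalRule m) : (n : ℕ) → (Fin n → Job m) → Fin m → MachineState
  | 0, _ => fun _ => MachineState.init
  | n + 1, J => fun i =>
      updateMachine (state W n (fun k => J k.castSucc) i) (J (Fin.last n)) (W n J) i

/-- The rule outputs a water-filling solution at every step. -/
def IsWaterFilling {m : ℕ} (W : FractionalRule m) : Prop :=
  ∀ (n : ℕ) (J : Fin (n + 1) → Job m),
    IsEquilibrium (state W n (fun k => J k.castSucc)) (J (Fin.last n)) (W n J)

/-- The dual solution constructed by the algorithm: `y_j = ∑ e, x_ej f_ej(x_ej)`, the vector `v_ij`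
is supported on `i` with entry `α_ij w_ij`, where `α_ij = min (ν^(j-1)(i) / w_ij) √2`, and `ν` is
the final dual vector. -/
def dualSolution {m n : ℕ} (W : FractionalRule m) (J : Fin n → Job m) : DualSolution m n where
  y j := ∑ e ∈ (J j).feasible, (W j (upTo J j)).x e *
    potential (state W j (before J j) e) ((J j).weight e)
      ((W j (upTo J j)).x e) ((W j (upTo J j)).phi e)
  nu := WithLp.toLp 2 fun i => (state W n J i).nu
  v i j := EuclideanSpace.single i
    (min ((state W j (before J j) i).nu / (J j).weight i) (Real.sqrt 2) * (J j).weight i)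

/-! ## The randomized part: online correlated rounding -/

/-- The names of the groups on a machine: `inl j` is the singleton group of the easy job with
index `j`, and `inr k` is the hard group with index `k`. -/
abbrev GroupName : Type := ℕ ⊕ ℕ

open Classical in
/-- The group of the last job on machine `i`. -/
def groupOf {m : ℕ} (W : FractionalRule m) (n : ℕ) (J : Fin (n + 1) → Job m) (i : Fin m) :
    GroupName :=
  if IsHard (state W n (fun k => J k.castSucc) i) (J (Fin.last n)) (W n J) i
  then Sum.inr (state W n (fun k => J k.castSucc) i).group
  else Sum.inl n

/-- The names of the independent uniform random variables used by the rounding: one for every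
machine, group and round; one for every machine, job and round to sample a number of tickets; and
one for every job and round to pick a ticket. -/
inductive Seed (m : ℕ) : Type
  | recommend (i : Fin m) (G : GroupName) (r : ℕ)
  | tickets (i : Fin m) (j r : ℕ)
  | pick (j r : ℕ)

/-- The sample space: a number in `[0, 1]` for every seed. -/
abbrev Seeds (m : ℕ) : Type := Seed m → unitInterval

/-- The seeds are independent and uniform. -/
def seedMeasure (m : ℕ) : Measure (Seeds m) :=
  Measure.infinitePi fun _ : Seed m => (volume : Measure unitInterval)

/-- The probability mass function of the modified Poisson distribution with parameter `p > 0`. -/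
def poiTilde (p : ℝ) (k : ℕ) : ℝ :=
  if k = 0 then 1 - (1 - Real.exp (-p)) / p else Real.exp (-p) * p ^ (k - 1) / k.factorial

/-- A sample of the modified Poisson distribution, obtained from a uniform `u` by inversion of the
cumulative distribution function. -/
def samplePoiTilde (p u : ℝ) : ℕ :=
  sInf {k : ℕ | u < ∑ l ∈ Finset.range (k + 1), poiTilde p l}

open Classical in
/-- The number of tickets that machine `i` generates for the last job in round `r`, where `R` holds
the current values of the variables `R_{G,r}`: the group of the job recommends the job if its
variable lies in `[0, x_i)`, and then a modified Poisson number of tickets is drawn. -/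
def ticketCount {m : ℕ} (W : FractionalRule m) (ω : Seeds m) (R : Fin m → GroupName → ℕ → ℝ)
    (n : ℕ) (J : Fin (n + 1) → Job m) (r : ℕ) (i : Fin m) : ℕ :=
  if R i (groupOf W n J i) r ∈ Set.Ico 0 ((W n J).x i)
  then samplePoiTilde ((W n J).x i) (ω (Seed.tickets i n r))
  else 0

open Classical in
/-- The variables `R_{G,r}` of every machine after the jobs `J 0, …, J (n - 1)` have been handled.
They start uniform; a job decreases the variable of its group on machine `i` by `x_i` in every
round `r` that it reaches, that is, for which no ticket was generated in the rounds before. -/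
def remaining {m : ℕ} (W : FractionalRule m) (ω : Seeds m) :
    (n : ℕ) → (Fin n → Job m) → Fin m → GroupName → ℕ → ℝ
  | 0, _ => fun i G r => ω (Seed.recommend i G r)
  | n + 1, J => fun i G r =>
      if G = groupOf W n J i ∧
          ∀ r' < r, ∑ e, ticketCount W ω (remaining W ω n fun k => J k.castSucc) n J r' e = 0
      then remaining W ω n (fun k => J k.castSucc) i G r - (W n J).x i
      else remaining W ω n (fun k => J k.castSucc) i G r

open Classical in
/-- Pick one of the tickets uniformly at random by means of a uniform `u`: the result is the first
machine `i` with `u * S < N 0 + … + N i`, where `S` is the total number of tickets (`none` if there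
is no such machine, which needs `u = 1` or `S = 0`). -/
def pickTicket {m : ℕ} (N : Fin m → ℕ) (u : ℝ) : Option (Fin m) :=
  if h : (Finset.univ.filter fun i : Fin m =>
      u * ((∑ e, N e : ℕ) : ℝ) < ((∑ e ∈ Finset.Iic i, N e : ℕ) : ℝ)).Nonempty
  then some (Finset.min' _ h)
  else none

open Classical in
/-- The machine of the last job: in the first round that generates a ticket, one of the tickets is
picked uniformly at random.  (With probability zero there is no such round, or the pick fails; then
the first feasible machine is used.) -/
def roundedChoice {m : ℕ} (W : FractionalRule m) (n : ℕ) (J : Fin (n + 1) → Job m)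
    (ω : Seeds m) : Fin m :=
  let N : ℕ → Fin m → ℕ := ticketCount W ω (remaining W ω n fun k => J k.castSucc) n J
  let fallback : Fin m := (J (Fin.last n)).feasible.min' (J (Fin.last n)).feasible_nonempty
  if h : ∃ r, 0 < ∑ e, N r e
  then (pickTicket (N (Nat.find h)) (ω (Seed.pick n (Nat.find h)))).getD fallback
  else fallback

/-- The full algorithm: water-filling by the rule `W`, online grouping of the hard jobs, dual
updates, and online correlated rounding. -/
def fullAlgorithm {m : ℕ} (W : FractionalRule m) : RandomizedAlgorithm m where
  Ω := Seeds m
  measurableSpace := inferInstance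
  P := seedMeasure m
  isProbabilityMeasure := by unfold seedMeasure; infer_instance
  choose := roundedChoice W

end OnlineLB

end

/-! The analysis is a dual fitting argument. By weak duality
(`DualSolution.IsFeasible.objective_le_cost`) a feasible dual solution bounds every offline cost
from below. So it suffices that the constructed dual is feasible (`dualSolution_isFeasible`) and
that its objective is at least `γ` times the expected cost (`gam_mul_expectedCost_le`).

Payment. Multiplying the potential by `x` turns its second part into `(ν̂² - ν²) / 2`, so `∑ y_j` is
`γ ∑ (w² x + 2 w x ℓ)` plus these differences (`dualY_eq`). The first sum is the cost that
uncorrelated jobs would have. The differences telescope to `‖ν‖² / 2`, except that bonuses increase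
`ν` without a matching term. They are financed by negative correlation: two jobs of one hard group
land together with probability at most `groupCorr * x * x'`, where `groupCorr < 0.5676`, and a full
group has enough pairs to cover its bonus (`group_bounds`, `bonus_le_gain`, `half_sq_nu_le`).

Feasibility. Water-filling makes `y_j` at most the potential on every feasible machine. Divided by
`w²`, the constraint on one machine is a polynomial inequality in `q = ν / w`, `x` and `φ`
(`scaled_constraint`), provided that `ν` is at least `β + 0.003` times the expected load. The rate
`β + δ` is affordable unless `q` lies in `[a, b]` and `x` is small; there the rate `β` is used, and
the bonus of a full group makes up for the slower growth. The invariant `Dominates` follows this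
balance through easy jobs, hard jobs and closing groups.

Rounding. In one round the tickets from machine `i` are Poisson with parameter `x_i` and independent
over the machines (`lintegral_ticket`). Their total is therefore Poisson with parameter 1: a job is
assigned with probability `1 - 1/e`, and then to `i` with conditional probability `x_i`. Jobs of a
group that reach the same round use disjoint intervals of one uniform variable, so at most one of
them gets tickets from that machine. Writing `N_i / S` as the integral of `N_i * t ^ (S - 1)` over
`[0, 1]` makes correlations factor over the machines, and `pairPotential` then does not increase in
expectation from round to round.

Existence of water-filling solutions follows from the intermediate value theorem in the water level,
with a second application in the rate `φ` where the rate jumps. -/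

noncomputable section

namespace OnlineLB

open ProbabilityTheory
open scoped ENNReal

/-! ## Independence of functions of disjoint sets of coordinates -/

section Independence

variable {ι : Type*} {X : ι → Type*} [∀ i, MeasurableSpace (X i)] [∀ i, Nonempty (X i)]

/-- Overwriting the coordinates outside `S` by constants does not change `f`, and the overwriting
map is measurable for the σ-algebra generated by the coordinates in `S`. -/
lemma measurable_iSup_comap_of_dependsOn {β : Type*} [MeasurableSpace β] {f : (∀ i, X i) → β}
    (hf : Measurable f) {S : Set ι} (hfS : DependsOn f S) :
    Measurable[⨆ i ∈ S, MeasurableSpace.comap (fun ω : ∀ i, X i => ω i) inferInstance] f := by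
  classical
  have h : f = f ∘ fun ω i => if i ∈ S then ω i else Classical.arbitrary (X i) := by
    funext ω
    refine hfS fun i hi => ?_
    simp [hi]
  rw [h]
  refine hf.comp ?_
  refine @measurable_pi_lambda _ _ _ (_) _ _ fun i => ?_
  by_cases hi : i ∈ S
  · simp only [hi, if_true]
    refine Measurable.of_comap_le ?_
    exact le_iSup₂_of_le i hi le_rfl
  · simp only [hi, if_false]
    exact measurable_const

lemma lintegral_mul_of_dependsOn {P : ∀ i, Measure (X i)} [∀ i, IsProbabilityMeasure (P i)]
    {f g : (∀ i, X i) → ℝ≥0∞} (hf : Measurable f) (hg : Measurable g) {S T : Set ι}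
    (hfS : DependsOn f S) (hgT : DependsOn g T) (hST : Disjoint S T) :
    ∫⁻ ω, f ω * g ω ∂Measure.infinitePi P =
      (∫⁻ ω, f ω ∂Measure.infinitePi P) * ∫⁻ ω, g ω ∂Measure.infinitePi P := by
  have hle : ∀ i, MeasurableSpace.comap (fun ω : ∀ i, X i => ω i) inferInstance ≤
      (inferInstance : MeasurableSpace (∀ i, X i)) := fun i =>
    (measurable_pi_apply i).comap_le
  have hind : iIndep (fun i => MeasurableSpace.comap (fun ω : ∀ i, X i => ω i) inferInstance)
      (Measure.infinitePi P) :=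
    iIndepFun_infinitePi (P := P) (X := fun i (x : X i) => x) fun i => measurable_id
  exact lintegral_mul_eq_lintegral_mul_lintegral_of_independent_measurableSpace
    (iSup₂_le fun i _ => hle i) (iSup₂_le fun i _ => hle i)
    (indep_iSup_of_disjoint hle hind hST)
    (measurable_iSup_comap_of_dependsOn hf hfS) (measurable_iSup_comap_of_dependsOn hg hgT)

lemma lintegral_prod_of_dependsOn {P : ∀ i, Measure (X i)} [∀ i, IsProbabilityMeasure (P i)]
    {κ : Type*} (t : Finset κ) {f : κ → (∀ i, X i) → ℝ≥0∞} {S : κ → Set ι}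
    (hf : ∀ k ∈ t, Measurable (f k)) (hfS : ∀ k ∈ t, DependsOn (f k) (S k))
    (hS : ∀ k ∈ t, ∀ l ∈ t, k ≠ l → Disjoint (S k) (S l)) :
    ∫⁻ ω, ∏ k ∈ t, f k ω ∂Measure.infinitePi P =
      ∏ k ∈ t, ∫⁻ ω, f k ω ∂Measure.infinitePi P := by
  classical
  induction t using Finset.induction_on with
  | empty => simp
  | insert a t ha ih =>
    simp only [Finset.prod_insert ha]
    rw [lintegral_mul_of_dependsOn (S := S a) (T := ⋃ k ∈ t, S k) (hf a (by simp)), ih]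
    · exact fun k hk => hf k (Finset.mem_insert_of_mem hk)
    · exact fun k hk => hfS k (Finset.mem_insert_of_mem hk)
    · exact fun k hk l hl => hS k (Finset.mem_insert_of_mem hk) l (Finset.mem_insert_of_mem hl)
    · exact Finset.measurable_prod _ fun k hk => hf k (Finset.mem_insert_of_mem hk)
    · exact hfS a (by simp)
    · intro x y h
      refine Finset.prod_congr rfl fun k hk => hfS k (Finset.mem_insert_of_mem hk) fun i hi =>
        h i (Set.mem_biUnion hk hi)
    · rw [Set.disjoint_iUnion₂_right]
      exact fun k hk => hS a (by simp) k (Finset.mem_insert_of_mem hk) (by rintro rfl; exact ha hk)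

end Independence

/-! ## The modified Poisson distribution -/

lemma poiTilde_nonneg {p : ℝ} (hp : 0 < p) (k : ℕ) : 0 ≤ poiTilde p k := by
  unfold poiTilde
  split_ifs
  · have : (1 - Real.exp (-p)) / p ≤ 1 := by
      rw [div_le_one hp]; linarith [Real.add_one_le_exp (-p)]
    linarith
  · positivity

/-- The probabilities of the Poisson distribution. -/
def poisson (p : ℝ) (k : ℕ) : ℝ := Real.exp (-p) * p ^ k / k.factorial

/-- This identity is the purpose of the modified distribution: a recommendation of probability `p`
followed by a modified Poisson sample gives a Poisson variable. The correction at `0` is the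
probability `1 - p` of not being recommended. -/
lemma mul_poiTilde {p : ℝ} (hp : 0 < p) (k : ℕ) :
    p * poiTilde p k = poisson p k - if k = 0 then 1 - p else 0 := by
  unfold poiTilde poisson
  rcases k with _ | k
  · simp; field_simp; ring
  · simp [pow_succ]; field_simp

lemma hasSum_poisson_mul_pow (p t : ℝ) :
    HasSum (fun k => poisson p k * t ^ k) (Real.exp (-(p * (1 - t)))) := by
  have h := (NormedSpace.expSeries_div_hasSum_exp (p * t)).mul_left (Real.exp (-p))
  rw [← Real.exp_eq_exp_ℝ, ← Real.exp_add] at h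
  convert! h using 1
  · funext k; unfold poisson; rw [mul_pow]; ring
  · ring_nf

lemma hasSum_poisson (p : ℝ) : HasSum (poisson p) 1 := by
  simpa using hasSum_poisson_mul_pow p 1

lemma hasSum_poisson_mul_deriv (p t : ℝ) :
    HasSum (fun k => poisson p k * (k * t ^ (k - 1))) (p * Real.exp (-(p * (1 - t)))) := by
  have h := (hasSum_poisson_mul_pow p t).mul_left p
  -- The term at `0` vanishes, and shifting the index by one turns the series into `p` times the
  -- generating function.
  rw [← hasSum_nat_add_iff' 1]
  simp only [Finset.range_one, Finset.sum_singleton, Nat.cast_zero, zero_mul, mul_zero, sub_zero]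
  convert! h using 1
  funext k
  unfold poisson
  rw [Nat.factorial_succ]
  push_cast
  field_simp
  ring

lemma hasSum_poiTilde {p : ℝ} (hp : 0 < p) : HasSum (poiTilde p) 1 := by
  have h := ((hasSum_poisson p).sub (hasSum_ite_eq 0 (1 - p))).mul_left p⁻¹
  convert! h using 1
  · funext k
    rw [← mul_poiTilde hp]; field_simp
  · field_simp; ring

lemma poisson_nonneg {p : ℝ} (hp : 0 ≤ p) (k : ℕ) : 0 ≤ poisson p k := by
  unfold poisson; positivity

/-- The cumulative distribution function of the modified Poisson distribution. -/
def cdfPoiTilde (p : ℝ) (k : ℕ) : ℝ := ∑ l ∈ Finset.range k, poiTilde p l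

lemma samplePoiTilde_eq_iff {p u : ℝ} (hp : 0 < p) (hu1 : u < 1) (hu0 : 0 ≤ u) (k : ℕ) :
    samplePoiTilde p u = k ↔ u ∈ Set.Ico (cdfPoiTilde p k) (cdfPoiTilde p (k + 1)) := by
  have hmono : Monotone (cdfPoiTilde p) := fun a b hab =>
    Finset.sum_le_sum_of_subset_of_nonneg (Finset.range_mono hab) fun l _ _ => poiTilde_nonneg hp l
  have hne : {k : ℕ | u < cdfPoiTilde p (k + 1)}.Nonempty := by
    have h := ((hasSum_poiTilde hp).tendsto_sum_nat.comp (Filter.tendsto_add_atTop_nat 1))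
    exact (h.eventually (lt_mem_nhds hu1)).exists
  have hdef : samplePoiTilde p u = sInf {k : ℕ | u < cdfPoiTilde p (k + 1)} := rfl
  rw [hdef]
  constructor
  · rintro rfl
    refine ⟨?_, Nat.sInf_mem hne⟩
    rcases h : sInf {k : ℕ | u < cdfPoiTilde p (k + 1)} with _ | l
    · simpa [cdfPoiTilde] using hu0
    · have := Nat.notMem_of_lt_sInf (m := l) (s := {k : ℕ | u < cdfPoiTilde p (k + 1)}) (by omega)
      simpa using this
  · rintro ⟨h1, h2⟩
    refine le_antisymm (Nat.sInf_le h2) ?_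
    by_contra! hlt
    have h3 : u < _ := Nat.sInf_mem hne
    have := hmono (Nat.succ_le_of_lt hlt)
    simp only [Nat.succ_eq_add_one] at this
    linarith

lemma measurable_samplePoiTilde (p : ℝ) : Measurable (samplePoiTilde p) := by
  refine measurable_to_countable' fun k => ?_
  have hF : ∀ k, MeasurableSet {u : ℝ | u < cdfPoiTilde p (k + 1)} := fun k =>
    measurableSet_lt measurable_id measurable_const
  -- For an arbitrary `p` the partial sums need not exceed `u`; the second set accounts for the
  -- convention `sInf ∅ = 0`.
  have h : samplePoiTilde p ⁻¹' {k} =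
      ({u | u < cdfPoiTilde p (k + 1)} ∩ ⋂ l ∈ Set.Iio k, {u | u < cdfPoiTilde p (l + 1)}ᶜ) ∪
      {u | k = 0 ∧ ∀ l, ¬ u < cdfPoiTilde p (l + 1)} := by
    ext u
    have hdef : samplePoiTilde p u = sInf {k : ℕ | u < cdfPoiTilde p (k + 1)} := rfl
    simp only [Set.mem_preimage, Set.mem_singleton_iff, hdef, Set.mem_union, Set.mem_inter_iff,
      Set.mem_ofPred_eq, Set.mem_iInter, Set.mem_Iio, Set.mem_compl_iff]
    by_cases hne : {k : ℕ | u < cdfPoiTilde p (k + 1)}.Nonempty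
    · have h2 : ¬ (k = 0 ∧ ∀ l, ¬ u < cdfPoiTilde p (l + 1)) := by
        rintro ⟨_, h⟩; obtain ⟨l, hl⟩ := hne; exact h l hl
      simp only [h2, or_false]
      constructor
      · rintro rfl
        exact ⟨Nat.sInf_mem hne, fun l hl => Nat.notMem_of_lt_sInf hl⟩
      · rintro ⟨h3, h4⟩
        refine le_antisymm (Nat.sInf_le h3) ?_
        by_contra! hlt
        exact h4 _ hlt (Nat.sInf_mem hne)
    · have h2 : ∀ l, ¬ u < cdfPoiTilde p (l + 1) := fun l hl => hne ⟨l, hl⟩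
      simp [h2, eq_comm]
  rw [h]
  refine ((hF k).inter (MeasurableSet.biInter (Set.to_countable _) fun l _ => (hF l).compl)).union ?_
  have : {u : ℝ | k = 0 ∧ ∀ l, ¬ u < cdfPoiTilde p (l + 1)} =
      {u | k = 0} ∩ ⋂ l, {u | u < cdfPoiTilde p (l + 1)}ᶜ := by
    ext; simp
  rw [this]
  exact (MeasurableSet.const _).inter (MeasurableSet.iInter fun l => (hF l).compl)

/-! ### Seeds and the distribution of the number of tickets. -/

instance (m : ℕ) : IsProbabilityMeasure (seedMeasure m) := by unfold seedMeasure; infer_instance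

lemma lintegral_seed_mul {m : ℕ} {f g : Seeds m → ℝ≥0∞} (hf : Measurable f) (hg : Measurable g)
    {S T : Set (Seed m)} (hfS : DependsOn f S) (hgT : DependsOn g T) (hST : Disjoint S T) :
    ∫⁻ ω, f ω * g ω ∂seedMeasure m = (∫⁻ ω, f ω ∂seedMeasure m) * ∫⁻ ω, g ω ∂seedMeasure m :=
  lintegral_mul_of_dependsOn hf hg hfS hgT hST

lemma lintegral_seed_eval {m : ℕ} (s : Seed m) {f : unitInterval → ℝ≥0∞} (hf : Measurable f) :
    ∫⁻ ω, f (ω s) ∂seedMeasure m = ∫⁻ u, f u := by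
  have h := measurePreserving_eval_infinitePi
    (fun _ : Seed m => (volume : Measure unitInterval)) s
  exact h.lintegral_comp hf

/-- The number of tickets as a function of the parameter `x` of the modified Poisson distribution,
the decrease `c` of the recommendation variable so far, and two uniform variables. -/
def ticket (x c u v : ℝ) : ℕ := if u - c ∈ Set.Ico 0 x then samplePoiTilde x v else 0

lemma measurable_ticket (x c : ℝ) : Measurable fun p : ℝ × ℝ => ticket x c p.1 p.2 := by
  unfold ticket
  refine Measurable.ite ?_ ((measurable_samplePoiTilde x).comp measurable_snd) measurable_const
  exact (measurable_fst.sub_const c) measurableSet_Ico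

lemma volume_samplePoiTilde_eq {x : ℝ} (hx : 0 < x) (k : ℕ) :
    (volume : Measure unitInterval) {v | samplePoiTilde x v = k} = ENNReal.ofReal (poiTilde x k) := by
  have hF : ∀ k, cdfPoiTilde x k ∈ unitInterval := fun k =>
    ⟨Finset.sum_nonneg fun l _ => poiTilde_nonneg hx l,
      sum_le_hasSum _ (fun l _ => poiTilde_nonneg hx l) (hasSum_poiTilde hx)⟩
  have h : {v : unitInterval | samplePoiTilde x v = k} =ᵐ[volume]
      Set.Ico (⟨_, hF k⟩ : unitInterval) ⟨_, hF (k + 1)⟩ := by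
    have h1 : ∀ᵐ v : unitInterval, v ≠ 1 := by
      rw [ae_iff]; simp
    filter_upwards [h1] with v hv
    have hv1 : (v : ℝ) < 1 := lt_of_le_of_ne v.2.2 fun h => hv (Subtype.ext h)
    exact propext (samplePoiTilde_eq_iff hx hv1 v.2.1 k)
  rw [measure_congr h, unitInterval.volume_Ico]
  congr 1
  simp [cdfPoiTilde, Finset.sum_range_succ]

lemma volume_recommend {x c : ℝ} (hx : 0 ≤ x) (hc : 0 ≤ c) (hxc : c + x ≤ 1) :
    (volume : Measure unitInterval) {u | (u : ℝ) - c ∈ Set.Ico 0 x} = ENNReal.ofReal x := by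
  have h : {u : unitInterval | (u : ℝ) - c ∈ Set.Ico 0 x} =
      Set.Ico (⟨c, hc, by linarith⟩ : unitInterval) ⟨c + x, by linarith, hxc⟩ := by
    ext u
    simp only [Set.mem_Ico, Set.mem_ofPred_eq, ← Subtype.coe_le_coe, ← Subtype.coe_lt_coe]
    constructor <;> rintro ⟨h1, h2⟩ <;> constructor <;> linarith
  rw [h, unitInterval.volume_Ico]
  simp

lemma lintegral_nat_comp {Ω : Type*} [MeasurableSpace Ω] (μ : Measure Ω) {N : Ω → ℕ}
    (hN : Measurable N) (φ : ℕ → ℝ≥0∞) :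
    ∫⁻ ω, φ (N ω) ∂μ = ∑' k, φ k * μ {ω | N ω = k} := by
  rw [← lintegral_map (f := φ) (measurable_of_countable _) hN, lintegral_countable']
  congr 1; funext k
  rw [Measure.map_apply hN (measurableSet_singleton k)]; rfl

/-- The number of tickets has a Poisson distribution. -/
lemma lintegral_ticket {m : ℕ} {s s' : Seed m} (hs : s ≠ s') {x c : ℝ} (hx : 0 ≤ x) (hc : 0 ≤ c)
    (hxc : c + x ≤ 1) (φ : ℕ → ℝ≥0∞) :
    ∫⁻ ω, φ (ticket x c (ω s) (ω s')) ∂seedMeasure m =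
      ∑' k, φ k * ENNReal.ofReal (poisson x k) := by
  have hmeas : Measurable fun ω : Seeds m => ticket x c (ω s) (ω s') :=
    (measurable_ticket x c).comp (by fun_prop : Measurable fun ω : Seeds m => ((ω s : ℝ), (ω s' : ℝ)))
  rw [lintegral_nat_comp _ hmeas]
  congr 1; funext k; congr 1
  have hR : MeasurableSet {u : unitInterval | (u : ℝ) - c ∈ Set.Ico 0 x} :=
    (measurable_subtype_coe.sub_const c) measurableSet_Ico
  have hS : MeasurableSet {v : unitInterval | samplePoiTilde x v = k} :=
    ((measurable_samplePoiTilde x).comp measurable_subtype_coe) (measurableSet_singleton k)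
  -- Split according to whether the job is recommended: if it is, the second seed must produce `k`;
  -- otherwise the count is `0` with certainty.
  have h1 : ∀ ω : Seeds m, ({ω | ticket x c (ω s) (ω s') = k} : Set (Seeds m)).indicator 1 ω =
      {u : unitInterval | (u : ℝ) - c ∈ Set.Ico 0 x}.indicator (1 : unitInterval → ℝ≥0∞) (ω s) *
        {v : unitInterval | samplePoiTilde x v = k}.indicator (1 : unitInterval → ℝ≥0∞) (ω s') +
      {u : unitInterval | (u : ℝ) - c ∈ Set.Ico 0 x}ᶜ.indicator (1 : unitInterval → ℝ≥0∞) (ω s) *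
        (if k = 0 then 1 else 0) := by
    intro ω
    by_cases h : (ω s : ℝ) - c ∈ Set.Ico 0 x
    · simp only [Set.indicator_apply, ticket, h, Set.mem_compl_iff, Set.mem_ofPred_eq]
      simp
    · simp only [Set.indicator_apply, ticket, h, Set.mem_compl_iff, Set.mem_ofPred_eq]
      simp [eq_comm]
  have h2 : MeasurableSet {ω : Seeds m | ticket x c (ω s) (ω s') = k} :=
    hmeas (measurableSet_singleton k)
  rw [← lintegral_indicator_one h2, lintegral_congr h1, lintegral_add_left,
    lintegral_seed_mul (S := {s}) (T := {s'}), lintegral_mul_const,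
    lintegral_seed_eval s (f := {u : unitInterval | (u : ℝ) - c ∈ Set.Ico 0 x}.indicator 1),
    lintegral_seed_eval s (f := {u : unitInterval | (u : ℝ) - c ∈ Set.Ico 0 x}ᶜ.indicator 1),
    lintegral_seed_eval s' (f := {v : unitInterval | samplePoiTilde x v = k}.indicator 1),
    lintegral_indicator_one hR, lintegral_indicator_one hS, lintegral_indicator_one hR.compl,
    measure_compl hR (measure_ne_top _ _), measure_univ, volume_recommend hx hc hxc]
  -- The fraction `0` is separate because the modified Poisson law divides by its parameter.
  · rcases hx.eq_or_lt with rfl | hx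
    · rcases k with _ | k <;> simp [poisson]
    · rw [volume_samplePoiTilde_eq hx, ← ENNReal.ofReal_mul hx.le, ← ENNReal.ofReal_one,
        ← ENNReal.ofReal_sub _ hx.le, mul_poiTilde hx]
      split_ifs with hk
      · rw [ENNReal.ofReal_one, mul_one, ← ENNReal.ofReal_add _ (by linarith)]
        · congr 1; ring
        · rw [← if_pos (c := k = 0) (t := 1 - x) (e := 0) hk, ← mul_poiTilde hx]
          exact mul_nonneg hx.le (poiTilde_nonneg hx k)
      · simp
  all_goals first
    | exact (measurable_one.indicator hR)
    | exact (measurable_one.indicator hS)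
    | exact (measurable_one.indicator hR.compl)
    | exact (measurable_one.indicator hR).comp (measurable_pi_apply _)
    | exact (measurable_one.indicator hS).comp (measurable_pi_apply _)
    | exact (measurable_one.indicator hR.compl).comp (measurable_pi_apply _)
    | exact Measurable.mul (f := fun ω : Seeds m =>
          {u : unitInterval | (u : ℝ) - c ∈ Set.Ico 0 x}.indicator (1 : unitInterval → ℝ≥0∞) (ω s))
        ((measurable_one.indicator hR).comp (measurable_pi_apply s))
        ((measurable_one.indicator hS).comp (measurable_pi_apply s'))
    | (intro ω ω' h; simp only [h s rfl])
    | (intro ω ω' h; simp only [h s' rfl])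
    | simpa using hs

lemma tsum_ofReal_poisson {x : ℝ} (hx : 0 ≤ x) {f : ℕ → ℝ} (hf : ∀ k, 0 ≤ f k) {a : ℝ}
    (h : HasSum (fun k => poisson x k * f k) a) :
    ∑' k, ENNReal.ofReal (f k) * ENNReal.ofReal (poisson x k) = ENNReal.ofReal a := by
  rw [← h.tsum_eq, ENNReal.ofReal_tsum_of_nonneg
    (fun k => mul_nonneg (poisson_nonneg hx k) (hf k)) h.summable]
  congr 1; funext k
  rw [mul_comm, ENNReal.ofReal_mul (poisson_nonneg hx k)]

lemma lintegral_pow_ticket {m : ℕ} {s s' : Seed m} (hs : s ≠ s') {x c : ℝ} (hx : 0 ≤ x)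
    (hc : 0 ≤ c) (hxc : c + x ≤ 1) {t : ℝ} (ht : 0 ≤ t) :
    ∫⁻ ω, ENNReal.ofReal (t ^ ticket x c (ω s) (ω s')) ∂seedMeasure m =
      ENNReal.ofReal (Real.exp (-(x * (1 - t)))) := by
  rw [lintegral_ticket hs hx hc hxc fun k => ENNReal.ofReal (t ^ k)]
  exact tsum_ofReal_poisson hx (fun k => pow_nonneg ht k) (hasSum_poisson_mul_pow x t)

lemma lintegral_deriv_ticket {m : ℕ} {s s' : Seed m} (hs : s ≠ s') {x c : ℝ} (hx : 0 ≤ x)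
    (hc : 0 ≤ c) (hxc : c + x ≤ 1) {t : ℝ} (ht : 0 ≤ t) :
    ∫⁻ ω, ENNReal.ofReal (ticket x c (ω s) (ω s') * t ^ (ticket x c (ω s) (ω s') - 1))
        ∂seedMeasure m = ENNReal.ofReal (x * Real.exp (-(x * (1 - t)))) := by
  rw [lintegral_ticket hs hx hc hxc fun k => ENNReal.ofReal (k * t ^ (k - 1))]
  exact tsum_ofReal_poisson hx (fun k => by positivity) (hasSum_poisson_mul_deriv x t)

/-! ## Picking a ticket -/

lemma pickTicket_eq_some_iff {m : ℕ} (N : Fin m → ℕ) (u : ℝ) (i : Fin m) :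
    pickTicket N u = some i ↔
      u * ((∑ e, N e : ℕ) : ℝ) < ((∑ e ∈ Finset.Iic i, N e : ℕ) : ℝ) ∧
        ∀ i' < i, ((∑ e ∈ Finset.Iic i', N e : ℕ) : ℝ) ≤ u * ((∑ e, N e : ℕ) : ℝ) := by
  classical
  unfold pickTicket
  constructor
  · intro h
    split_ifs at h with hne
    simp only [Option.some.injEq] at h
    subst h
    refine ⟨by simpa using Finset.min'_mem _ hne, fun i' hi' => ?_⟩
    by_contra! hlt
    exact absurd (Finset.min'_le _ i' (by simpa using hlt)) (not_le.2 hi')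
  · rintro ⟨h1, h2⟩
    have hmem : i ∈ Finset.univ.filter fun i : Fin m =>
      u * ((∑ e, N e : ℕ) : ℝ) < ((∑ e ∈ Finset.Iic i, N e : ℕ) : ℝ) := by simpa using h1
    rw [dif_pos ⟨i, hmem⟩]
    simp only [Option.some.injEq]
    refine le_antisymm (Finset.min'_le _ _ hmem) ?_
    refine Finset.le_min' _ _ _ fun i' hi' => ?_
    by_contra! hlt
    have := h2 i' hlt
    simp only [Finset.mem_filter, Finset.mem_univ, true_and] at hi'
    linarith

/-- The tickets are laid out on `[0, S)` in the order of the machines, and `i` owns a half-open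
interval of length `N i`. The minimality condition for all smaller machines reduces to the immediate
predecessor, which is missing for the first machine. -/
lemma pickTicket_eq_some_iff_mem_Ico {m : ℕ} (N : Fin m → ℕ) {u : ℝ} (hu : 0 ≤ u) (i : Fin m) :
    pickTicket N u = some i ↔ u * ((∑ e, N e : ℕ) : ℝ) ∈
      Set.Ico ((∑ e ∈ Finset.Iio i, N e : ℕ) : ℝ) ((∑ e ∈ Finset.Iio i, N e : ℕ) + N i) := by
  have hI : ((∑ e ∈ Finset.Iic i, N e : ℕ) : ℝ) = (∑ e ∈ Finset.Iio i, N e : ℕ) + N i := by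
    rw [← Finset.Iio_insert i, Finset.sum_insert (by simp)]; push_cast; ring
  rw [pickTicket_eq_some_iff, hI, Set.mem_Ico, and_comm]
  refine and_congr_left fun _ => ⟨fun h => ?_, fun h i' hi' => le_trans ?_ h⟩
  · rcases Nat.eq_zero_or_pos (i : ℕ) with h0 | h0
    · have : Finset.Iio i = ∅ := by
        ext e; simp [Fin.lt_def, h0]
      rw [this]; simp; positivity
    · have h1 := h ⟨i - 1, by omega⟩ (by rw [Fin.lt_def]; simp; omega)
      have hI' : Finset.Iio i = Finset.Iic ⟨i - 1, by omega⟩ := by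
        ext e
        simp only [Finset.mem_Iio, Finset.mem_Iic, Fin.lt_def, Fin.le_def]
        omega
      rw [hI']
      exact h1
  · exact_mod_cast Finset.sum_le_sum_of_subset fun e he => by
      simp only [Finset.mem_Iic, Finset.mem_Iio] at he ⊢
      exact lt_of_le_of_lt he hi'

lemma pos_of_pickTicket_eq_some {m : ℕ} {N : Fin m → ℕ} {u : ℝ} (hu : 0 ≤ u) {i : Fin m}
    (h : pickTicket N u = some i) : 0 < N i := by
  rw [pickTicket_eq_some_iff_mem_Ico N hu] at h
  have := h.1.trans_lt h.2
  have h2 : (0 : ℝ) < N i := by linarith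
  exact_mod_cast h2

lemma measurableSet_pickTicket {m : ℕ} (N : Fin m → ℕ) (i : Fin m) :
    MeasurableSet {u : ℝ | pickTicket N u = some i} := by
  have : {u : ℝ | pickTicket N u = some i} =
      {u : ℝ | u * ((∑ e, N e : ℕ) : ℝ) < ((∑ e ∈ Finset.Iic i, N e : ℕ) : ℝ)} ∩
        ⋂ i' ∈ Set.Iio i,
          {u : ℝ | ((∑ e ∈ Finset.Iic i', N e : ℕ) : ℝ) ≤ u * ((∑ e, N e : ℕ) : ℝ)} := by
    ext u; simp [pickTicket_eq_some_iff]
  rw [this]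
  refine MeasurableSet.inter (measurableSet_lt (by fun_prop) (by fun_prop)) ?_
  exact MeasurableSet.biInter (Set.to_countable _) fun i' _ =>
    measurableSet_le (by fun_prop) (by fun_prop)

/-- The fraction of the tickets that belong to machine `i`. -/
def share {m : ℕ} (i : Fin m) (N : Fin m → ℕ) : ℝ≥0∞ :=
  ENNReal.ofReal (N i / ((∑ e, N e : ℕ) : ℝ))

lemma volume_pickTicket {m : ℕ} (N : Fin m → ℕ) (i : Fin m) :
    (volume : Measure unitInterval) {u | pickTicket N u = some i} = share i N := by
  unfold share
  set S : ℝ := ((∑ e, N e : ℕ) : ℝ) with hS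
  set a : ℝ := ((∑ e ∈ Finset.Iio i, N e : ℕ) : ℝ) with ha
  have ha0 : 0 ≤ a := by positivity
  have haS : a + N i ≤ S := by
    rw [ha, hS]
    have h1 : ∑ e ∈ Finset.Iio i, N e + N i = ∑ e ∈ Finset.Iic i, N e := by
      rw [← Finset.Iio_insert i, Finset.sum_insert (by simp)]; ring
    have : ∑ e ∈ Finset.Iio i, N e + N i ≤ ∑ e, N e := by
      rw [h1]; exact Finset.sum_le_sum_of_subset (Finset.subset_univ _)
    exact_mod_cast this
  rcases (Nat.zero_le (∑ e, N e)).eq_or_lt with h0 | h0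
  · have hN : N i = 0 := by
      have := Finset.single_le_sum (f := N) (fun _ _ => Nat.zero_le _) (Finset.mem_univ i)
      omega
    have : {u : unitInterval | pickTicket N u = some i} = ∅ := by
      ext u
      simp only [Set.mem_ofPred_eq, Set.mem_empty_iff_false, iff_false]
      intro h
      have := pos_of_pickTicket_eq_some u.2.1 h
      omega
    rw [this]; simp [hN]
  · have hSpos : 0 < S := by rw [hS]; exact_mod_cast h0
    have hNi : (0 : ℝ) ≤ N i := by positivity
    have : {u : unitInterval | pickTicket N u = some i} =
        Set.Ico (⟨a / S, by positivity, by rw [div_le_one hSpos]; linarith⟩ : unitInterval)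
          ⟨(a + N i) / S, by positivity, by rw [div_le_one hSpos]; exact haS⟩ := by
      ext u
      simp only [Set.mem_ofPred_eq, pickTicket_eq_some_iff_mem_Ico N u.2.1 i, ← hS, ← ha,
        Set.mem_Ico, ← Subtype.coe_le_coe, ← Subtype.coe_lt_coe, div_le_iff₀ hSpos,
        lt_div_iff₀ hSpos]
    rw [this, unitInterval.volume_Ico]
    congr 1
    ring

/-! ## Generating functions of the numbers of tickets -/

/-- The weight `t ^ n`, as an extended nonnegative number. -/
def powW (t : ℝ) (n : ℕ) : ℝ≥0∞ := ENNReal.ofReal (t ^ n)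

/-- The derivative `n * t ^ (n - 1)`, as an extended nonnegative number. -/
def derW (t : ℝ) (n : ℕ) : ℝ≥0∞ := ENNReal.ofReal (n * t ^ (n - 1))

/-- The weights of the machines whose product integrates to the share of machine `i`. -/
def shareW {m : ℕ} (i : Fin m) (t : ℝ) (e : Fin m) : ℕ → ℝ≥0∞ :=
  if e = i then derW t else powW t

lemma lintegral_unitInterval_ofReal {f F : ℝ → ℝ} (hF : ∀ t, HasDerivAt F (f t) t)
    (hf : Continuous f) (h0 : ∀ t ∈ unitInterval, 0 ≤ f t) :
    ∫⁻ t : unitInterval, ENNReal.ofReal (f t) = ENNReal.ofReal (F 1 - F 0) := by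
  have h1 := unitInterval.measurePreserving_coe.lintegral_comp
    (f := fun t => ENNReal.ofReal (f t)) (by fun_prop)
  rw [h1, ← ofReal_integral_eq_lintegral_ofReal]
  · congr 1
    rw [show unitInterval = Set.Icc (0 : ℝ) 1 from rfl, integral_Icc_eq_integral_Ioc,
      ← intervalIntegral.integral_of_le zero_le_one]
    exact intervalIntegral.integral_eq_sub_of_hasDerivAt (fun t _ => hF t)
      (hf.intervalIntegrable _ _)
  · exact hf.continuousOn.integrableOn_compact isCompact_Icc
  · exact (ae_restrict_iff' measurableSet_Icc).2 (ae_of_all _ h0)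

/-- This is `N_i / S = ∫ N_i t^(S-1) dt` over `[0, 1]`. It replaces the quotient, which couples the
machines, by a product of one factor per machine. -/
lemma lintegral_shareW {m : ℕ} (i : Fin m) (N : Fin m → ℕ) :
    ∫⁻ t : unitInterval, ∏ e, shareW i t e (N e) = share i N := by
  classical
  have hprod : ∀ t : unitInterval, ∏ e, shareW i t e (N e) =
      ENNReal.ofReal (N i * (t : ℝ) ^ ((∑ e, N e) - 1)) := by
    intro t
    have ht : (0 : ℝ) ≤ t := t.2.1
    rw [← Finset.mul_prod_erase _ _ (Finset.mem_univ i)]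
    have : ∏ e ∈ Finset.univ.erase i, shareW i t e (N e) =
        ENNReal.ofReal ((t : ℝ) ^ ∑ e ∈ Finset.univ.erase i, N e) := by
      rw [← Finset.prod_pow_eq_pow_sum, ENNReal.ofReal_prod_of_nonneg fun e _ => pow_nonneg ht _]
      exact Finset.prod_congr rfl fun e he => by simp [shareW, Finset.ne_of_mem_erase he, powW]
    rw [this, shareW, if_pos rfl, derW, ← ENNReal.ofReal_mul (by positivity)]
    have hs := Finset.add_sum_erase Finset.univ N (Finset.mem_univ i)
    rcases Nat.eq_zero_or_pos (N i) with h0 | h0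
    · simp [h0]
    · rw [mul_assoc, ← pow_add]
      congr 3
      omega
  simp_rw [hprod]
  rw [lintegral_unitInterval_ofReal (f := fun t => N i * t ^ ((∑ e, N e) - 1))
    (F := fun t => N i / ((∑ e, N e : ℕ) : ℝ) * t ^ (∑ e, N e))]
  · rcases Nat.eq_zero_or_pos (∑ e, N e) with h0 | h0
    · simp [h0, share]
    · simp [share, h0.ne']
  · intro t
    rcases Nat.eq_zero_or_pos (∑ e, N e) with h0 | h0
    · have : N i = 0 := by
        have := Finset.single_le_sum (f := N) (fun _ _ => Nat.zero_le _) (Finset.mem_univ i)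
        omega
      simp [h0, this, hasDerivAt_const]
    · have h0' : ((∑ e, N e : ℕ) : ℝ) ≠ 0 := by exact_mod_cast h0.ne'
      convert! (hasDerivAt_pow (∑ e, N e) t).const_mul (N i / ((∑ e, N e : ℕ) : ℝ)) using 1
      field_simp
  · fun_prop
  · intro t ht
    have := ht.1
    positivity

lemma prod_powW_zero {m : ℕ} (N : Fin m → ℕ) :
    ∏ e, powW 0 (N e) = if ∑ e, N e = 0 then 1 else 0 := by
  split_ifs with h
  · have : ∀ e, N e = 0 := by simpa using h
    simp [powW, this]
  · have : ∃ e, N e ≠ 0 := by simpa using h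
    obtain ⟨e, he⟩ := this
    exact Finset.prod_eq_zero (Finset.mem_univ e) (by simp [powW, he])

/-! ## The tickets of a single round -/

/-- The numbers of tickets of a job with fractions `x` in round `r`, if `c` is the decrease of the
recommendation variables so far. -/
def roundTickets {m : ℕ} (x c : Fin m → ℝ) (G : Fin m → GroupName) (j r : ℕ) (ω : Seeds m)
    (e : Fin m) : ℕ :=
  ticket (x e) (c e) (ω (Seed.recommend e (G e) r)) (ω (Seed.tickets e j r))

/-- Fractions `x` of total mass one that fit into the recommendation variables. -/
structure Fits {m : ℕ} (x c : Fin m → ℝ) : Prop where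
  nonneg : ∀ e, 0 ≤ x e
  sum_eq_one : ∑ e, x e = 1
  shift_nonneg : ∀ e, 0 ≤ c e
  le_one : ∀ e, c e + x e ≤ 1

section Round

variable {m : ℕ} {x c y d : Fin m → ℝ} {G H : Fin m → GroupName} {k j r : ℕ} {i : Fin m}

lemma measurable_roundTickets_apply (x c : Fin m → ℝ) (G : Fin m → GroupName) (j r : ℕ)
    (e : Fin m) : Measurable fun ω => roundTickets x c G j r ω e :=
  (measurable_ticket _ _).comp
    (by fun_prop : Measurable fun ω : Seeds m =>
      ((ω (Seed.recommend e (G e) r) : ℝ), (ω (Seed.tickets e j r) : ℝ)))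

lemma measurable_roundTickets (x c : Fin m → ℝ) (G : Fin m → GroupName) (j r : ℕ) :
    Measurable (roundTickets x c G j r) :=
  measurable_pi_lambda _ fun e => measurable_roundTickets_apply x c G j r e

/-- The seeds that machine `e` uses in round `r`. -/
def machineSeeds (e : Fin m) (r : ℕ) : Set (Seed m) :=
  {s | (∃ G, s = Seed.recommend e G r) ∨ ∃ j, s = Seed.tickets e j r}

lemma disjoint_machineSeeds {e e' : Fin m} (h : e ≠ e') (r : ℕ) :
    Disjoint (machineSeeds e r) (machineSeeds e' r) := by
  rw [Set.disjoint_left]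
  rintro s (⟨G, rfl⟩ | ⟨j, rfl⟩) (⟨G', h'⟩ | ⟨j', h'⟩)
  · exact h (by injection h')
  · cases h'
  · cases h'
  · exact h (by injection h')

lemma dependsOn_roundTickets (x c : Fin m → ℝ) (G : Fin m → GroupName) (j r : ℕ) (e : Fin m) :
    DependsOn (fun ω => roundTickets x c G j r ω e)
      {Seed.recommend e (G e) r, Seed.tickets e j r} := by
  intro ω ω' h
  simp only [roundTickets]
  rw [h _ (by simp), h _ (by simp)]

lemma dependsOn_roundTickets_machineSeeds (x c : Fin m → ℝ) (G : Fin m → GroupName) (j r : ℕ)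
    (e : Fin m) : DependsOn (fun ω => roundTickets x c G j r ω e) (machineSeeds e r) :=
  (dependsOn_roundTickets x c G j r e).mono (by
    rintro s (rfl | rfl)
    · exact Or.inl ⟨_, rfl⟩
    · exact Or.inr ⟨_, rfl⟩)

lemma lintegral_prod_roundTickets (φ : Fin m → ℕ → ℝ≥0∞) :
    ∫⁻ ω, ∏ e, φ e (roundTickets x c G j r ω e) ∂seedMeasure m =
      ∏ e, ∫⁻ ω, φ e (roundTickets x c G j r ω e) ∂seedMeasure m := by
  refine lintegral_prod_of_dependsOn (S := fun e => machineSeeds e r) Finset.univ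
    (fun e _ => (measurable_of_countable (φ e)).comp (measurable_roundTickets_apply x c G j r e))
    (fun e _ ω ω' h => congrArg (φ e) (dependsOn_roundTickets_machineSeeds x c G j r e h))
    fun e _ e' _ h => disjoint_machineSeeds h r

/-- If on every machine the weights of two jobs are not positively correlated, then neither are
their products over all machines. -/
lemma lintegral_prod_mul_prod_le {φ ψ : Fin m → ℕ → ℝ≥0∞}
    (h : ∀ e, ∫⁻ ω, φ e (roundTickets x c G k r ω e) * ψ e (roundTickets y d H j r ω e)
        ∂seedMeasure m ≤
      (∫⁻ ω, φ e (roundTickets x c G k r ω e) ∂seedMeasure m) *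
        ∫⁻ ω, ψ e (roundTickets y d H j r ω e) ∂seedMeasure m) :
    ∫⁻ ω, (∏ e, φ e (roundTickets x c G k r ω e)) * ∏ e, ψ e (roundTickets y d H j r ω e)
        ∂seedMeasure m ≤
      (∫⁻ ω, ∏ e, φ e (roundTickets x c G k r ω e) ∂seedMeasure m) *
        ∫⁻ ω, ∏ e, ψ e (roundTickets y d H j r ω e) ∂seedMeasure m := by
  rw [lintegral_prod_roundTickets, lintegral_prod_roundTickets, ← Finset.prod_mul_distrib]
  simp_rw [← Finset.prod_mul_distrib]
  have := lintegral_prod_of_dependsOn (P := fun _ : Seed m => (volume : Measure unitInterval))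
    (S := fun e => machineSeeds e r) Finset.univ
    (f := fun e ω => φ e (roundTickets x c G k r ω e) * ψ e (roundTickets y d H j r ω e))
    (fun e _ => ((measurable_of_countable (φ e)).comp
      (measurable_roundTickets_apply x c G k r e)).mul
        ((measurable_of_countable (ψ e)).comp (measurable_roundTickets_apply y d H j r e)))
    (fun e _ ω ω' h => congrArg₂ _
      (congrArg (φ e) (dependsOn_roundTickets_machineSeeds x c G k r e h))
      (congrArg (ψ e) (dependsOn_roundTickets_machineSeeds y d H j r e h)))
    fun e _ e' _ h => disjoint_machineSeeds h r
  unfold seedMeasure at h ⊢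
  rw [this]
  exact Finset.prod_le_prod' fun e _ => h e

/-- Jobs from different groups of a machine are independent on this machine. -/
lemma lintegral_mul_of_group_ne (hkj : k ≠ j) {e : Fin m} (h : G e ≠ H e) (φ ψ : ℕ → ℝ≥0∞) :
    ∫⁻ ω, φ (roundTickets x c G k r ω e) * ψ (roundTickets y d H j r ω e) ∂seedMeasure m =
      (∫⁻ ω, φ (roundTickets x c G k r ω e) ∂seedMeasure m) *
        ∫⁻ ω, ψ (roundTickets y d H j r ω e) ∂seedMeasure m := by
  refine lintegral_seed_mul
    ((measurable_of_countable φ).comp (measurable_roundTickets_apply x c G k r e))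
    ((measurable_of_countable ψ).comp (measurable_roundTickets_apply y d H j r e))
    (S := {Seed.recommend e (G e) r, Seed.tickets e k r})
    (T := {Seed.recommend e (H e) r, Seed.tickets e j r})
    (fun ω ω' h => congrArg φ (dependsOn_roundTickets x c G k r e h))
    (fun ω ω' h => congrArg ψ (dependsOn_roundTickets y d H j r e h)) ?_
  rw [Set.disjoint_left]
  rintro s (rfl | rfl) (h' | h')
  · injection h' with _ h2; exact h h2
  · cases h'
  · cases h'
  · injection h' with _ h2; exact hkj h2

lemma lintegral_powW (hx : Fits x c) (e : Fin m) {t : ℝ} (ht : 0 ≤ t) :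
    ∫⁻ ω, powW t (roundTickets x c G j r ω e) ∂seedMeasure m =
      ENNReal.ofReal (Real.exp (-(x e * (1 - t)))) :=
  lintegral_pow_ticket (by simp) (hx.nonneg e) (hx.shift_nonneg e) (hx.le_one e) ht

lemma lintegral_derW (hx : Fits x c) (e : Fin m) {t : ℝ} (ht : 0 ≤ t) :
    ∫⁻ ω, derW t (roundTickets x c G j r ω e) ∂seedMeasure m =
      ENNReal.ofReal (x e * Real.exp (-(x e * (1 - t)))) :=
  lintegral_deriv_ticket (by simp) (hx.nonneg e) (hx.shift_nonneg e) (hx.le_one e) ht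

/-- Two jobs of which at most one gets tickets from a machine are negatively correlated on it. -/
lemma lintegral_powW_mul_powW_le (hx : Fits x c) (hy : Fits y d) {e : Fin m}
    (h : ∀ ω, roundTickets x c G k r ω e = 0 ∨ roundTickets y d H j r ω e = 0)
    {t s : ℝ} (ht : t ∈ unitInterval) (hs : s ∈ unitInterval) :
    ∫⁻ ω, powW t (roundTickets x c G k r ω e) * powW s (roundTickets y d H j r ω e)
        ∂seedMeasure m ≤
      (∫⁻ ω, powW t (roundTickets x c G k r ω e) ∂seedMeasure m) *
        ∫⁻ ω, powW s (roundTickets y d H j r ω e) ∂seedMeasure m := by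
  set u := Real.exp (-(x e * (1 - t))) with hu
  set v := Real.exp (-(y e * (1 - s))) with hv
  have hu1 : u ≤ 1 := Real.exp_le_one_iff.2 (by
    have := mul_nonneg (hx.nonneg e) (sub_nonneg.2 ht.2); linarith)
  have hv1 : v ≤ 1 := Real.exp_le_one_iff.2 (by
    have := mul_nonneg (hy.nonneg e) (sub_nonneg.2 hs.2); linarith)
  have hu0 : 0 ≤ u := (Real.exp_pos _).le
  have hv0 : 0 ≤ v := (Real.exp_pos _).le
  -- One of the two counts is zero, so one power is `1` and `ab + 1 = a + b`. Taking expectations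
  -- gives `u + v - 1 ≤ u * v` for `u, v ≤ 1`; adding the `1` avoids subtraction in `ℝ≥0∞`.
  have h1 : ∀ ω, powW t (roundTickets x c G k r ω e) * powW s (roundTickets y d H j r ω e) + 1 =
      powW t (roundTickets x c G k r ω e) + powW s (roundTickets y d H j r ω e) := by
    intro ω
    rcases h ω with h | h
    · simp [h, powW, add_comm]
    · simp [h, powW]
  have h2 := lintegral_congr (μ := seedMeasure m) h1
  have hm1 : Measurable fun ω => powW t (roundTickets x c G k r ω e) :=
    (measurable_of_countable (powW t)).comp (measurable_roundTickets_apply x c G k r e)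
  rw [lintegral_add_right _ measurable_const, lintegral_add_left hm1, lintegral_powW hx e ht.1,
    lintegral_powW hy e hs.1] at h2
  rw [lintegral_powW hx e ht.1, lintegral_powW hy e hs.1]
  simp only [lintegral_const, measure_univ, mul_one] at h2
  rw [← hu, ← hv] at *
  refine (ENNReal.add_le_add_iff_right ENNReal.one_ne_top).1 ?_
  rw [h2, ← ENNReal.ofReal_mul hu0, ← ENNReal.ofReal_one, ← ENNReal.ofReal_add hu0 hv0,
    ← ENNReal.ofReal_add (mul_nonneg hu0 hv0) zero_le_one]
  refine ENNReal.ofReal_le_ofReal ?_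
  nlinarith [mul_nonneg (sub_nonneg.2 hu1) (sub_nonneg.2 hv1)]

end Round

/-! ### Shares as averages of generating functions. -/

section Round

variable {m : ℕ} {x c y d : Fin m → ℝ} {G H : Fin m → GroupName} {k j r : ℕ} {i : Fin m}

lemma measurable_shareW (i : Fin m) (e : Fin m) (n : ℕ) : Measurable fun t => shareW i t e n := by
  unfold shareW derW powW
  split_ifs <;> fun_prop

lemma measurable_prod_shareW (x c : Fin m → ℝ) (G : Fin m → GroupName) (k r : ℕ) (i : Fin m) :
    Measurable fun p : unitInterval × Seeds m =>
      ∏ e, shareW i p.1 e (roundTickets x c G k r p.2 e) := by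
  refine Finset.measurable_prod _ fun e _ => ?_
  have h1 : Measurable fun q : unitInterval × ℕ => shareW i q.1 e q.2 :=
    measurable_from_prod_countable_left fun n =>
      (measurable_shareW i e n).comp measurable_subtype_coe
  exact h1.comp (measurable_fst.prodMk
    ((measurable_roundTickets_apply x c G k r e).comp measurable_snd))

/-- The share of a job is averaged over generating functions. -/
lemma lintegral_share_mul (i : Fin m) {g : Seeds m → ℝ≥0∞} (hg : Measurable g) :
    ∫⁻ ω, share i (roundTickets x c G k r ω) * g ω ∂seedMeasure m =
      ∫⁻ t : unitInterval, ∫⁻ ω, (∏ e, shareW i t e (roundTickets x c G k r ω e)) * g ω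
        ∂seedMeasure m := by
  have hmeas := measurable_prod_shareW x c G k r i
  have h := lintegral_lintegral_swap (μ := (volume : Measure unitInterval)) (ν := seedMeasure m)
    (f := fun t ω => (∏ e, shareW i t e (roundTickets x c G k r ω e)) * g ω)
    (hmeas.mul (hg.comp measurable_snd)).aemeasurable
  refine Eq.trans (lintegral_congr fun ω => ?_) h.symm
  have h2 : Measurable fun t : unitInterval =>
      ∏ e, shareW i t e (roundTickets x c G k r ω e) :=
    Finset.measurable_prod _ fun e _ => (measurable_shareW i e _).comp measurable_subtype_coe
  rw [lintegral_mul_const _ h2, lintegral_shareW]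

/-- For fixed `t` both sides are products over independent machines, so the comparison can be made
machine by machine and then integrated over `t`. -/
lemma lintegral_share_mul_prod_le (i : Fin m) {ψ : Fin m → ℕ → ℝ≥0∞}
    (h : ∀ t ∈ unitInterval, ∀ e,
      ∫⁻ ω, shareW i t e (roundTickets x c G k r ω e) * ψ e (roundTickets y d H j r ω e)
        ∂seedMeasure m ≤
      (∫⁻ ω, shareW i t e (roundTickets x c G k r ω e) ∂seedMeasure m) *
        ∫⁻ ω, ψ e (roundTickets y d H j r ω e) ∂seedMeasure m) :
    ∫⁻ ω, share i (roundTickets x c G k r ω) * ∏ e, ψ e (roundTickets y d H j r ω e)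
        ∂seedMeasure m ≤
      (∫⁻ ω, share i (roundTickets x c G k r ω) ∂seedMeasure m) *
        ∫⁻ ω, ∏ e, ψ e (roundTickets y d H j r ω e) ∂seedMeasure m := by
  have hψ : Measurable fun ω => ∏ e, ψ e (roundTickets y d H j r ω e) :=
    Finset.measurable_prod _ fun e _ =>
      (measurable_of_countable (ψ e)).comp (measurable_roundTickets_apply y d H j r e)
  have h1 := lintegral_share_mul (x := x) (c := c) (G := G) (k := k) (r := r) i
    (g := fun _ => 1) measurable_const
  simp only [mul_one] at h1
  rw [lintegral_share_mul i hψ, h1,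
    ← lintegral_mul_const _ (measurable_prod_shareW x c G k r i).lintegral_prod_right']
  exact lintegral_mono fun t => lintegral_prod_mul_prod_le (h t t.2)

lemma lintegral_share_mul_share_le (i : Fin m)
    (h : ∀ t ∈ unitInterval, ∀ s ∈ unitInterval, ∀ e,
      ∫⁻ ω, shareW i t e (roundTickets x c G k r ω e) * shareW i s e (roundTickets y d H j r ω e)
        ∂seedMeasure m ≤
      (∫⁻ ω, shareW i t e (roundTickets x c G k r ω e) ∂seedMeasure m) *
        ∫⁻ ω, shareW i s e (roundTickets y d H j r ω e) ∂seedMeasure m) :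
    ∫⁻ ω, share i (roundTickets x c G k r ω) * share i (roundTickets y d H j r ω)
        ∂seedMeasure m ≤
      (∫⁻ ω, share i (roundTickets x c G k r ω) ∂seedMeasure m) *
        ∫⁻ ω, share i (roundTickets y d H j r ω) ∂seedMeasure m := by
  have hm : Measurable fun ω => share i (roundTickets x c G k r ω) :=
    (measurable_of_countable (share i)).comp (measurable_roundTickets x c G k r)
  have h1 := lintegral_share_mul (x := y) (c := d) (G := H) (k := j) (r := r) i
    (g := fun _ => 1) measurable_const
  have h2 := lintegral_share_mul (x := y) (c := d) (G := H) (k := j) (r := r) i hm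
  simp only [mul_one] at h1
  simp_rw [mul_comm (share i (roundTickets x c G k r _))]
  rw [h2, h1, ← lintegral_const_mul _ (measurable_prod_shareW y d H j r i).lintegral_prod_right']
  refine lintegral_mono fun s => ?_
  simp_rw [mul_comm _ (share i (roundTickets x c G k r _))]
  exact lintegral_share_mul_prod_le i fun t ht e => h t ht s s.2 e

lemma lintegral_prod_powW (hx : Fits x c) {t : ℝ} (ht : 0 ≤ t) :
    ∫⁻ ω, ∏ e, powW t (roundTickets x c G j r ω e) ∂seedMeasure m =
      ENNReal.ofReal (Real.exp (-(1 - t))) := by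
  rw [lintegral_prod_roundTickets fun _ => powW t]
  simp_rw [lintegral_powW hx _ ht]
  rw [← ENNReal.ofReal_prod_of_nonneg fun e _ => (Real.exp_pos _).le, ← Real.exp_sum,
    Finset.sum_neg_distrib, ← Finset.sum_mul, hx.sum_eq_one, one_mul]

lemma lintegral_prod_shareW (hx : Fits x c) (i : Fin m) {t : ℝ} (ht : 0 ≤ t) :
    ∫⁻ ω, ∏ e, shareW i t e (roundTickets x c G j r ω e) ∂seedMeasure m =
      ENNReal.ofReal (x i * Real.exp (-(1 - t))) := by
  have h : ∀ e, ∫⁻ ω, shareW i t e (roundTickets x c G j r ω e) ∂seedMeasure m =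
      (if e = i then ENNReal.ofReal (x i) else 1) *
        ENNReal.ofReal (Real.exp (-(x e * (1 - t)))) := by
    intro e
    unfold shareW
    split_ifs with he
    · rw [lintegral_derW hx e ht, ENNReal.ofReal_mul (hx.nonneg e), he]
    · rw [lintegral_powW hx e ht, one_mul]
  rw [lintegral_prod_roundTickets fun e => shareW i t e]
  simp_rw [h]
  rw [Finset.prod_mul_distrib, Finset.prod_ite_eq' _ _ fun _ => ENNReal.ofReal (x i),
    if_pos (Finset.mem_univ i), ← ENNReal.ofReal_prod_of_nonneg fun e _ => (Real.exp_pos _).le,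
    ← Real.exp_sum, Finset.sum_neg_distrib, ← Finset.sum_mul, hx.sum_eq_one, one_mul,
    ← ENNReal.ofReal_mul (hx.nonneg i)]

/-- As the fractions sum to one, the generating function is `x_i e^{-(1-t)}`, independently of how
the rest is distributed over the other machines. -/
lemma lintegral_share (hx : Fits x c) (i : Fin m) :
    ∫⁻ ω, share i (roundTickets x c G j r ω) ∂seedMeasure m =
      ENNReal.ofReal (x i * (1 - Real.exp (-1))) := by
  have h1 := lintegral_share_mul (x := x) (c := c) (G := G) (k := j) (r := r) i
    (g := fun _ => 1) measurable_const
  simp only [mul_one] at h1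
  rw [h1, lintegral_congr fun t : unitInterval => lintegral_prod_shareW hx i t.2.1,
    lintegral_unitInterval_ofReal (f := fun t => x i * Real.exp (-(1 - t)))
      (F := fun t => x i * Real.exp (-(1 - t)))]
  · congr 1
    simp; ring
  · intro t
    have h2 : HasDerivAt (fun t : ℝ => -(1 - t)) 1 t := by
      simp only [neg_sub]
      exact (hasDerivAt_id t).sub_const 1
    simpa using (h2.exp).const_mul (x i)
  · fun_prop
  · intro t _
    exact mul_nonneg (hx.nonneg i) (Real.exp_pos _).le

/-- The probability that no ticket is generated. -/
lemma lintegral_no_ticket (hx : Fits x c) :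
    ∫⁻ ω, (∏ e, powW 0 (roundTickets x c G j r ω e)) ∂seedMeasure m =
      ENNReal.ofReal (Real.exp (-1)) := by
  simpa using lintegral_prod_powW (G := G) (j := j) (r := r) hx le_rfl

/-! ## Correlation of two jobs in a round -/

/-- The indicator that machine `i` is picked. -/
def picks (i : Fin m) (N : Fin m → ℕ) (u : unitInterval) : ℝ≥0∞ :=
  {u : unitInterval | pickTicket N u = some i}.indicator 1 u

/-- The indicator that there is no ticket. -/
def noTicket (N : Fin m → ℕ) : ℝ≥0∞ := ∏ e, powW 0 (N e)

lemma measurable_picks (i : Fin m) :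
    Measurable fun p : (Fin m → ℕ) × unitInterval => picks i p.1 p.2 := by
  refine measurable_from_prod_countable_right fun N => ?_
  exact measurable_one.indicator (measurable_subtype_coe (measurableSet_pickTicket N i))

/-- The picking seed is independent of everything else, so it can be averaged out first. Since the
vector of counts takes countably many values, conditioning on it is a countable sum. -/
lemma lintegral_picks_mul (i : Fin m) {N : Seeds m → Fin m → ℕ} {g : Seeds m → ℝ≥0∞}
    (hN : Measurable N) (hg : Measurable g) {s : Seed m}
    (hNS : DependsOn N {s}ᶜ) (hgS : DependsOn g {s}ᶜ) :
    ∫⁻ ω, picks i (N ω) (ω s) * g ω ∂seedMeasure m =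
      ∫⁻ ω, share i (N ω) * g ω ∂seedMeasure m := by
  have hind : ∀ n, Measurable fun ω : Seeds m => (N ⁻¹' {n}).indicator g ω := fun n =>
    hg.indicator (hN (measurableSet_singleton n))
  have hdecomp : ∀ F : (Fin m → ℕ) → Seeds m → ℝ≥0∞, (∀ n, Measurable (F n)) →
      ∫⁻ ω, F (N ω) ω * g ω ∂seedMeasure m =
        ∑' n, ∫⁻ ω, (N ⁻¹' {n}).indicator g ω * F n ω ∂seedMeasure m := by
    intro F hF
    rw [← lintegral_tsum (f := fun n ω => (N ⁻¹' {n}).indicator g ω * F n ω)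
      fun n => ((hind n).mul (hF n)).aemeasurable]
    refine lintegral_congr fun ω => ?_
    rw [tsum_eq_single (N ω)]
    · simp [mul_comm]
    · intro n hn
      rw [Set.indicator_of_notMem (by simpa using hn.symm), zero_mul]
  have hp' : ∀ n, Measurable (picks i n) := fun n =>
    measurable_one.indicator (measurable_subtype_coe (measurableSet_pickTicket n i))
  have hp : ∀ n, Measurable fun ω : Seeds m => picks i n (ω s) := fun n =>
    (hp' n).comp (measurable_pi_apply s)
  rw [hdecomp (fun n ω => picks i n (ω s)) hp,
    hdecomp (fun n _ => share i n) fun n => measurable_const]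
  congr 1
  funext n
  rw [lintegral_mul_const _ (hind n), lintegral_seed_mul (hind n) (hp n) (S := {s}ᶜ) (T := {s})]
  · congr 1
    rw [lintegral_seed_eval s (hp' n), ← volume_pickTicket]
    exact lintegral_indicator_one (measurable_subtype_coe (measurableSet_pickTicket n i))
  · intro ω ω' h
    have h1 := hNS h
    have h2 := hgS h
    by_cases hn : N ω' = n
    · have hn' : ω ∈ N ⁻¹' {n} := h1.trans hn
      exact (Set.indicator_of_mem hn' g).trans
        (h2.trans (Set.indicator_of_mem (s := N ⁻¹' {n}) hn g).symm)
    · have hn' : ω ∉ N ⁻¹' {n} := fun h => hn (h1.symm.trans h)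
      exact (Set.indicator_of_notMem hn' g).trans
        (Set.indicator_of_notMem (s := N ⁻¹' {n}) hn g).symm
  · intro ω ω' h
    simp only [h s rfl]
  · exact disjoint_compl_left

lemma measurable_noTicket (N : Seeds m → Fin m → ℕ) (hN : Measurable N) :
    Measurable fun ω => noTicket (N ω) := (measurable_of_countable noTicket).comp hN

lemma measurable_picks_comp {N : Seeds m → Fin m → ℕ} (hN : Measurable N) (i : Fin m)
    (s : Seed m) : Measurable fun ω => picks i (N ω) (ω s) :=
  Measurable.comp (g := fun p : (Fin m → ℕ) × unitInterval => picks i p.1 p.2)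
    (f := fun ω => (N ω, ω s)) (measurable_picks i) (hN.prodMk (measurable_pi_apply s))

lemma dependsOn_roundTickets_compl_pick (x c : Fin m → ℝ) (G : Fin m → GroupName)
    (j r j' r' : ℕ) : DependsOn (roundTickets x c G j r) {Seed.pick j' r'}ᶜ := by
  intro ω ω' h
  funext e
  exact dependsOn_roundTickets x c G j r e fun s hs => h s (by
    rcases hs with rfl | rfl <;> simp)

lemma lintegral_picks (hx : Fits x c) (i : Fin m) :
    ∫⁻ ω, picks i (roundTickets x c G k r ω) (ω (Seed.pick k r)) ∂seedMeasure m =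
      ENNReal.ofReal (x i * (1 - Real.exp (-1))) := by
  have h := lintegral_picks_mul i (measurable_roundTickets x c G k r) (g := fun _ => 1)
    measurable_const (dependsOn_roundTickets_compl_pick x c G k r k r) (fun _ _ _ => rfl)
  simp only [mul_one] at h
  rw [h, lintegral_share hx]

/-- In every round, a job is assigned with probability `1 - 1 / e`, and then to machine `i` with
probability `x i`. -/
lemma lintegral_picks_add_noTicket (hx : Fits x c) (i : Fin m) :
    ∫⁻ ω, (picks i (roundTickets x c G k r ω) (ω (Seed.pick k r)) +
      ENNReal.ofReal (x i) * noTicket (roundTickets x c G k r ω)) ∂seedMeasure m =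
      ENNReal.ofReal (x i) := by
  have hm := measurable_noTicket _ (measurable_roundTickets x c G k r)
  rw [lintegral_add_right _ (hm.const_mul _), lintegral_picks hx, lintegral_const_mul _ hm]
  unfold noTicket
  have hexp : Real.exp (-1) ≤ 1 := Real.exp_le_one_iff.2 (by norm_num)
  have hi := hx.nonneg i
  rw [lintegral_no_ticket hx, ← ENNReal.ofReal_mul hi, ← ENNReal.ofReal_add]
  · congr 1; ring
  · exact mul_nonneg hi (by linarith)
  · positivity

lemma lintegral_picks_mul_eq (i : Fin m) {g : Seeds m → ℝ≥0∞} (hg : Measurable g)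
    (hgS : DependsOn g {Seed.pick k r}ᶜ) :
    ∫⁻ ω, picks i (roundTickets x c G k r ω) (ω (Seed.pick k r)) * g ω ∂seedMeasure m =
      ∫⁻ ω, share i (roundTickets x c G k r ω) * g ω ∂seedMeasure m :=
  lintegral_picks_mul i (measurable_roundTickets x c G k r) hg
    (dependsOn_roundTickets_compl_pick x c G k r k r) hgS

lemma lintegral_powW_mul_powW_le_of_exclusive (hx : Fits x c) (hy : Fits y d) (hkj : k ≠ j)
    (hex : ∀ e, G e = H e → ∀ ω, roundTickets x c G k r ω e = 0 ∨ roundTickets y d H j r ω e = 0)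
    {t s : ℝ} (ht : t ∈ unitInterval) (hs : s ∈ unitInterval) (e : Fin m) :
    ∫⁻ ω, powW t (roundTickets x c G k r ω e) * powW s (roundTickets y d H j r ω e)
        ∂seedMeasure m ≤
      (∫⁻ ω, powW t (roundTickets x c G k r ω e) ∂seedMeasure m) *
        ∫⁻ ω, powW s (roundTickets y d H j r ω e) ∂seedMeasure m := by
  by_cases h : G e = H e
  · exact lintegral_powW_mul_powW_le hx hy (hex e h) ht hs
  · exact (lintegral_mul_of_group_ne hkj h _ _).le

lemma lintegral_noTicket_mul_noTicket_le (hx : Fits x c) (hy : Fits y d) (hkj : k ≠ j)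
    (hex : ∀ e, G e = H e →
      ∀ ω, roundTickets x c G k r ω e = 0 ∨ roundTickets y d H j r ω e = 0) :
    ∫⁻ ω, noTicket (roundTickets x c G k r ω) * noTicket (roundTickets y d H j r ω)
        ∂seedMeasure m ≤ ENNReal.ofReal (Real.exp (-1)) * ENNReal.ofReal (Real.exp (-1)) := by
  have h := lintegral_prod_mul_prod_le (φ := fun _ => powW 0) (ψ := fun _ => powW 0)
    (lintegral_powW_mul_powW_le_of_exclusive hx hy hkj hex (by simp) (by simp))
  rwa [lintegral_no_ticket hx, lintegral_no_ticket hy] at h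

/-- The derivative weight on machine `i` is not covered by the exclusivity argument; there the
different groups give exact independence. On all other machines only powers occur, and these are
never positively correlated. -/
lemma lintegral_picks_mul_noTicket_le (hx : Fits x c) (hy : Fits y d) (hkj : k ≠ j)
    (hex : ∀ e, G e = H e →
      ∀ ω, roundTickets x c G k r ω e = 0 ∨ roundTickets y d H j r ω e = 0) (hi : G i ≠ H i) :
    ∫⁻ ω, picks i (roundTickets x c G k r ω) (ω (Seed.pick k r)) *
        noTicket (roundTickets y d H j r ω) ∂seedMeasure m ≤
      ENNReal.ofReal (x i * (1 - Real.exp (-1))) * ENNReal.ofReal (Real.exp (-1)) := by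
  rw [lintegral_picks_mul_eq i (measurable_noTicket _ (measurable_roundTickets y d H j r))
    fun ω ω' h => congrArg noTicket (dependsOn_roundTickets_compl_pick y d H j r k r h)]
  rw [← lintegral_share (G := G) (j := k) (r := r) hx,
    ← lintegral_no_ticket (G := H) (j := j) (r := r) hy]
  refine lintegral_share_mul_prod_le (ψ := fun _ => powW 0) i fun t ht e => ?_
  by_cases he : e = i
  · exact (lintegral_mul_of_group_ne hkj (he ▸ hi) _ _).le
  · simp only [shareW, if_neg he]
    exact lintegral_powW_mul_powW_le_of_exclusive hx hy hkj hex ht (by simp) e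

lemma lintegral_picks_mul_picks_le (hx : Fits x c) (hy : Fits y d) (hkj : k ≠ j)
    (hex : ∀ e, G e = H e →
      ∀ ω, roundTickets x c G k r ω e = 0 ∨ roundTickets y d H j r ω e = 0) (hi : G i ≠ H i) :
    ∫⁻ ω, picks i (roundTickets x c G k r ω) (ω (Seed.pick k r)) *
        picks i (roundTickets y d H j r ω) (ω (Seed.pick j r)) ∂seedMeasure m ≤
      ENNReal.ofReal (x i * (1 - Real.exp (-1))) * ENNReal.ofReal (y i * (1 - Real.exp (-1))) := by
  rw [lintegral_picks_mul_eq i (measurable_picks_comp (measurable_roundTickets y d H j r) i _)]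
  · simp_rw [mul_comm (share i _)]
    rw [lintegral_picks_mul_eq i (g := fun ω => share i (roundTickets x c G k r ω))
      ((measurable_of_countable (share i)).comp (measurable_roundTickets x c G k r))
      fun ω ω' h => congrArg (share i) (dependsOn_roundTickets_compl_pick x c G k r j r h)]
    simp_rw [mul_comm (share i (roundTickets y d H j r _))]
    rw [← lintegral_share (G := G) (j := k) (r := r) hx,
      ← lintegral_share (G := H) (j := j) (r := r) hy]
    refine lintegral_share_mul_share_le i fun t ht s hs e => ?_
    by_cases he : e = i
    · exact (lintegral_mul_of_group_ne hkj (he ▸ hi) _ _).le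
    · simp only [shareW, if_neg he]
      exact lintegral_powW_mul_powW_le_of_exclusive hx hy hkj hex ht hs e
  · intro ω ω' h
    have h1 := dependsOn_roundTickets_compl_pick y d H j r k r h
    have h2 := h (Seed.pick j r) (by simpa using hkj.symm)
    simp only [h1, h2]

/-- Two jobs that share their group on machine `i`: if one is assigned to `i`, then the other one
has no ticket from `i`. -/
lemma lintegral_picks_mul_noTicket_le_of_group_eq (hx : Fits x c) (hy : Fits y d) (hkj : k ≠ j)
    (hex : ∀ e, G e = H e →
      ∀ ω, roundTickets x c G k r ω e = 0 ∨ roundTickets y d H j r ω e = 0) :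
    ∫⁻ ω, picks i (roundTickets x c G k r ω) (ω (Seed.pick k r)) *
        noTicket (roundTickets y d H j r ω) ∂seedMeasure m ≤
      ENNReal.ofReal (x i * (1 - Real.exp (-1))) * ENNReal.ofReal (Real.exp (-(1 - y i))) := by
  rw [lintegral_picks_mul_eq i (measurable_noTicket _ (measurable_roundTickets y d H j r))
    fun ω ω' h => congrArg noTicket (dependsOn_roundTickets_compl_pick y d H j r k r h)]
  -- On the shared machine `i` the absence of tickets for the second job is replaced by the trivial
  -- bound `1`. This costs a factor `e^{y_i}`, which is small because hard jobs have fraction at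
  -- most `θ`.
  set ψ : Fin m → ℕ → ℝ≥0∞ := fun e => if e = i then fun _ => 1 else powW 0 with hψ
  have hle : ∀ N : Fin m → ℕ, noTicket N ≤ ∏ e, ψ e (N e) := by
    intro N
    refine Finset.prod_le_prod' fun e _ => ?_
    simp only [hψ]
    split_ifs
    · simp only [powW, ENNReal.ofReal_le_one]
      exact pow_le_one₀ le_rfl zero_le_one
    · exact le_rfl
  have hval : ∫⁻ ω, ∏ e, ψ e (roundTickets y d H j r ω e) ∂seedMeasure m =
      ENNReal.ofReal (Real.exp (-(1 - y i))) := by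
    have h1 : ∀ e, ∫⁻ ω, ψ e (roundTickets y d H j r ω e) ∂seedMeasure m =
        ENNReal.ofReal (Real.exp (-(y e - if e = i then y i else 0))) := by
      intro e
      simp only [hψ]
      split_ifs with he
      · simp [he]
      · rw [lintegral_powW hy e le_rfl]; simp
    rw [lintegral_prod_roundTickets]
    simp_rw [h1]
    rw [← ENNReal.ofReal_prod_of_nonneg fun e _ => (Real.exp_pos _).le, ← Real.exp_sum,
      Finset.sum_neg_distrib, Finset.sum_sub_distrib, hy.sum_eq_one]
    simp
  rw [← lintegral_share (G := G) (j := k) (r := r) hx, ← hval]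
  refine (lintegral_mono fun ω => mul_le_mul_right (hle _) _).trans ?_
  refine lintegral_share_mul_prod_le i fun t ht e => ?_
  by_cases he : e = i
  · simp [hψ, he]
  · simp only [shareW, hψ, if_neg he]
    exact lintegral_powW_mul_powW_le_of_exclusive hx hy hkj hex ht (by simp) e

end Round

/-- The potential of a pair of jobs in a round: `X` and `Y` are their fractions, and `C` is the
bound for the probability that both are assigned to machine `i`. -/
def pairStep {m : ℕ} (i : Fin m) (X Y C : ℝ≥0∞) (N N' : Fin m → ℕ) (u u' : unitInterval) : ℝ≥0∞ :=
  picks i N u * picks i N' u' + Y * (picks i N u * noTicket N') +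
    X * (picks i N' u' * noTicket N) + C * (noTicket N * noTicket N')

/-- The bound for the correlation of two jobs in the same hard group. -/
def groupCorr : ℝ := 2 * Real.exp theta / (Real.exp 1 + 1)

section Round

variable {m : ℕ} {x c y d : Fin m → ℝ} {G H : Fin m → GroupName} {k j r : ℕ} {i : Fin m}

lemma lintegral_pairStep (X Y C : ℝ≥0∞) :
    ∫⁻ ω, pairStep i X Y C (roundTickets x c G k r ω) (roundTickets y d H j r ω)
        (ω (Seed.pick k r)) (ω (Seed.pick j r)) ∂seedMeasure m =
      ∫⁻ ω, picks i (roundTickets x c G k r ω) (ω (Seed.pick k r)) *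
        picks i (roundTickets y d H j r ω) (ω (Seed.pick j r)) ∂seedMeasure m +
      Y * ∫⁻ ω, picks i (roundTickets x c G k r ω) (ω (Seed.pick k r)) *
        noTicket (roundTickets y d H j r ω) ∂seedMeasure m +
      X * ∫⁻ ω, picks i (roundTickets y d H j r ω) (ω (Seed.pick j r)) *
        noTicket (roundTickets x c G k r ω) ∂seedMeasure m +
      C * ∫⁻ ω, noTicket (roundTickets x c G k r ω) *
        noTicket (roundTickets y d H j r ω) ∂seedMeasure m := by
  have h1 := measurable_picks_comp (measurable_roundTickets x c G k r) i (Seed.pick k r)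
  have h2 := measurable_picks_comp (measurable_roundTickets y d H j r) i (Seed.pick j r)
  have h3 := measurable_noTicket _ (measurable_roundTickets x c G k r)
  have h4 := measurable_noTicket _ (measurable_roundTickets y d H j r)
  have h34 : Measurable fun ω => noTicket (roundTickets x c G k r ω) *
    noTicket (roundTickets y d H j r ω) := h3.mul h4
  have h23 : Measurable fun ω => picks i (roundTickets y d H j r ω) (ω (Seed.pick j r)) *
    noTicket (roundTickets x c G k r ω) := h2.mul h3
  have h14 : Measurable fun ω => picks i (roundTickets x c G k r ω) (ω (Seed.pick k r)) *
    noTicket (roundTickets y d H j r ω) := h1.mul h4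
  unfold pairStep
  rw [lintegral_add_right _ (h34.const_mul C), lintegral_add_right _ (h23.const_mul X),
    lintegral_add_right _ (h14.const_mul Y), lintegral_const_mul C h34, lintegral_const_mul X h23,
    lintegral_const_mul Y h14]

/-- With `p = 1/e` the four terms add up to at most `x y ((1-p)² + 2 p (1-p) + p²) = x y`, so the
product of the fractions survives every round. -/
lemma lintegral_pairStep_le (hx : Fits x c) (hy : Fits y d) (hkj : k ≠ j)
    (hex : ∀ e, G e = H e →
      ∀ ω, roundTickets x c G k r ω e = 0 ∨ roundTickets y d H j r ω e = 0) (hi : G i ≠ H i) :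
    ∫⁻ ω, pairStep i (ENNReal.ofReal (x i)) (ENNReal.ofReal (y i)) (ENNReal.ofReal (x i * y i))
        (roundTickets x c G k r ω) (roundTickets y d H j r ω)
        (ω (Seed.pick k r)) (ω (Seed.pick j r)) ∂seedMeasure m ≤ ENNReal.ofReal (x i * y i) := by
  have hx0 := hx.nonneg i
  have hy0 := hy.nonneg i
  have hexp : Real.exp (-1) ≤ 1 := Real.exp_le_one_iff.2 (by norm_num)
  have hexp0 := (Real.exp_pos (-1)).le
  have hq : 0 ≤ 1 - Real.exp (-1) := by linarith
  rw [lintegral_pairStep]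
  refine (add_le_add (add_le_add (add_le_add
    (lintegral_picks_mul_picks_le hx hy hkj hex hi)
    (mul_le_mul_right (lintegral_picks_mul_noTicket_le hx hy hkj hex hi) _))
    (mul_le_mul_right (lintegral_picks_mul_noTicket_le hy hx hkj.symm
      (fun e he ω => (hex e he.symm ω).symm) hi.symm) _))
    (mul_le_mul_right (lintegral_noTicket_mul_noTicket_le hx hy hkj hex) _)).trans_eq ?_
  rw [← ENNReal.ofReal_mul, ← ENNReal.ofReal_mul, ← ENNReal.ofReal_mul, ← ENNReal.ofReal_mul,
    ← ENNReal.ofReal_mul, ← ENNReal.ofReal_mul, ← ENNReal.ofReal_mul, ← ENNReal.ofReal_add,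
    ← ENNReal.ofReal_add, ← ENNReal.ofReal_add]
  · congr 1; ring
  all_goals positivity

/-- The two jobs cannot both be picked for `i` in the same round. Hence the bound only has to cover
one being picked while the other continues, and both continuing; `groupCorr` is the fixed point of
the resulting recursion. -/
lemma lintegral_pairStep_le_of_group_eq (hx : Fits x c) (hy : Fits y d) (hkj : k ≠ j)
    (hex : ∀ e, G e = H e →
      ∀ ω, roundTickets x c G k r ω e = 0 ∨ roundTickets y d H j r ω e = 0) (hi : G i = H i)
    (hxθ : x i ≤ theta) (hyθ : y i ≤ theta) :
    ∫⁻ ω, pairStep i (ENNReal.ofReal (x i)) (ENNReal.ofReal (y i))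
        (ENNReal.ofReal (groupCorr * (x i * y i)))
        (roundTickets x c G k r ω) (roundTickets y d H j r ω)
        (ω (Seed.pick k r)) (ω (Seed.pick j r)) ∂seedMeasure m ≤
      ENNReal.ofReal (groupCorr * (x i * y i)) := by
  have hx0 := hx.nonneg i
  have hy0 := hy.nonneg i
  have hexp : Real.exp (-1) ≤ 1 := Real.exp_le_one_iff.2 (by norm_num)
  have hexp0 := (Real.exp_pos (-1)).le
  have hq : 0 ≤ 1 - Real.exp (-1) := by linarith
  have hc0 : 0 ≤ groupCorr := by unfold groupCorr; positivity
  have h0 : ∀ ω : Seeds m, picks i (roundTickets x c G k r ω) (ω (Seed.pick k r)) *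
        picks i (roundTickets y d H j r ω) (ω (Seed.pick j r)) = 0 := by
    intro ω
    have hpick : ∀ (N : Fin m → ℕ) (u : unitInterval), N i = 0 → picks i N u = 0 := by
      intro N u hN
      refine Set.indicator_of_notMem (fun h => ?_) _
      have := pos_of_pickTicket_eq_some u.2.1 h
      omega
    rcases hex i hi ω with h | h
    · rw [hpick _ _ h, zero_mul]
    · rw [hpick _ _ h, mul_zero]
  rw [lintegral_pairStep, lintegral_congr h0, lintegral_zero, zero_add]
  refine (add_le_add (add_le_add
    (mul_le_mul_right (lintegral_picks_mul_noTicket_le_of_group_eq hx hy hkj hex) _)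
    (mul_le_mul_right (lintegral_picks_mul_noTicket_le_of_group_eq hy hx hkj.symm
      (fun e he ω => (hex e he.symm ω).symm)) _))
    (mul_le_mul_right (lintegral_noTicket_mul_noTicket_le hx hy hkj hex) _)).trans ?_
  rw [← ENNReal.ofReal_mul, ← ENNReal.ofReal_mul, ← ENNReal.ofReal_mul, ← ENNReal.ofReal_mul,
    ← ENNReal.ofReal_mul, ← ENNReal.ofReal_mul, ← ENNReal.ofReal_add, ← ENNReal.ofReal_add]
  · refine ENNReal.ofReal_le_ofReal ?_
    have e1 : ∀ z ≤ theta, Real.exp (-(1 - z)) ≤ Real.exp theta * Real.exp (-1) := by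
      intro z hz
      rw [← Real.exp_add]
      exact Real.exp_le_exp.2 (by linarith)
    -- The fixed point equation `C = 2 (1 - 1/e) e^{θ-1} + C e^{-2}`.
    have hkey : 2 * (1 - Real.exp (-1)) * (Real.exp theta * Real.exp (-1)) +
        groupCorr * (Real.exp (-1) * Real.exp (-1)) = groupCorr := by
      unfold groupCorr
      rw [Real.exp_neg]
      have := Real.exp_pos 1
      field_simp
      ring
    have hxy : 0 ≤ x i * y i * (1 - Real.exp (-1)) := by positivity
    have e2 := mul_le_mul_of_nonneg_left (e1 _ hxθ) hxy
    have e3 := mul_le_mul_of_nonneg_left (e1 _ hyθ) hxy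
    have e4 := congrArg (fun z => z * (x i * y i)) hkey
    linarith
  all_goals positivity

end Round

/-! ## The rounds as a process -/

/-- The last seeds of a round are indexed by it. -/
def Seed.round {m : ℕ} : Seed m → ℕ
  | recommend _ _ r => r
  | tickets _ _ r => r
  | pick _ r => r

instance : MeasurableSpace (Finset ℕ) := ⊤
instance : DiscreteMeasurableSpace (Finset ℕ) := ⟨fun _ => trivial⟩

section RoundProcess

variable {m : ℕ} (n : ℕ) (x : ℕ → Fin m → ℝ) (G : ℕ → Fin m → GroupName)

/-- The decrease of the recommendation variable of job `j` on machine `e` if `A` is the set of jobs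
that reach the round. -/
def shift (A : Finset ℕ) (j : ℕ) (e : Fin m) : ℝ :=
  ∑ k ∈ Finset.range j, if k ∈ A ∧ G k e = G j e then x k e else 0

/-- The tickets of job `j` in round `r` if `A` is the set of jobs that reach this round. -/
def tix (A : Finset ℕ) (j r : ℕ) (ω : Seeds m) : Fin m → ℕ :=
  roundTickets (x j) (shift x G A j) (G j) j r ω

/-- The jobs among the first `n` that reach round `r`. -/
def aliveSet (ω : Seeds m) : ℕ → Finset ℕ
  | 0 => Finset.range n
  | r + 1 => (aliveSet ω r).filter fun j => ∑ e, tix x G (aliveSet ω r) j r ω e = 0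

/-- The fractions of the jobs have total mass one, and those of a group fit into `[0, 1]`. -/
structure FitsGroups : Prop where
  nonneg : ∀ j e, 0 ≤ x j e
  sum_eq_one : ∀ j, ∑ e, x j e = 1
  le_one : ∀ j e, (∑ k ∈ Finset.range j, if G k e = G j e then x k e else 0) + x j e ≤ 1

variable {n x G}

lemma FitsGroups.fits (h : FitsGroups x G) (A : Finset ℕ) (j : ℕ) :
    Fits (x j) (shift x G A j) where
  nonneg := h.nonneg j
  sum_eq_one := h.sum_eq_one j
  shift_nonneg e := Finset.sum_nonneg fun k _ => by split_ifs <;> simp [h.nonneg]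
  le_one e := by
    refine le_trans (add_le_add_left ?_ _) (h.le_one j e)
    refine Finset.sum_le_sum fun k _ => ?_
    have := h.nonneg k e
    split_ifs <;> simp_all

/-- An earlier job that reaches the round has already shifted the shared variable by its fraction,
so the recommendation interval of the later job begins at or after the end of the earlier one. -/
lemma FitsGroups.exclusive (h : FitsGroups x G) {A : Finset ℕ} {k j : ℕ} (hkj : k < j)
    (hk : k ∈ A) {e : Fin m} (he : G k e = G j e) (r : ℕ) (ω : Seeds m) :
    tix x G A k r ω e = 0 ∨ tix x G A j r ω e = 0 := by
  have hle : shift x G A k e + x k e ≤ shift x G A j e := by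
    have h1 : shift x G A k e + x k e =
        ∑ l ∈ Finset.range (k + 1), if l ∈ A ∧ G l e = G j e then x l e else 0 := by
      rw [Finset.sum_range_succ, if_pos ⟨hk, he⟩, shift, he]
    rw [h1, shift]
    exact Finset.sum_le_sum_of_subset_of_nonneg (Finset.range_mono hkj) fun l _ _ => by
      split_ifs <;> simp [h.nonneg]
  by_contra! hcon
  obtain ⟨h1, h2⟩ := hcon
  unfold tix roundTickets ticket at h1 h2
  rw [he] at h1
  split_ifs at h1 h2 with h3 h4
  · have := h3.2
    have := h4.1
    linarith
  · exact h2 rfl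
  · exact h1 rfl
  · exact h1 rfl

lemma measurable_tix (A : Finset ℕ) (j r : ℕ) : Measurable (tix x G A j r) :=
  measurable_roundTickets _ _ _ _ _

lemma dependsOn_tix (A : Finset ℕ) (j r : ℕ) : DependsOn (tix x G A j r) {s | s.round = r} := by
  intro ω ω' h
  funext e
  exact dependsOn_roundTickets (x j) (shift x G A j) (G j) j r e fun s hs => h s (by
    rcases hs with rfl | rfl <;> rfl)

lemma aliveSet_subset (ω : Seeds m) (r : ℕ) : aliveSet n x G ω r ⊆ Finset.range n := by
  induction r with
  | zero => exact subset_rfl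
  | succ r ih => exact (Finset.filter_subset _ _).trans ih

lemma measurable_aliveSet (r : ℕ) : Measurable fun ω : Seeds m => aliveSet n x G ω r := by
  induction r with
  | zero => exact measurable_const
  | succ r ih =>
    have h : Measurable fun p : Finset ℕ × Seeds m =>
        p.1.filter fun j => ∑ e, tix x G p.1 j r p.2 e = 0 := by
      refine measurable_from_prod_countable_right fun A => measurable_to_countable' fun B => ?_
      have : (fun ω : Seeds m => A.filter fun j => ∑ e, tix x G A j r ω e = 0) ⁻¹' {B} =
          ⋂ j, {ω | (j ∈ A ∧ ∑ e, tix x G A j r ω e = 0) ↔ j ∈ B} := by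
        ext ω
        simp [Finset.ext_iff]
      rw [this]
      refine MeasurableSet.iInter fun j => ?_
      have h0 : MeasurableSet {ω : Seeds m | ∑ e, tix x G A j r ω e = 0} :=
        ((measurable_of_countable fun N : Fin m → ℕ => ∑ e, N e).comp (measurable_tix A j r))
          (measurableSet_singleton 0)
      by_cases hA : j ∈ A <;> by_cases hB : j ∈ B <;> simp only [hA, hB, true_and, false_and,
        iff_true, iff_false]
      · exact h0
      · exact h0.compl
      · exact MeasurableSet.const _
      · exact MeasurableSet.const _
    exact Measurable.comp (f := fun ω : Seeds m => (aliveSet n x G ω r, ω))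
      (g := fun p : Finset ℕ × Seeds m =>
        p.1.filter fun j => ∑ e, tix x G p.1 j r p.2 e = 0) h (ih.prodMk measurable_id)

lemma dependsOn_aliveSet (r : ℕ) :
    DependsOn (fun ω : Seeds m => aliveSet n x G ω r) {s | s.round < r} := by
  induction r with
  | zero => exact fun _ _ _ => rfl
  | succ r ih =>
    intro ω ω' h
    have h1 : aliveSet n x G ω r = aliveSet n x G ω' r :=
      ih fun s hs => h s (Nat.lt_succ_of_lt hs)
    have h2 : ∀ j, tix x G (aliveSet n x G ω' r) j r ω = tix x G (aliveSet n x G ω' r) j r ω' :=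
      fun j => dependsOn_tix _ j r fun s hs => h s (by
        rw [Set.mem_ofPred_eq] at hs ⊢; omega)
    simp only [aliveSet, h1, h2]

/-- Conditioning on the set of jobs that reach round `r`. -/
lemma lintegral_mul_aliveSet {r : ℕ} {Z : Seeds m → ℝ≥0∞} (hZ : Measurable Z)
    (hZr : DependsOn Z {s | s.round < r}) {Φ : Finset ℕ → Seeds m → ℝ≥0∞}
    (hΦ : ∀ A, Measurable (Φ A)) (hΦr : ∀ A, DependsOn (Φ A) {s | s.round = r}) :
    ∫⁻ ω, Z ω * Φ (aliveSet n x G ω r) ω ∂seedMeasure m =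
      ∑ A ∈ (Finset.range n).powerset,
        (∫⁻ ω, Z ω * (if aliveSet n x G ω r = A then 1 else 0) ∂seedMeasure m) *
          ∫⁻ ω, Φ A ω ∂seedMeasure m := by
  have hI : ∀ A, Measurable fun ω : Seeds m =>
      if aliveSet n x G ω r = A then (1 : ℝ≥0∞) else 0 := fun A =>
    Measurable.ite (measurable_aliveSet r (measurableSet_singleton A)) measurable_const
      measurable_const
  have h1 : ∀ A, (∫⁻ ω, Z ω * (if aliveSet n x G ω r = A then 1 else 0) ∂seedMeasure m) *
      ∫⁻ ω, Φ A ω ∂seedMeasure m =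
      ∫⁻ ω, (Z ω * (if aliveSet n x G ω r = A then 1 else 0)) * Φ A ω ∂seedMeasure m := by
    intro A
    refine (lintegral_seed_mul (hZ.mul (hI A)) (hΦ A) (S := {s | s.round < r})
      (T := {s | s.round = r}) ?_ (hΦr A) ?_).symm
    · intro ω ω' h
      have h2 : aliveSet n x G ω r = aliveSet n x G ω' r := dependsOn_aliveSet r h
      simp only [Pi.mul_apply, hZr h, h2]
    · rw [Set.disjoint_left]
      intro s h2 h3
      rw [Set.mem_ofPred_eq] at h2 h3
      omega
  simp_rw [h1]
  rw [← lintegral_finsetSum (f := fun A ω =>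
    Z ω * (if aliveSet n x G ω r = A then 1 else 0) * Φ A ω) _
    fun A _ => (hZ.mul (hI A)).mul (hΦ A)]
  refine lintegral_congr fun ω => ?_
  rw [Finset.sum_eq_single_of_mem (aliveSet n x G ω r)
    (Finset.mem_powerset.2 (aliveSet_subset ω r))]
  · simp
  · intro A _ hA
    simp [hA.symm]

/-- The bound is needed only for sets on which `Z` does not vanish. For pairs this is the condition
that the earlier job is still unassigned, without which exclusivity would not be available. -/
lemma lintegral_mul_aliveSet_le {r : ℕ} {Z : Seeds m → ℝ≥0∞} (hZ : Measurable Z)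
    (hZr : DependsOn Z {s | s.round < r}) {Φ : Finset ℕ → Seeds m → ℝ≥0∞}
    (hΦ : ∀ A, Measurable (Φ A)) (hΦr : ∀ A, DependsOn (Φ A) {s | s.round = r})
    {κ : ℝ≥0∞} {p : Finset ℕ → Prop} (hκ : ∀ A, p A → ∫⁻ ω, Φ A ω ∂seedMeasure m ≤ κ)
    (hp : ∀ ω, ¬ p (aliveSet n x G ω r) → Z ω = 0) :
    ∫⁻ ω, Z ω * Φ (aliveSet n x G ω r) ω ∂seedMeasure m ≤ (∫⁻ ω, Z ω ∂seedMeasure m) * κ := by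
  have h1 := lintegral_mul_aliveSet (n := n) (x := x) (G := G) hZ hZr (Φ := fun _ _ => 1)
    (fun _ => measurable_const) (fun _ _ _ _ => rfl)
  simp only [mul_one, lintegral_const, measure_univ] at h1
  rw [h1, lintegral_mul_aliveSet hZ hZr hΦ hΦr, Finset.sum_mul]
  refine Finset.sum_le_sum fun A _ => ?_
  by_cases hA : p A
  · exact mul_le_mul_right (hκ A hA) _
  · have : ∀ ω : Seeds m, Z ω * (if aliveSet n x G ω r = A then 1 else 0) = 0 := by
      intro ω
      split_ifs with h
      · rw [hp ω (h ▸ hA), zero_mul]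
      · exact mul_zero _
    rw [lintegral_congr this, lintegral_zero, zero_mul, zero_mul]

lemma lintegral_mul_aliveSet_eq {r : ℕ} {Z : Seeds m → ℝ≥0∞} (hZ : Measurable Z)
    (hZr : DependsOn Z {s | s.round < r}) {Φ : Finset ℕ → Seeds m → ℝ≥0∞}
    (hΦ : ∀ A, Measurable (Φ A)) (hΦr : ∀ A, DependsOn (Φ A) {s | s.round = r})
    {κ : ℝ≥0∞} (hκ : ∀ A, ∫⁻ ω, Φ A ω ∂seedMeasure m = κ) :
    ∫⁻ ω, Z ω * Φ (aliveSet n x G ω r) ω ∂seedMeasure m = (∫⁻ ω, Z ω ∂seedMeasure m) * κ := by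
  have h1 := lintegral_mul_aliveSet (n := n) (x := x) (G := G) hZ hZr (Φ := fun _ _ => 1)
    (fun _ => measurable_const) (fun _ _ _ _ => rfl)
  simp only [mul_one, lintegral_const, measure_univ] at h1
  rw [h1, lintegral_mul_aliveSet hZ hZr hΦ hΦr, Finset.sum_mul]
  exact Finset.sum_congr rfl fun A _ => by rw [hκ A]

end RoundProcess

/-! ### The status of the jobs from round to round. -/

section RoundProcess

variable {m : ℕ} (n : ℕ) (x : ℕ → Fin m → ℝ) (G : ℕ → Fin m → GroupName)

/-- The indicator that job `j` reaches round `r`. -/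
def alive (j r : ℕ) (ω : Seeds m) : ℝ≥0∞ := if j ∈ aliveSet n x G ω r then 1 else 0

/-- The indicator that job `j` is assigned to machine `i` in round `r`, provided that it reaches
this round. -/
def roundPick (i : Fin m) (j r : ℕ) (ω : Seeds m) : ℝ≥0∞ :=
  picks i (tix x G (aliveSet n x G ω r) j r ω) (ω (Seed.pick j r))

/-- The indicator that job `j` is assigned to machine `i` before round `r`. -/
def decided (i : Fin m) (j r : ℕ) (ω : Seeds m) : ℝ≥0∞ :=
  ∑ r' ∈ Finset.range r, alive n x G j r' ω * roundPick n x G i j r' ω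

variable {n x G} {i : Fin m} {k j : ℕ}

lemma alive_succ (j r : ℕ) (ω : Seeds m) :
    alive n x G j (r + 1) ω =
      alive n x G j r ω * noTicket (tix x G (aliveSet n x G ω r) j r ω) := by
  unfold alive noTicket
  rw [prod_powW_zero]
  simp only [aliveSet, Finset.mem_filter]
  split_ifs <;> simp_all

lemma decided_succ (i : Fin m) (j r : ℕ) (ω : Seeds m) :
    decided n x G i j (r + 1) ω =
      decided n x G i j r ω + alive n x G j r ω * roundPick n x G i j r ω :=
  Finset.sum_range_succ _ _

lemma measurable_alive (j r : ℕ) : Measurable (alive n x G j r) :=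
  (measurable_of_countable fun A : Finset ℕ => if j ∈ A then (1 : ℝ≥0∞) else 0).comp
    (measurable_aliveSet r)

lemma dependsOn_alive (j r : ℕ) : DependsOn (alive n x G j r) {s | s.round < r} := by
  intro ω ω' h
  have h1 : aliveSet n x G ω r = aliveSet n x G ω' r := dependsOn_aliveSet r h
  simp only [alive, h1]

lemma measurable_tix_aliveSet (j r : ℕ) :
    Measurable fun ω : Seeds m => tix x G (aliveSet n x G ω r) j r ω := by
  have h : Measurable fun p : Finset ℕ × Seeds m => tix x G p.1 j r p.2 :=
    measurable_from_prod_countable_right fun A => measurable_tix A j r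
  exact Measurable.comp (f := fun ω : Seeds m => (aliveSet n x G ω r, ω))
    (g := fun p : Finset ℕ × Seeds m => tix x G p.1 j r p.2) h
    ((measurable_aliveSet r).prodMk measurable_id)

lemma measurable_roundPick (i : Fin m) (j r : ℕ) : Measurable (roundPick n x G i j r) :=
  measurable_picks_comp (measurable_tix_aliveSet j r) i _

lemma dependsOn_tix_aliveSet (j r : ℕ) :
    DependsOn (fun ω : Seeds m => tix x G (aliveSet n x G ω r) j r ω) {s | s.round < r + 1} := by
  intro ω ω' h
  have h1 : aliveSet n x G ω r = aliveSet n x G ω' r :=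
    dependsOn_aliveSet r fun s hs => h s (Nat.lt_succ_of_lt hs)
  have hT := dependsOn_tix (x := x) (G := G) (aliveSet n x G ω' r) j r
  have h2 := hT (x := ω) (y := ω') fun s hs => h s (by rw [Set.mem_ofPred_eq] at hs ⊢; omega)
  simp only [h1, h2]

lemma dependsOn_roundPick (i : Fin m) (j r : ℕ) :
    DependsOn (roundPick n x G i j r) {s | s.round < r + 1} := by
  intro ω ω' h
  have h1 := dependsOn_tix_aliveSet (n := n) (x := x) (G := G) j r h
  have h2 := h (Seed.pick j r) (by simp [Seed.round])
  simp only [roundPick, h2]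
  exact congrArg (fun N => picks i N (ω' (Seed.pick j r))) h1

lemma measurable_decided (i : Fin m) (j r : ℕ) : Measurable (decided n x G i j r) :=
  Finset.measurable_fun_sum _ fun r' _ => (measurable_alive j r').mul (measurable_roundPick i j r')

lemma dependsOn_decided (i : Fin m) (j r : ℕ) :
    DependsOn (decided n x G i j r) {s | s.round < r} := by
  intro ω ω' h
  refine Finset.sum_congr rfl fun r' hr' => ?_
  have hr : r' < r := Finset.mem_range.1 hr'
  exact congrArg₂ _ (dependsOn_alive j r' fun s hs => h s (by rw [Set.mem_ofPred_eq] at hs ⊢; omega))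
    (dependsOn_roundPick i j r' fun s hs => h s (by rw [Set.mem_ofPred_eq] at hs ⊢; omega))

lemma monotone_decided (i : Fin m) (j : ℕ) : Monotone (decided n x G i j) := by
  refine monotone_nat_of_le_succ fun r ω => ?_
  rw [decided_succ]
  exact le_self_add

/-! ### A single job -/

lemma lintegral_alive (h : FitsGroups x G) (hj : j < n) (r : ℕ) :
    ∫⁻ ω, alive n x G j r ω ∂seedMeasure m = ENNReal.ofReal (Real.exp (-1)) ^ r := by
  induction r with
  | zero => simp [alive, aliveSet, hj]
  | succ r ih =>
    simp_rw [alive_succ]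
    rw [lintegral_mul_aliveSet_eq (measurable_alive j r) (dependsOn_alive j r)
      (Φ := fun A ω => noTicket (tix x G A j r ω)) (fun A => measurable_noTicket _ (measurable_tix A j r))
      (fun A ω ω' h => congrArg noTicket (dependsOn_tix A j r h))
      fun A => lintegral_no_ticket (h.fits A j), ih, pow_succ]

lemma measurable_picks_tix (A : Finset ℕ) (i : Fin m) (j r : ℕ) :
    Measurable fun ω : Seeds m => picks i (tix x G A j r ω) (ω (Seed.pick j r)) :=
  measurable_picks_comp (measurable_tix A j r) i _

lemma dependsOn_picks_tix (A : Finset ℕ) (i : Fin m) (j r : ℕ) :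
    DependsOn (fun ω : Seeds m => picks i (tix x G A j r ω) (ω (Seed.pick j r)))
      {s | s.round = r} := by
  intro ω ω' h
  have h1 := dependsOn_tix (x := x) (G := G) A j r h
  have h2 := h (Seed.pick j r) rfl
  simp only [h1, h2]

/-- Conditionally on the past, an unassigned job is picked for `i` with probability `x_i (1 - 1/e)`
and survives with probability `1/e`, so the weight `x_i` on being alive makes the sum a martingale.
-/
lemma lintegral_decided_add_alive (h : FitsGroups x G) (hj : j < n) (i : Fin m) (r : ℕ) :
    ∫⁻ ω, decided n x G i j r ω ∂seedMeasure m +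
      ENNReal.ofReal (x j i) * ∫⁻ ω, alive n x G j r ω ∂seedMeasure m = ENNReal.ofReal (x j i) := by
  induction r with
  | zero => simp [decided, alive, aliveSet, hj]
  | succ r ih =>
    have hm := (measurable_alive (n := n) (x := x) (G := G) j (r + 1)).const_mul
      (ENNReal.ofReal (x j i))
    have e1 : ∀ ω, decided n x G i j (r + 1) ω +
        ENNReal.ofReal (x j i) * alive n x G j (r + 1) ω =
        decided n x G i j r ω + alive n x G j r ω *
          (picks i (tix x G (aliveSet n x G ω r) j r ω) (ω (Seed.pick j r)) +
            ENNReal.ofReal (x j i) * noTicket (tix x G (aliveSet n x G ω r) j r ω)) := by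
      intro ω
      rw [decided_succ, alive_succ, roundPick]
      ring
    rw [← lintegral_const_mul _ (measurable_alive j (r + 1)), ← lintegral_add_right _ hm,
      lintegral_congr e1, lintegral_add_left (measurable_decided i j r),
      lintegral_mul_aliveSet_eq (measurable_alive j r) (dependsOn_alive j r)
        (Φ := fun A ω => picks i (tix x G A j r ω) (ω (Seed.pick j r)) +
          ENNReal.ofReal (x j i) * noTicket (tix x G A j r ω))
        (κ := ENNReal.ofReal (x j i)), mul_comm]
    · exact ih
    · exact fun A => (measurable_picks_tix A i j r).add
        ((measurable_noTicket _ (measurable_tix A j r)).const_mul _)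
    · intro A ω ω' h'
      exact congrArg₂ _ (dependsOn_picks_tix A i j r h')
        (congrArg (fun N => ENNReal.ofReal (x j i) * noTicket N) (dependsOn_tix A j r h'))
    · exact fun A => lintegral_picks_add_noTicket (h.fits A j) i

/-- The probability that job `j` is eventually assigned to machine `i` in some round. -/
lemma le_lintegral_iSup_decided (h : FitsGroups x G) (hj : j < n) (i : Fin m) :
    ENNReal.ofReal (x j i) ≤ ∫⁻ ω, ⨆ r, decided n x G i j r ω ∂seedMeasure m := by
  have h1 : ∀ r, ENNReal.ofReal (x j i) ≤
      ∫⁻ ω, ⨆ r, decided n x G i j r ω ∂seedMeasure m +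
        ENNReal.ofReal (x j i) * ENNReal.ofReal (Real.exp (-1)) ^ r := by
    intro r
    rw [← lintegral_alive h hj r]
    conv_lhs => rw [← lintegral_decided_add_alive h hj i r]
    exact add_le_add_left (lintegral_mono fun ω => le_iSup (fun r => decided n x G i j r ω) r) _
  have h2 : Filter.Tendsto (fun r => ∫⁻ ω, ⨆ r, decided n x G i j r ω ∂seedMeasure m +
      ENNReal.ofReal (x j i) * ENNReal.ofReal (Real.exp (-1)) ^ r) Filter.atTop
      (nhds (∫⁻ ω, ⨆ r, decided n x G i j r ω ∂seedMeasure m + ENNReal.ofReal (x j i) * 0)) := by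
    refine Filter.Tendsto.add tendsto_const_nhds (ENNReal.Tendsto.const_mul
      (ENNReal.tendsto_pow_atTop_nhds_zero_of_lt_one ?_) (Or.inr ENNReal.ofReal_ne_top))
    rw [ENNReal.ofReal_lt_one]
    exact (Real.exp_lt_exp.2 (by norm_num)).trans_eq Real.exp_zero
  rw [mul_zero, add_zero] at h2
  exact ge_of_tendsto' h2 h1

/-! ### Two jobs -/

lemma lintegral_pairStep_tix_le (h : FitsGroups x G) (hkj : k < j) {A : Finset ℕ} (hk : k ∈ A)
    (i : Fin m) (hi : G k i ≠ G j i) (r : ℕ) :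
    ∫⁻ ω, pairStep i (ENNReal.ofReal (x k i)) (ENNReal.ofReal (x j i))
      (ENNReal.ofReal (x k i * x j i)) (tix x G A k r ω) (tix x G A j r ω)
      (ω (Seed.pick k r)) (ω (Seed.pick j r)) ∂seedMeasure m ≤ ENNReal.ofReal (x k i * x j i) :=
  lintegral_pairStep_le (h.fits A k) (h.fits A j) hkj.ne (fun _ he ω => h.exclusive hkj hk he r ω) hi

lemma lintegral_pairStep_tix_le_of_group_eq (h : FitsGroups x G) (hkj : k < j) {A : Finset ℕ}
    (hk : k ∈ A) (i : Fin m) (hi : G k i = G j i) (hxk : x k i ≤ theta) (hxj : x j i ≤ theta)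
    (r : ℕ) :
    ∫⁻ ω, pairStep i (ENNReal.ofReal (x k i)) (ENNReal.ofReal (x j i))
      (ENNReal.ofReal (groupCorr * (x k i * x j i))) (tix x G A k r ω) (tix x G A j r ω)
      (ω (Seed.pick k r)) (ω (Seed.pick j r)) ∂seedMeasure m ≤
      ENNReal.ofReal (groupCorr * (x k i * x j i)) :=
  lintegral_pairStep_le_of_group_eq (h.fits A k) (h.fits A j) hkj.ne
    (fun _ he ω => h.exclusive hkj hk he r ω) hi hxk hxj

lemma measurable_pairStep_tix (i : Fin m) (X Y C : ℝ≥0∞) (A : Finset ℕ) (k j r : ℕ) :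
    Measurable fun ω => pairStep i X Y C (tix x G A k r ω) (tix x G A j r ω)
      (ω (Seed.pick k r)) (ω (Seed.pick j r)) := by
  have h1 := measurable_picks_tix (x := x) (G := G) A i k r
  have h2 := measurable_picks_tix (x := x) (G := G) A i j r
  have h3 := measurable_noTicket _ (measurable_tix (x := x) (G := G) A k r)
  have h4 := measurable_noTicket _ (measurable_tix (x := x) (G := G) A j r)
  exact (((h1.mul h2).add ((h1.mul h4).const_mul Y)).add ((h2.mul h3).const_mul X)).add
    ((h3.mul h4).const_mul C)

/-- The bound for the probability that two jobs have been assigned to machine `i`, given the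
rounds before `r`. -/
def pairPotential (n : ℕ) (x : ℕ → Fin m → ℝ) (G : ℕ → Fin m → GroupName) (i : Fin m) (k j : ℕ)
    (C : ℝ≥0∞) (r : ℕ) (ω : Seeds m) : ℝ≥0∞ :=
  decided n x G i k r ω * decided n x G i j r ω +
    ENNReal.ofReal (x j i) * (decided n x G i k r ω * alive n x G j r ω) +
    ENNReal.ofReal (x k i) * (decided n x G i j r ω * alive n x G k r ω) +
    C * (alive n x G k r ω * alive n x G j r ω)

/-- The terms are sorted by the status before the round: both decided, exactly one decided, or none.
Each past status is then multiplied by a factor whose conditional expectation is already known. -/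
lemma pairPotential_succ (C : ℝ≥0∞) (r : ℕ) (ω : Seeds m) :
    pairPotential n x G i k j C (r + 1) ω =
      decided n x G i k r ω * decided n x G i j r ω +
      (decided n x G i k r ω * alive n x G j r ω) *
        (picks i (tix x G (aliveSet n x G ω r) j r ω) (ω (Seed.pick j r)) +
          ENNReal.ofReal (x j i) * noTicket (tix x G (aliveSet n x G ω r) j r ω)) +
      (decided n x G i j r ω * alive n x G k r ω) *
        (picks i (tix x G (aliveSet n x G ω r) k r ω) (ω (Seed.pick k r)) +
          ENNReal.ofReal (x k i) * noTicket (tix x G (aliveSet n x G ω r) k r ω)) +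
      (alive n x G k r ω * alive n x G j r ω) *
        pairStep i (ENNReal.ofReal (x k i)) (ENNReal.ofReal (x j i)) C
          (tix x G (aliveSet n x G ω r) k r ω) (tix x G (aliveSet n x G ω r) j r ω)
          (ω (Seed.pick k r)) (ω (Seed.pick j r)) := by
  unfold pairPotential pairStep
  simp only [decided_succ, alive_succ, roundPick]
  ring

lemma lintegral_mul_add_noTicket (h : FitsGroups x G) {r : ℕ} {Z : Seeds m → ℝ≥0∞}
    (hZ : Measurable Z) (hZr : DependsOn Z {s | s.round < r}) (i : Fin m) (j : ℕ) :
    ∫⁻ ω, Z ω * (picks i (tix x G (aliveSet n x G ω r) j r ω) (ω (Seed.pick j r)) +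
          ENNReal.ofReal (x j i) * noTicket (tix x G (aliveSet n x G ω r) j r ω)) ∂seedMeasure m =
      ENNReal.ofReal (x j i) * ∫⁻ ω, Z ω ∂seedMeasure m := by
  rw [lintegral_mul_aliveSet_eq hZ hZr
        (Φ := fun A ω => picks i (tix x G A j r ω) (ω (Seed.pick j r)) +
          ENNReal.ofReal (x j i) * noTicket (tix x G A j r ω))
        (κ := ENNReal.ofReal (x j i)), mul_comm]
  · exact fun A => (measurable_picks_tix A i j r).add
      ((measurable_noTicket _ (measurable_tix A j r)).const_mul _)
  · intro A ω ω' h'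
    exact congrArg₂ _ (dependsOn_picks_tix A i j r h')
      (congrArg (fun N => ENNReal.ofReal (x j i) * noTicket N) (dependsOn_tix A j r h'))
  · exact fun A => lintegral_picks_add_noTicket (h.fits A j) i

lemma lintegral_add_four {Ω : Type*} [MeasurableSpace Ω] {μ : Measure Ω} {f₀ f₁ f₂ : Ω → ℝ≥0∞}
    (f₃ : Ω → ℝ≥0∞) (h₀ : Measurable f₀) (h₁ : Measurable f₁) (h₂ : Measurable f₂) :
    ∫⁻ ω, (f₀ ω + f₁ ω + f₂ ω + f₃ ω) ∂μ =
      ∫⁻ ω, f₀ ω ∂μ + ∫⁻ ω, f₁ ω ∂μ + ∫⁻ ω, f₂ ω ∂μ + ∫⁻ ω, f₃ ω ∂μ := by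
  have h01 : Measurable fun ω => f₀ ω + f₁ ω := h₀.add h₁
  have h012 : Measurable fun ω => f₀ ω + f₁ ω + f₂ ω := h01.add h₂
  rw [lintegral_add_left h012, lintegral_add_left h01, lintegral_add_left h₀]

/-- The terms with at least one decided job are preserved exactly, by the martingale property of the
other job; only the term with both jobs alive uses the assumption on `C`. -/
lemma lintegral_pairPotential_succ_le (h : FitsGroups x G) {C : ℝ≥0∞} {r : ℕ}
    (hC : ∀ A : Finset ℕ, k ∈ A →
      ∫⁻ ω, pairStep i (ENNReal.ofReal (x k i)) (ENNReal.ofReal (x j i)) C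
        (tix x G A k r ω) (tix x G A j r ω) (ω (Seed.pick k r)) (ω (Seed.pick j r))
        ∂seedMeasure m ≤ C) :
    ∫⁻ ω, pairPotential n x G i k j C (r + 1) ω ∂seedMeasure m ≤
      ∫⁻ ω, pairPotential n x G i k j C r ω ∂seedMeasure m := by
  have mk := measurable_decided (n := n) (x := x) (G := G) i k r
  have mj := measurable_decided (n := n) (x := x) (G := G) i j r
  have ak := measurable_alive (n := n) (x := x) (G := G) k r
  have aj := measurable_alive (n := n) (x := x) (G := G) j r
  have dmk := dependsOn_decided (n := n) (x := x) (G := G) i k r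
  have dmj := dependsOn_decided (n := n) (x := x) (G := G) i j r
  have dak := dependsOn_alive (n := n) (x := x) (G := G) k r
  have daj := dependsOn_alive (n := n) (x := x) (G := G) j r
  have m0 : Measurable fun ω => decided n x G i k r ω * decided n x G i j r ω := mk.mul mj
  have m1 : Measurable fun ω => decided n x G i k r ω * alive n x G j r ω := mk.mul aj
  have m2 : Measurable fun ω => decided n x G i j r ω * alive n x G k r ω := mj.mul ak
  have m3 : Measurable fun ω => alive n x G k r ω * alive n x G j r ω := ak.mul aj
  have d1 : DependsOn (fun ω => decided n x G i k r ω * alive n x G j r ω) {s | s.round < r} :=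
    fun ω ω' h => congrArg₂ _ (dmk h) (daj h)
  have d2 : DependsOn (fun ω => decided n x G i j r ω * alive n x G k r ω) {s | s.round < r} :=
    fun ω ω' h => congrArg₂ _ (dmj h) (dak h)
  have d3 : DependsOn (fun ω => alive n x G k r ω * alive n x G j r ω) {s | s.round < r} :=
    fun ω ω' h => congrArg₂ _ (dak h) (daj h)
  have mt : ∀ l, Measurable fun ω : Seeds m =>
      picks i (tix x G (aliveSet n x G ω r) l r ω) (ω (Seed.pick l r)) +
        ENNReal.ofReal (x l i) * noTicket (tix x G (aliveSet n x G ω r) l r ω) := fun l =>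
    (measurable_roundPick i l r).add
      ((measurable_noTicket _ (measurable_tix_aliveSet l r)).const_mul _)
  have m1t : Measurable fun ω => (decided n x G i k r ω * alive n x G j r ω) *
      (picks i (tix x G (aliveSet n x G ω r) j r ω) (ω (Seed.pick j r)) +
        ENNReal.ofReal (x j i) * noTicket (tix x G (aliveSet n x G ω r) j r ω)) := m1.mul (mt j)
  have m2t : Measurable fun ω => (decided n x G i j r ω * alive n x G k r ω) *
      (picks i (tix x G (aliveSet n x G ω r) k r ω) (ω (Seed.pick k r)) +
        ENNReal.ofReal (x k i) * noTicket (tix x G (aliveSet n x G ω r) k r ω)) := m2.mul (mt k)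
  have hpair := lintegral_mul_aliveSet_le (n := n) m3 d3
    (Φ := fun A ω => pairStep i (ENNReal.ofReal (x k i)) (ENNReal.ofReal (x j i)) C
        (tix x G A k r ω) (tix x G A j r ω) (ω (Seed.pick k r)) (ω (Seed.pick j r)))
    (fun A => measurable_pairStep_tix i _ _ C A k j r)
    (fun A ω ω' h => by
      have h1 := dependsOn_tix (x := x) (G := G) A j r h
      have h2 := dependsOn_tix (x := x) (G := G) A k r h
      have h3 := h (Seed.pick j r) rfl
      have h4 := h (Seed.pick k r) rfl
      simp only [h1, h2, h3, h4])
    (p := fun A => k ∈ A) hC (fun ω hω => by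
      have : alive n x G k r ω = 0 := if_neg hω
      rw [this, zero_mul])
  simp_rw [pairPotential_succ]
  rw [lintegral_add_four _ m0 m1t m2t, lintegral_mul_add_noTicket h m1 d1 i j,
    lintegral_mul_add_noTicket h m2 d2 i k]
  unfold pairPotential
  rw [lintegral_add_four _ m0 (m1.const_mul _) (m2.const_mul _), lintegral_const_mul _ m3,
    lintegral_const_mul _ m2, lintegral_const_mul _ m1]
  refine add_le_add_right ?_ _
  rw [mul_comm C]
  exact hpair

/-- The probability that two jobs are eventually assigned to the same machine. -/
lemma lintegral_iSup_decided_mul_le (h : FitsGroups x G) (hk : k < n) (hj : j < n) {C : ℝ≥0∞}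
    (hC : ∀ r, ∀ A : Finset ℕ, k ∈ A →
      ∫⁻ ω, pairStep i (ENNReal.ofReal (x k i)) (ENNReal.ofReal (x j i)) C
        (tix x G A k r ω) (tix x G A j r ω) (ω (Seed.pick k r)) (ω (Seed.pick j r))
        ∂seedMeasure m ≤ C) :
    ∫⁻ ω, (⨆ r, decided n x G i k r ω) * (⨆ r, decided n x G i j r ω) ∂seedMeasure m ≤ C := by
  have h1 : ∀ r, ∫⁻ ω, pairPotential n x G i k j C r ω ∂seedMeasure m ≤ C := by
    intro r
    induction r with
    | zero => simp [pairPotential, decided, alive, aliveSet, hk, hj]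
    | succ r ih => exact (lintegral_pairPotential_succ_le h (hC r)).trans ih
  -- Both sequences are monotone, so two rounds can be replaced by their maximum, and monotone
  -- convergence applies to the product.
  have h2 : ∀ ω, (⨆ r, decided n x G i k r ω) * (⨆ r, decided n x G i j r ω) ≤
      ⨆ r, decided n x G i k r ω * decided n x G i j r ω := by
    intro ω
    rw [ENNReal.iSup_mul]
    refine iSup_le fun r => ?_
    rw [ENNReal.mul_iSup]
    exact iSup_le fun r' => le_trans (mul_le_mul'
      (monotone_decided i k (le_max_left r r') ω) (monotone_decided i j (le_max_right r r') ω))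
      (le_iSup (fun r => decided n x G i k r ω * decided n x G i j r ω) (max r r'))
  refine (lintegral_mono h2).trans ?_
  rw [lintegral_iSup (f := fun r ω => decided n x G i k r ω * decided n x G i j r ω)
    (fun r => (measurable_decided i k r).mul (measurable_decided i j r))
    fun r r' hr ω => mul_le_mul' (monotone_decided i k hr ω) (monotone_decided i j hr ω)]
  refine iSup_le fun r => le_trans (lintegral_mono fun ω => ?_) (h1 r)
  unfold pairPotential
  rw [add_assoc, add_assoc]
  exact le_self_add

end RoundProcess

/-! ## Instances as prefixes of sequences of jobs -/

/-- The first `n` jobs of a sequence. -/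
def pre {m : ℕ} (J : ℕ → Job m) (n : ℕ) : Fin n → Job m := fun k => J k

/-- Working with infinite sequences makes prefixes of prefixes definitionally equal, so that the
recursion of the states unfolds by `rfl`. -/
lemma exists_eq_pre {m n : ℕ} (J : Fin (n + 1) → Job m) : ∃ J' : ℕ → Job m, J = pre J' (n + 1) :=
  ⟨fun k => if h : k < n + 1 then J ⟨k, h⟩ else J 0, by funext k; simp only [pre, dif_pos k.isLt]⟩

section Sequence

variable {m : ℕ} (W : FractionalRule m) (J : ℕ → Job m)

/-- The fractional solution for job `j`. -/
def sol (j : ℕ) : Fractional m := W j (pre J (j + 1))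

/-- The fractional assignment of job `j`. -/
def frac (j : ℕ) : Fin m → ℝ := (sol W J j).x

/-- The groups of job `j`. -/
def grp (j : ℕ) : Fin m → GroupName := groupOf W j (pre J (j + 1))

/-- The state of machine `i` before job `j`. -/
def st (j : ℕ) (i : Fin m) : MachineState := state W j (pre J j) i

lemma st_zero (i : Fin m) : st W J 0 i = MachineState.init := rfl

lemma st_succ (j : ℕ) (i : Fin m) :
    st W J (j + 1) i = updateMachine (st W J j i) (J j) (sol W J j) i := rfl

variable {W J}

lemma grp_of_hard {j : ℕ} {i : Fin m} (h : IsHard (st W J j i) (J j) (sol W J j) i) :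
    grp W J j i = Sum.inr (st W J j i).group := if_pos h

lemma grp_of_not_hard {j : ℕ} {i : Fin m} (h : ¬ IsHard (st W J j i) (J j) (sol W J j) i) :
    grp W J j i = Sum.inl j := if_neg h

lemma IsWaterFilling.isEquilibrium (hW : IsWaterFilling W) (j : ℕ) :
    IsEquilibrium (st W J j) (J j) (sol W J j) := hW j (pre J (j + 1))

/-- The three ways in which the state of a machine changes. -/
lemma updateMachine_cases {s : MachineState} {job : Job m} {F : Fractional m} {i : Fin m}
    {p : MachineState → Prop} (h₀ : i ∉ job.feasible → p s)
    (h₁ : i ∈ job.feasible → ¬ IsHard s job F i →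
      p { s with expLoad := s.expLoad + job.weight i * F.x i, nu := nuHat s job F i })
    (h₂ : IsHard s job F i → 1 - theta < s.mass + F.x i →
      p { expLoad := s.expLoad + job.weight i * F.x i
          nu := nuHat s job F i + lam * (s.start.getD s.nu) ^ 2 / nuHat s job F i
          group := s.group + 1
          mass := 0
          start := none })
    (h₃ : IsHard s job F i → s.mass + F.x i ≤ 1 - theta →
      p { expLoad := s.expLoad + job.weight i * F.x i
          nu := nuHat s job F i
          group := s.group
          mass := s.mass + F.x i
          start := some (s.start.getD s.nu) }) : p (updateMachine s job F i) := by
  unfold updateMachine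
  by_cases h1 : i ∈ job.feasible
  · rw [if_neg (not_not.2 h1)]
    by_cases h2 : IsHard s job F i
    · rw [if_neg (not_not.2 h2)]
      by_cases h3 : 1 - theta < s.mass + F.x i
      · rw [if_pos h3]
        exact h₂ h2 h3
      · rw [if_neg h3]
        exact h₃ h2 (not_lt.1 h3)
    · rw [if_pos h2]
      exact h₁ h1 h2
  · rw [if_pos h1]
    exact h₀ h1

/-! ### Bookkeeping of the hard groups. -/

lemma group_le_group_succ (j : ℕ) (i : Fin m) : (st W J j i).group ≤ (st W J (j + 1) i).group := by
  rw [st_succ]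
  apply updateMachine_cases (p := fun s => (st W J j i).group ≤ s.group) <;> simp

lemma group_le_of_grp_eq {k j : ℕ} (hkj : k < j) {i : Fin m} {g : ℕ} (h : grp W J k i = Sum.inr g) :
    g ≤ (st W J j i).group := by
  have hg : g = (st W J k i).group := by
    by_cases hh : IsHard (st W J k i) (J k) (sol W J k) i
    · rw [grp_of_hard hh] at h; injection h with h; exact h.symm
    · rw [grp_of_not_hard hh] at h; cases h
  rw [hg]
  exact monotone_nat_of_le_succ (f := fun j => (st W J j i).group)
    (fun j => group_le_group_succ j i) hkj.le

/-- The total of `f` over the jobs before `j` in the current hard group of machine `i`. -/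
def groupSum (W : FractionalRule m) (J : ℕ → Job m) (f : ℕ → ℝ) (j : ℕ) (i : Fin m) : ℝ :=
  ∑ k ∈ Finset.range j, if grp W J k i = Sum.inr (st W J j i).group then f k else 0

lemma groupSum_succ_of_not_hard (f : ℕ → ℝ) {j : ℕ} {i : Fin m}
    (h : ¬ IsHard (st W J j i) (J j) (sol W J j) i) :
    groupSum W J f (j + 1) i = groupSum W J f j i := by
  have hg : (st W J (j + 1) i).group = (st W J j i).group := by
    rw [st_succ]
    apply updateMachine_cases (p := fun s => s.group = (st W J j i).group) <;> simp_all
  unfold groupSum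
  rw [Finset.sum_range_succ, hg, grp_of_not_hard h]
  simp

/-- Closing a group raises the index above all indices used so far, so no earlier job belongs to the
new group. -/
lemma groupSum_succ_of_full (f : ℕ → ℝ) {j : ℕ} {i : Fin m}
    (h : IsHard (st W J j i) (J j) (sol W J j) i)
    (hfull : 1 - theta < (st W J j i).mass + (sol W J j).x i) :
    groupSum W J f (j + 1) i = 0 := by
  have hg : (st W J (j + 1) i).group = (st W J j i).group + 1 := by
    rw [st_succ]
    apply updateMachine_cases (p := fun s => s.group = (st W J j i).group + 1)
    · exact fun h' => absurd h.1 h'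
    · exact fun _ h' => absurd h h'
    · exact fun _ _ => rfl
    · exact fun _ h' => absurd hfull (not_lt.2 h')
  refine Finset.sum_eq_zero fun k hk => if_neg fun hk' => ?_
  rw [hg] at hk'
  rcases (Nat.lt_succ_iff.1 (Finset.mem_range.1 hk)).eq_or_lt with rfl | hlt
  · rw [grp_of_hard h] at hk'
    injection hk' with hk'
    omega
  · have := group_le_of_grp_eq hlt hk'
    omega

lemma groupSum_succ_of_not_full (f : ℕ → ℝ) {j : ℕ} {i : Fin m}
    (h : IsHard (st W J j i) (J j) (sol W J j) i)
    (hfull : (st W J j i).mass + (sol W J j).x i ≤ 1 - theta) :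
    groupSum W J f (j + 1) i = groupSum W J f j i + f j := by
  have hg : (st W J (j + 1) i).group = (st W J j i).group := by
    rw [st_succ]
    apply updateMachine_cases (p := fun s => s.group = (st W J j i).group)
    · exact fun h' => absurd h.1 h'
    · exact fun _ h' => absurd h h'
    · exact fun _ h' => absurd hfull (not_le.2 h')
    · exact fun _ _ => rfl
  unfold groupSum
  rw [Finset.sum_range_succ, hg, if_pos (grp_of_hard h)]

lemma mass_eq_groupSum (j : ℕ) (i : Fin m) :
    (st W J j i).mass = groupSum W J (fun k => frac W J k i) j i := by
  induction j with
  | zero => simp [st_zero, groupSum, MachineState.init]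
  | succ j ih =>
    rw [st_succ]
    apply updateMachine_cases (p := fun s => s.mass = groupSum W J (fun k => frac W J k i) (j + 1) i)
    · intro h
      rw [groupSum_succ_of_not_hard _ fun h' => h h'.1, ih]
    · intro _ h
      rw [groupSum_succ_of_not_hard _ h, ← ih]
    · intro h h'
      rw [groupSum_succ_of_full _ h h']
    · intro h h'
      rw [groupSum_succ_of_not_full _ h h', ← ih]
      rfl

lemma mass_le (j : ℕ) (i : Fin m) : (st W J j i).mass ≤ 1 - theta := by
  have h0 : (0 : ℝ) ≤ 1 - theta := by norm_num [theta]
  induction j with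
  | zero => exact h0
  | succ j ih =>
    rw [st_succ]
    exact updateMachine_cases (p := fun s => s.mass ≤ 1 - theta) (fun _ => ih) (fun _ _ => ih)
      (fun _ _ => h0) (fun _ h => h)

lemma frac_nonneg (hW : IsWaterFilling W) (j : ℕ) (i : Fin m) : 0 ≤ frac W J j i :=
  (hW.isEquilibrium j).nonneg i

lemma frac_le_one (hW : IsWaterFilling W) (j : ℕ) (i : Fin m) : frac W J j i ≤ 1 := by
  rw [← (hW.isEquilibrium (J := J) j).sum_eq_one]
  exact Finset.single_le_sum (fun e _ => frac_nonneg (J := J) hW j e) (Finset.mem_univ i)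

lemma frac_le_theta {j : ℕ} {i : Fin m} {g : ℕ} (h : grp W J j i = Sum.inr g) :
    frac W J j i ≤ theta := by
  by_cases hh : IsHard (st W J j i) (J j) (sol W J j) i
  · exact hh.2.2
  · rw [grp_of_not_hard hh] at h; cases h

/-- The name of an easy group contains the index of its only job, so distinct jobs can share only a
hard group. -/
lemma exists_inr_of_grp_eq {k j : ℕ} (hkj : k ≠ j) {i : Fin m} (h : grp W J k i = grp W J j i) :
    ∃ g, grp W J k i = Sum.inr g ∧ grp W J j i = Sum.inr g := by
  by_cases hk : IsHard (st W J k i) (J k) (sol W J k) i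
  · exact ⟨_, grp_of_hard hk, h ▸ grp_of_hard hk⟩
  · by_cases hj : IsHard (st W J j i) (J j) (sol W J j) i
    · exact ⟨_, h.trans (grp_of_hard hj), grp_of_hard hj⟩
    · rw [grp_of_not_hard hk, grp_of_not_hard hj] at h
      injection h with h
      exact absurd h hkj

/-- An open hard group has mass at most `1 - θ` and a hard job has fraction at most `θ`, so even the
job that closes the group fits into the unit interval. -/
lemma fitsGroups (hW : IsWaterFilling W) (J : ℕ → Job m) : FitsGroups (frac W J) (grp W J) where
  nonneg := frac_nonneg hW
  sum_eq_one j := (hW.isEquilibrium j).sum_eq_one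
  le_one j e := by
    by_cases h : IsHard (st W J j e) (J j) (sol W J j) e
    · have h1 := mass_le (W := W) (J := J) j e
      rw [mass_eq_groupSum, groupSum] at h1
      simp_rw [grp_of_hard h]
      have h2 : frac W J j e ≤ theta := h.2.2
      linarith
    · rw [Finset.sum_eq_zero, zero_add]
      · exact frac_le_one hW j e
      · intro k hk
        refine if_neg fun hk' => ?_
        obtain ⟨g, _, h2⟩ := exists_inr_of_grp_eq (Finset.mem_range.1 hk).ne hk'
        rw [grp_of_not_hard h] at h2
        cases h2

/-! ## The rounds of the algorithm -/

/-- The tickets of job `j` in round `r`. -/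
def jobTickets (W : FractionalRule m) (J : ℕ → Job m) (n : ℕ) (j r : ℕ) (ω : Seeds m) : Fin m → ℕ :=
  tix (frac W J) (grp W J) (aliveSet n (frac W J) (grp W J) ω r) j r ω

lemma mem_aliveSet_iff {n j : ℕ} (hj : j < n) (ω : Seeds m) (r : ℕ) :
    j ∈ aliveSet n (frac W J) (grp W J) ω r ↔ ∀ r' < r, ∑ e, jobTickets W J n j r' ω e = 0 := by
  induction r with
  | zero => simpa [aliveSet] using hj
  | succ r ih =>
    rw [aliveSet, Finset.mem_filter, ih]
    constructor
    · rintro ⟨h1, h2⟩ r' hr'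
      rcases (Nat.lt_succ_iff.1 hr').eq_or_lt with rfl | h
      · exact h2
      · exact h1 r' h
    · exact fun h => ⟨fun r' hr' => h r' (Nat.lt_succ_of_lt hr'), h r (Nat.lt_succ_self r)⟩

lemma ticketCount_eq_of_remaining {n j : ℕ} {ω : Seeds m} {R : Fin m → GroupName → ℕ → ℝ} (r : ℕ)
    (h : ∀ i G, R i G r = ω (Seed.recommend i G r) - ∑ k ∈ Finset.range j,
      if k ∈ aliveSet n (frac W J) (grp W J) ω r ∧ grp W J k i = G then frac W J k i else 0) :
    ticketCount W ω R j (pre J (j + 1)) r = jobTickets W J n j r ω := by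
  funext i
  have h1 := h i (grp W J j i)
  unfold ticketCount jobTickets tix roundTickets ticket
  change (if R i (grp W J j i) r ∈ Set.Ico 0 (frac W J j i) then _ else 0) = _
  rw [h1]
  rfl

/-- The statement has to be proved for all rounds together: whether job `j` decreases the variable
of round `r` depends on its tickets, and hence on the variables, in all rounds before `r`. -/
lemma remaining_eq {n j : ℕ} (hj : j ≤ n) (ω : Seeds m) (i : Fin m) (G : GroupName) (r : ℕ) :
    remaining W ω j (pre J j) i G r = ω (Seed.recommend i G r) - ∑ k ∈ Finset.range j,
      if k ∈ aliveSet n (frac W J) (grp W J) ω r ∧ grp W J k i = G then frac W J k i else 0 := by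
  induction j generalizing i G r with
  | zero => simp [remaining]
  | succ j ih =>
    have ih' := ih (Nat.le_of_succ_le hj)
    have hT : ∀ r', ticketCount W ω (remaining W ω j (pre J j)) j (pre J (j + 1)) r' =
        jobTickets W J n j r' ω := fun r' =>
      ticketCount_eq_of_remaining r' fun i G => ih' i G r'
    have halive := mem_aliveSet_iff (W := W) (J := J) (Nat.lt_of_succ_le hj) ω r
    have hstep : remaining W ω (j + 1) (pre J (j + 1)) i G r =
        if G = grp W J j i ∧ ∀ r' < r, ∑ e, ticketCount W ω (remaining W ω j (pre J j)) j
          (pre J (j + 1)) r' e = 0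
        then remaining W ω j (pre J j) i G r - frac W J j i
        else remaining W ω j (pre J j) i G r := rfl
    rw [hstep, Finset.sum_range_succ, ih']
    simp_rw [hT]
    by_cases hc : G = grp W J j i ∧ j ∈ aliveSet n (frac W J) (grp W J) ω r
    · rw [if_pos ⟨hc.1, halive.1 hc.2⟩, if_pos ⟨hc.2, hc.1.symm⟩]; ring
    · rw [if_neg fun h => hc ⟨h.1, halive.2 h.2⟩, if_neg fun h => hc ⟨h.2.symm, h.1⟩]; ring

lemma ticketCount_eq {n j : ℕ} (hj : j < n) (ω : Seeds m) (r : ℕ) :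
    ticketCount W ω (remaining W ω j (pre J j)) j (pre J (j + 1)) r = jobTickets W J n j r ω :=
  ticketCount_eq_of_remaining r fun i G => remaining_eq hj.le ω i G r

/-- The machine to which job `j` is assigned. -/
def choice (W : FractionalRule m) (J : ℕ → Job m) (j : ℕ) (ω : Seeds m) : Fin m :=
  roundedChoice W j (pre J (j + 1)) ω

/-- The machine that is used if no ticket is picked. -/
def fallback (J : ℕ → Job m) (j : ℕ) : Fin m := (J j).feasible.min' (J j).feasible_nonempty

lemma choice_of_first {n j : ℕ} (hj : j < n) {ω : Seeds m} {r : ℕ}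
    (h : ∀ r' < r, ∑ e, jobTickets W J n j r' ω e = 0) (hr : 0 < ∑ e, jobTickets W J n j r ω e) :
    choice W J j ω =
      (pickTicket (jobTickets W J n j r ω) (ω (Seed.pick j r))).getD (fallback J j) := by
  classical
  have hN : ticketCount W ω (remaining W ω j fun k => pre J (j + 1) k.castSucc) j (pre J (j + 1)) =
      fun r => jobTickets W J n j r ω := funext fun r => ticketCount_eq hj ω r
  have hex : ∃ r, 0 < ∑ e, jobTickets W J n j r ω e := ⟨r, hr⟩
  have hfind : Nat.find hex = r := by
    rw [Nat.find_eq_iff]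
    exact ⟨hr, fun r' hr' => by simp [h r' hr']⟩
  unfold choice roundedChoice
  simp only [hN]
  rw [dif_pos hex]
  -- The definition of the choice carries its own decidability instance, so the value of `Nat.find`
  -- is transferred to every instance.
  have : ∀ inst : DecidablePred fun r => 0 < ∑ e, jobTickets W J n j r ω e,
      @Nat.find _ inst hex = r := by
    intro inst
    rw [← hfind]
    congr!
  rw [this]
  rfl

lemma choice_of_forall {n j : ℕ} (hj : j < n) {ω : Seeds m}
    (h : ∀ r, ∑ e, jobTickets W J n j r ω e = 0) : choice W J j ω = fallback J j := by
  classical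
  have hN : ticketCount W ω (remaining W ω j fun k => pre J (j + 1) k.castSucc) j (pre J (j + 1)) =
      fun r => jobTickets W J n j r ω := funext fun r => ticketCount_eq hj ω r
  unfold choice roundedChoice
  simp only [hN]
  rw [dif_neg (by push Not; intro r; rw [h r])]
  rfl

lemma choice_mem_feasible (hW : IsWaterFilling W) (j : ℕ) (ω : Seeds m) :
    choice W J j ω ∈ (J j).feasible := by
  classical
  have hfb : fallback J j ∈ (J j).feasible := Finset.min'_mem _ _
  by_cases hex : ∃ r, 0 < ∑ e, jobTickets W J (j + 1) j r ω e
  · rw [choice_of_first (Nat.lt_succ_self j) (r := Nat.find hex)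
      (fun r' hr' => by simpa using Nat.find_min hex hr') (Nat.find_spec hex)]
    rcases hp : pickTicket (jobTickets W J (j + 1) j (Nat.find hex) ω)
      (ω (Seed.pick j (Nat.find hex))) with _ | i
    · exact hfb
    · have hpos := pos_of_pickTicket_eq_some (ω (Seed.pick j (Nat.find hex))).2.1 hp
      by_contra hi
      have hx : frac W J j i = 0 := (hW.isEquilibrium j).eq_zero i hi
      unfold jobTickets tix roundTickets ticket at hpos
      rw [hx] at hpos
      simp at hpos
  · rw [choice_of_forall (Nat.lt_succ_self j) fun r => by
      by_contra hr; exact hex ⟨r, Nat.pos_of_ne_zero hr⟩]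
    exact hfb

end Sequence

/-! ### Measurability, marginals and pair probabilities of the decisions. -/

section Sequence

variable {m : ℕ} {W : FractionalRule m} {J : ℕ → Job m}

lemma measurable_jobTickets (n j r : ℕ) : Measurable (jobTickets W J n j r) :=
  measurable_tix_aliveSet j r

lemma picks_eq_one_iff {i : Fin m} {N : Fin m → ℕ} {u : unitInterval} :
    picks i N u = 1 ↔ pickTicket N u = some i := by
  unfold picks
  by_cases h : pickTicket N u = some i
  · rw [Set.indicator_of_mem (by exact h)]
    simp [h]
  · rw [Set.indicator_of_notMem (by exact h)]
    simp [h]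

lemma measurableSet_pickTicket_jobTickets (n j r : ℕ) (i : Fin m) :
    MeasurableSet {ω | pickTicket (jobTickets W J n j r ω) (ω (Seed.pick j r)) = some i} := by
  have h := (measurable_roundPick (n := n) (x := frac W J) (G := grp W J) i j r)
    (measurableSet_singleton 1)
  convert! h using 1
  ext ω
  exact picks_eq_one_iff.symm

lemma measurable_choice (W : FractionalRule m) (J : ℕ → Job m) (j : ℕ) :
    Measurable (choice W J j) := by
  refine measurable_to_countable' fun i => ?_
  have hz : ∀ r, MeasurableSet {ω : Seeds m | ∑ e, jobTickets W J (j + 1) j r ω e = 0} := fun r =>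
    ((measurable_of_countable fun N : Fin m → ℕ => ∑ e, N e).comp
      (measurable_jobTickets (j + 1) j r)) (measurableSet_singleton 0)
  have hp : ∀ r, MeasurableSet {ω : Seeds m |
      (pickTicket (jobTickets W J (j + 1) j r ω) (ω (Seed.pick j r))).getD (fallback J j) = i} := by
    intro r
    have : {ω : Seeds m |
      (pickTicket (jobTickets W J (j + 1) j r ω) (ω (Seed.pick j r))).getD (fallback J j) = i} =
        {ω | pickTicket (jobTickets W J (j + 1) j r ω) (ω (Seed.pick j r)) = some i} ∪
        ({ω | fallback J j = i} ∩ ⋂ i',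
          {ω | pickTicket (jobTickets W J (j + 1) j r ω) (ω (Seed.pick j r)) = some i'}ᶜ) := by
      ext ω
      simp only [Set.mem_ofPred_eq, Set.mem_union, Set.mem_inter_iff, Set.mem_iInter,
        Set.mem_compl_iff]
      rcases pickTicket (jobTickets W J (j + 1) j r ω) (ω (Seed.pick j r)) with _ | i'
      · simp
      · simp
    rw [this]
    exact (measurableSet_pickTicket_jobTickets _ _ _ _).union ((MeasurableSet.const _).inter
      (MeasurableSet.iInter fun i' => (measurableSet_pickTicket_jobTickets _ _ _ _).compl))
  have hset : choice W J j ⁻¹' {i} =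
      (⋃ r, ((⋂ r' ∈ Set.Iio r, {ω | ∑ e, jobTickets W J (j + 1) j r' ω e = 0}) ∩
        {ω | ∑ e, jobTickets W J (j + 1) j r ω e = 0}ᶜ ∩ {ω |
          (pickTicket (jobTickets W J (j + 1) j r ω) (ω (Seed.pick j r))).getD
            (fallback J j) = i})) ∪
      ((⋂ r, {ω | ∑ e, jobTickets W J (j + 1) j r ω e = 0}) ∩ {ω | fallback J j = i}) := by
    classical
    ext ω
    simp only [Set.mem_preimage, Set.mem_singleton_iff, Set.mem_union, Set.mem_iUnion,
      Set.mem_inter_iff, Set.mem_iInter, Set.mem_Iio, Set.mem_ofPred_eq, Set.mem_compl_iff]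
    constructor
    · intro h
      by_cases hex : ∃ r, 0 < ∑ e, jobTickets W J (j + 1) j r ω e
      · have hf : ∀ r' < Nat.find hex, ∑ e, jobTickets W J (j + 1) j r' ω e = 0 :=
          fun r' hr' => by simpa using Nat.find_min hex hr'
        rw [choice_of_first (Nat.lt_succ_self j) hf (Nat.find_spec hex)] at h
        exact Or.inl ⟨Nat.find hex, ⟨hf, (Nat.find_spec hex).ne'⟩, h⟩
      · have hf : ∀ r, ∑ e, jobTickets W J (j + 1) j r ω e = 0 := fun r => by
          by_contra hr; exact hex ⟨r, Nat.pos_of_ne_zero hr⟩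
        rw [choice_of_forall (Nat.lt_succ_self j) hf] at h
        exact Or.inr ⟨hf, h⟩
    · rintro (⟨r, ⟨h1, h2⟩, h3⟩ | ⟨h1, h2⟩)
      · rwa [choice_of_first (Nat.lt_succ_self j) h1 (Nat.pos_of_ne_zero h2)]
      · rwa [choice_of_forall (Nat.lt_succ_self j) h1]
  rw [hset]
  refine (MeasurableSet.iUnion fun r => ((MeasurableSet.biInter (Set.to_countable _)
    fun r' _ => hz r').inter (hz r).compl).inter (hp r)).union
    ((MeasurableSet.iInter hz).inter (MeasurableSet.const _))

/-- The indicator that job `j` is assigned to machine `i`. -/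
def chosen (W : FractionalRule m) (J : ℕ → Job m) (i : Fin m) (j : ℕ) : Seeds m → ℝ≥0∞ :=
  {ω | choice W J j ω = i}.indicator 1

lemma measurableSet_choice (i : Fin m) (j : ℕ) : MeasurableSet {ω | choice W J j ω = i} :=
  measurable_choice W J j (measurableSet_singleton i)

lemma measurable_chosen (i : Fin m) (j : ℕ) : Measurable (chosen W J i j) :=
  measurable_one.indicator (measurableSet_choice i j)

/-- At most one round contributes to the sum: a pick needs a ticket, and a job with a ticket does
not reach any later round. The fallback can only increase the right side. -/
lemma decided_le_chosen {n j : ℕ} (hj : j < n) (i : Fin m) (r : ℕ) (ω : Seeds m) :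
    decided n (frac W J) (grp W J) i j r ω ≤ chosen W J i j ω := by
  have hterm : ∀ r', alive n (frac W J) (grp W J) j r' ω *
      roundPick n (frac W J) (grp W J) i j r' ω ≠ 0 →
      (∀ r'' < r', ∑ e, jobTickets W J n j r'' ω e = 0) ∧
        0 < ∑ e, jobTickets W J n j r' ω e ∧
        pickTicket (jobTickets W J n j r' ω) (ω (Seed.pick j r')) = some i := by
    intro r' hr'
    have h1 : j ∈ aliveSet n (frac W J) (grp W J) ω r' := by
      by_contra h
      exact hr' (by rw [alive, if_neg h, zero_mul])
    have h2 : pickTicket (jobTickets W J n j r' ω) (ω (Seed.pick j r')) = some i := by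
      by_contra h
      refine hr' ?_
      rw [roundPick, picks, Set.indicator_of_notMem (by exact h), mul_zero]
    refine ⟨(mem_aliveSet_iff hj ω r').1 h1, ?_, h2⟩
    exact (pos_of_pickTicket_eq_some (ω (Seed.pick j r')).2.1 h2).trans_le
      (Finset.single_le_sum (f := jobTickets W J n j r' ω) (fun _ _ => Nat.zero_le _)
        (Finset.mem_univ i))
  by_cases hex : ∃ r' ∈ Finset.range r, alive n (frac W J) (grp W J) j r' ω *
      roundPick n (frac W J) (grp W J) i j r' ω ≠ 0
  · obtain ⟨r', hr', hne⟩ := hex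
    obtain ⟨h1, h2, h3⟩ := hterm r' hne
    have hchoice : choice W J j ω = i := by rw [choice_of_first hj h1 h2, h3]; rfl
    rw [decided, Finset.sum_eq_single_of_mem r' hr', chosen,
      Set.indicator_of_mem (by exact hchoice)]
    · refine mul_le_one' ?_ ?_
      · unfold alive; split_ifs <;> simp
      · exact Set.indicator_le_self' (fun _ _ => zero_le) _
    · intro r'' _ hr''
      by_contra hne'
      obtain ⟨h1', h2', _⟩ := hterm r'' hne'
      rcases lt_or_gt_of_ne hr'' with hlt | hlt
      · have := h1 _ hlt; omega
      · have := h1' _ hlt; omega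
  · push Not at hex
    rw [decided, Finset.sum_eq_zero hex]
    exact zero_le

lemma lintegral_chosen (i : Fin m) (j : ℕ) :
    ∫⁻ ω, chosen W J i j ω ∂seedMeasure m = seedMeasure m {ω | choice W J j ω = i} :=
  lintegral_indicator_one (measurableSet_choice i j)

lemma frac_le_measureReal_choice (hW : IsWaterFilling W) (i : Fin m) (j : ℕ) :
    frac W J j i ≤ (seedMeasure m).real {ω | choice W J j ω = i} := by
  refine (ENNReal.ofReal_le_iff_le_toReal (measure_ne_top _ _)).1 ?_
  rw [← lintegral_chosen]
  exact (le_lintegral_iSup_decided (fitsGroups hW J) (Nat.lt_succ_self j) i).trans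
    (lintegral_mono fun ω => iSup_le fun r => decided_le_chosen (Nat.lt_succ_self j) i r ω)

/-- The rounding respects the fractional assignment. -/
lemma measureReal_choice (hW : IsWaterFilling W) (i : Fin m) (j : ℕ) :
    (seedMeasure m).real {ω | choice W J j ω = i} = frac W J j i := by
  have hsum : ∑ i, (seedMeasure m).real {ω | choice W J j ω = i} = 1 := by
    have h := measureReal_biUnion_finset (μ := seedMeasure m) (s := Finset.univ)
      (f := fun i => {ω | choice W J j ω = i})
      (fun a _ b _ hab => Set.disjoint_left.2 fun ω h1 h2 => hab (h1.symm.trans h2))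
      (fun i _ => measurableSet_choice i j)
    rw [← h]
    have : (⋃ i ∈ Finset.univ, {ω | choice W J j ω = i}) = Set.univ := by
      ext ω; simp
    rw [this, probReal_univ]
  have h1 := (fitsGroups hW J).sum_eq_one j
  -- Lower bounds that sum to one are attained, so the probability of the fallback never has to be
  -- estimated separately.
  have h2 := (Finset.sum_eq_sum_iff_of_le (s := Finset.univ)
    (fun i _ => frac_le_measureReal_choice (J := J) hW i j)).1 (h1.trans hsum.symm)
  exact (h2 i (Finset.mem_univ i)).symm

/-- A pointwise inequality between functions with the same finite integral is an equality almost
everywhere. This transfers the pair bounds from the round process to the actual assignment. -/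
lemma iSup_decided_ae_eq_chosen (hW : IsWaterFilling W) {n j : ℕ} (hj : j < n) (i : Fin m) :
    (fun ω => ⨆ r, decided n (frac W J) (grp W J) i j r ω) =ᵐ[seedMeasure m] chosen W J i j := by
  have hle : ∀ ω, ⨆ r, decided n (frac W J) (grp W J) i j r ω ≤ chosen W J i j ω :=
    fun ω => iSup_le fun r => decided_le_chosen hj i r ω
  have hint : ∫⁻ ω, chosen W J i j ω ∂seedMeasure m = ENNReal.ofReal (frac W J j i) := by
    rw [lintegral_chosen, ← measureReal_choice hW, ofReal_measureReal]
  refine ae_eq_of_ae_le_of_lintegral_le (ae_of_all _ hle) ?_ (measurable_chosen i j).aemeasurable ?_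
  · exact ne_top_of_le_ne_top (hint ▸ ENNReal.ofReal_ne_top) (lintegral_mono hle)
  · rw [hint]
    exact le_lintegral_iSup_decided (fitsGroups hW J) hj i

lemma measure_choice_inter_le (hW : IsWaterFilling W) {k j : ℕ} (hkj : k < j) (i : Fin m)
    {C : ℝ≥0∞} (hC : ∀ r, ∀ A : Finset ℕ, k ∈ A →
      ∫⁻ ω, pairStep i (ENNReal.ofReal (frac W J k i)) (ENNReal.ofReal (frac W J j i)) C
        (tix (frac W J) (grp W J) A k r ω) (tix (frac W J) (grp W J) A j r ω)
        (ω (Seed.pick k r)) (ω (Seed.pick j r)) ∂seedMeasure m ≤ C) :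
    seedMeasure m ({ω | choice W J k ω = i} ∩ {ω | choice W J j ω = i}) ≤ C := by
  have hj : j < j + 1 := Nat.lt_succ_self j
  have hk : k < j + 1 := hkj.trans hj
  rw [← lintegral_indicator_one ((measurableSet_choice i k).inter (measurableSet_choice i j))]
  refine le_trans (lintegral_congr_ae ?_).le
    (lintegral_iSup_decided_mul_le (fitsGroups hW J) hk hj hC)
  filter_upwards [iSup_decided_ae_eq_chosen hW (J := J) hk i,
    iSup_decided_ae_eq_chosen hW (J := J) hj i] with ω h1 h2
  rw [h1, h2, chosen, chosen, Set.inter_indicator_one, Pi.mul_apply]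

/-- Two jobs are never positively correlated. -/
lemma measureReal_choice_inter_le (hW : IsWaterFilling W) {k j : ℕ} (hkj : k < j) (i : Fin m)
    (hi : grp W J k i ≠ grp W J j i) :
    (seedMeasure m).real ({ω | choice W J k ω = i} ∩ {ω | choice W J j ω = i}) ≤
      frac W J k i * frac W J j i :=
  ENNReal.toReal_le_of_le_ofReal
    (mul_nonneg (frac_nonneg hW k i) (frac_nonneg hW j i))
    (measure_choice_inter_le hW hkj i fun r _ hA =>
      lintegral_pairStep_tix_le (fitsGroups hW J) hkj hA i hi r)

/-- Two jobs of the same group are strongly negatively correlated. -/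
lemma measureReal_choice_inter_le_of_grp_eq (hW : IsWaterFilling W) {k j : ℕ} (hkj : k < j)
    (i : Fin m) (hi : grp W J k i = grp W J j i) :
    (seedMeasure m).real ({ω | choice W J k ω = i} ∩ {ω | choice W J j ω = i}) ≤
      groupCorr * (frac W J k i * frac W J j i) := by
  obtain ⟨g, h1, h2⟩ := exists_inr_of_grp_eq hkj.ne hi
  have h0 : 0 ≤ groupCorr := by unfold groupCorr; positivity
  exact ENNReal.toReal_le_of_le_ofReal
    (mul_nonneg h0 (mul_nonneg (frac_nonneg hW k i) (frac_nonneg hW j i)))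
    (measure_choice_inter_le hW hkj i fun r _ hA =>
      lintegral_pairStep_tix_le_of_group_eq (fitsGroups hW J) hkj hA i hi
        (frac_le_theta h1) (frac_le_theta h2) r)

/-! ## The expected cost -/

lemma cost_eq {n : ℕ} (a : ℕ → Fin m) :
    cost (pre J n) (fun j => a j) = ∑ i, ((∑ j ∈ Finset.range n,
      if a j = i then (J j).weight i ^ 2 else 0) +
      2 * ∑ j ∈ Finset.range n, ∑ k ∈ Finset.range j,
        if a k = i ∧ a j = i then (J k).weight i * (J j).weight i else 0) := by
  unfold cost
  refine Finset.sum_congr rfl fun i _ => ?_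
  have hload : load (pre J n) (fun j => a j) i =
      ∑ j ∈ Finset.range n, if a j = i then (J j).weight i else 0 :=
    Fin.sum_univ_eq_sum_range (fun j => if a j = i then (J j).weight i else 0) n
  rw [hload]
  clear hload
  induction n with
  | zero => simp
  | succ n ih =>
    rw [Finset.sum_range_succ, add_sq, ih, Finset.sum_range_succ, Finset.sum_range_succ]
    by_cases h : a n = i
    · simp only [h, if_true, and_true]
      have : ∑ k ∈ Finset.range n, (if a k = i then (J k).weight i * (J n).weight i else 0) =
          (∑ k ∈ Finset.range n, if a k = i then (J k).weight i else 0) * (J n).weight i := by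
        rw [Finset.sum_mul]
        exact Finset.sum_congr rfl fun k _ => by split_ifs <;> simp
      rw [this]
      ring
    · simp [h]

lemma integral_ite_eq {p : Seeds m → Prop} [DecidablePred p] (hp : MeasurableSet {ω | p ω})
    (c : ℝ) : ∫ ω, (if p ω then c else 0) ∂seedMeasure m = (seedMeasure m).real {ω | p ω} * c := by
  have : (fun ω => if p ω then c else 0) = {ω | p ω}.indicator fun _ => c := by
    funext ω; simp [Set.indicator_apply]
  rw [this, integral_indicator hp, setIntegral_const, smul_eq_mul]

lemma expectedCost_eq (W : FractionalRule m) (J : ℕ → Job m) (n : ℕ) :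
    (fullAlgorithm W).expectedCost (pre J n) = ∑ i, ((∑ j ∈ Finset.range n,
      (seedMeasure m).real {ω | choice W J j ω = i} * (J j).weight i ^ 2) +
      2 * ∑ j ∈ Finset.range n, ∑ k ∈ Finset.range j,
        (seedMeasure m).real ({ω | choice W J k ω = i} ∩ {ω | choice W J j ω = i}) *
          ((J k).weight i * (J j).weight i)) := by
  have h1 : (fullAlgorithm W).expectedCost (pre J n) =
      ∫ ω, cost (pre J n) (fun j => choice W J j ω) ∂seedMeasure m := rfl
  have hi1 : ∀ i j (c : ℝ), Integrable (fun ω => if choice W J j ω = i then c else 0)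
      (seedMeasure m) := fun i j c => by
    have := (integrable_const (μ := seedMeasure m) c).indicator
      (measurableSet_choice (W := W) (J := J) i j)
    exact this.congr (ae_of_all _ fun ω => by simp [Set.indicator_apply])
  have hi2 : ∀ i k j (c : ℝ), Integrable
      (fun ω => if choice W J k ω = i ∧ choice W J j ω = i then c else 0) (seedMeasure m) :=
    fun i k j c => by
    have := (integrable_const (μ := seedMeasure m) c).indicator
      ((measurableSet_choice (W := W) (J := J) i k).inter
        (measurableSet_choice (W := W) (J := J) i j))
    exact this.congr (ae_of_all _ fun ω => by simp [Set.indicator_apply])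
  rw [h1, integral_congr_ae (ae_of_all _ fun ω =>
    cost_eq (J := J) (n := n) (fun j => choice W J j ω)), integral_finsetSum]
  · refine Finset.sum_congr rfl fun i _ => ?_
    rw [integral_add, integral_finsetSum _ fun j _ => hi1 i j _, integral_const_mul,
      integral_finsetSum]
    · congr 1
      · exact Finset.sum_congr rfl fun j _ => integral_ite_eq (measurableSet_choice i j) _
      · congr 1
        refine Finset.sum_congr rfl fun j _ => ?_
        rw [integral_finsetSum _ fun k _ => hi2 i k j _]
        exact Finset.sum_congr rfl fun k _ => integral_ite_eq
          (p := fun ω => choice W J k ω = i ∧ choice W J j ω = i) ((measurableSet_choice i k).inter (measurableSet_choice i j)) _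
    · exact fun j _ => integrable_finsetSum _ fun k _ => hi2 i k j _
    · exact integrable_finsetSum _ fun j _ => hi1 i j _
    · exact (integrable_finsetSum _ fun j _ => integrable_finsetSum _ fun k _ =>
        hi2 i k j _).const_mul 2
  · exact fun i _ => (integrable_finsetSum _ fun j _ => hi1 i j _).add
      ((integrable_finsetSum _ fun j _ => integrable_finsetSum _ fun k _ =>
        hi2 i k j _).const_mul 2)

end Sequence

/-! ## Numerical facts -/

lemma beta_gt : 0.63245 < beta := by
  unfold beta
  exact Real.lt_sqrt_of_sq_lt (by norm_num)

lemma beta_lt : beta < 0.63246 := by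
  unfold beta
  rw [Real.sqrt_lt' (by norm_num)]
  norm_num

/-- The factor `0.54` limits how much hard jobs of total mass at most one can inflate the dual
variable. The bound comes from `(1 - t/n)^n ≤ e^{-t}`, with `n = 128` leaving enough precision for
rational arithmetic. -/
lemma exp_neg_rate_gt : 0.54 < Real.exp (-(beta / lowA)) := by
  have h1 : beta / lowA ≤ 0.6125 := by
    rw [div_le_iff₀ (by norm_num [lowA])]
    have := beta_lt
    norm_num [lowA] at *
    linarith
  have h2 := Real.one_sub_div_pow_le_exp_neg (n := 128) (t := 0.6125) (by norm_num)
  calc (0.54 : ℝ) < (1 - 0.6125 / (128 : ℕ)) ^ 128 := by norm_num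
    _ ≤ Real.exp (-0.6125) := h2
    _ ≤ _ := Real.exp_le_exp.2 (by linarith)

lemma groupCorr_lt : groupCorr < 0.5676 := by
  have h2 := Real.one_sub_div_pow_le_exp_neg (n := 32) (t := theta) (by norm_num [theta])
  have h3 : Real.exp theta < 1.05503 := by
    have h4 : (0.947849 : ℝ) < Real.exp (-theta) := by
      refine lt_of_lt_of_le ?_ h2
      norm_num [theta]
    rw [Real.exp_neg] at h4
    have h5 := Real.exp_pos theta
    rw [lt_inv_comm₀ (by norm_num) h5] at h4
    refine h4.trans ?_
    norm_num
  have h6 := Real.exp_one_gt_d9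
  unfold groupCorr
  rw [div_lt_iff₀ (by linarith)]
  linarith

/-- The gain of a full hard group pays for its bonus. -/
lemma bonus_le_gain :
    lam + lam ^ 2 / 2 ≤ gam * (1 - groupCorr) * ((1 - theta) * (1 - 2 * theta)) / highB ^ 2 := by
  have h := groupCorr_lt
  have h1 : gam * (1 - 0.5676) * ((1 - theta) * (1 - 2 * theta)) / highB ^ 2 ≤
      gam * (1 - groupCorr) * ((1 - theta) * (1 - 2 * theta)) / highB ^ 2 := by
    have : (0 : ℝ) ≤ gam := by norm_num [gam]
    have : (0 : ℝ) ≤ (1 - theta) * (1 - 2 * theta) := by norm_num [theta]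
    gcongr
  refine le_trans ?_ h1
  -- This is where `λ` is determined: the two sides differ by less than `10⁻⁵`.
  norm_num [lam, gam, theta, highB]

/-! ## Feasibility of the constraint of a single job -/

lemma rate_bounds {ν w t φ : ℝ} (h : IsRate ν w t φ) : beta ≤ φ ∧ φ ≤ beta + delta := by
  obtain ⟨h1, h2, h3⟩ := h
  have hδ : (0 : ℝ) ≤ delta := by norm_num [delta]
  by_cases hc : ¬ Critical ν w ∨ theta < t
  · rw [h1 hc]
    constructor <;> linarith
  · push Not at hc
    rcases hc.2.lt_or_eq with ht | ht
    · rw [h2 ⟨hc.1, ht⟩]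
      constructor <;> linarith
    · exact h3 ⟨hc.1, ht⟩

/-- The constraint of a job in terms of the ratio `q = ν / w`, if the dual vector is at least
`β + 0.003` times the expected load. -/
lemma scaled_constraint {q x φ K : ℝ} (hq : 0 ≤ q) (hx0 : 0 ≤ x) (hx1 : x ≤ 1)
    (hφ0 : beta ≤ φ) (hφ1 : φ ≤ beta + delta)
    (hrate : (q ∈ Set.Icc lowA highB ∧ x < theta → φ = beta))
    (hK : K ≤ 0.63147) (hcrit : q ∈ Set.Icc lowA highB ∨ q < lowA ∨ highB < q) :
    gam + K * q + (φ * q + φ ^ 2 * x / 2) ≤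
      1 - 1 / 2 * (min q (Real.sqrt 2)) ^ 2 + (q + x * φ) * min q (Real.sqrt 2) := by
  have hb0 := beta_gt
  have hb1 := beta_lt
  have hφl : 0.63245 ≤ φ := by linarith
  have hφu : φ ≤ 0.65848 := by norm_num [delta] at hφ1; norm_num; linarith
  have hs0 : 1.4142 < Real.sqrt 2 := Real.lt_sqrt_of_sq_lt (by norm_num)
  have hs1 : Real.sqrt 2 < 1.4143 := by rw [Real.sqrt_lt' (by norm_num)]; norm_num
  have hss : Real.sqrt 2 ^ 2 = 2 := Real.sq_sqrt (by norm_num)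
  have hKq : K * q ≤ 0.63147 * q := mul_le_mul_of_nonneg_right hK hq
  have hxφ : 0 ≤ x * φ := mul_nonneg hx0 (by linarith)
  have hg : gam < 0.20064 := by norm_num [gam]
  rcases le_total q (Real.sqrt 2) with h | h
  · rw [min_eq_left h]
    suffices 0 ≤ 1 - 0.20064 - (0.63147 + φ) * q + q ^ 2 / 2 + x * (φ * (q - φ / 2)) by nlinarith
    rcases hcrit with hc | hc | hc
    · have hqa : 1.0326 ≤ q := by simpa [lowA] using hc.1
      have hpos : 0 ≤ φ * (q - φ / 2) := mul_nonneg (by linarith) (by linarith)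
      rcases lt_or_ge x theta with hx | hx
      · have hφ := hrate ⟨hc, hx⟩
        have h1 := mul_nonneg hx0 hpos
        have h2 : φ * q ≤ 0.63246 * q := mul_le_mul_of_nonneg_right (by linarith) hq
        -- The vertex of the quadratic in `q` is `0.63147 + 0.63246`. The value there is barely
        -- positive; the rate `β + δ` with no help from `x` would make it negative, which is why
        -- hard jobs exist.
        nlinarith [sq_nonneg (q - 1.26393)]
      · have hx' : 0.0535 ≤ x := by simpa [theta] using hx
        -- From the fraction `θ` on, the term in `x` compensates for the larger rate. After
        -- replacing `x` by `θ` and `φ` by its maximum, the vertex in `q` is `0.63147 + (1 - 0.0535)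
        -- * 0.65848`, about `1.25472`.
        have h1 : 0.0535 * (φ * (q - φ / 2)) ≤ x * (φ * (q - φ / 2)) :=
          mul_le_mul_of_nonneg_right hx' hpos
        have h2 : 0 ≤ (0.65848 - φ) * (q - 0.0535 * q + 0.0535 / 2 * (φ + 0.65848)) :=
          mul_nonneg (by linarith) (by nlinarith)
        nlinarith [sq_nonneg (q - 1.25472)]
    · have hqa : q < 1.0326 := by simpa [lowA] using hc
      have h2 : φ * q ≤ 0.65848 * q := mul_le_mul_of_nonneg_right hφu hq
      have h3 : φ ^ 2 ≤ 0.65848 ^ 2 := pow_le_pow_left₀ (by linarith) hφu 2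
      -- The expression is affine in `x`, so the endpoints `0` and `1` suffice. At `x = 0` the
      -- quadratic decreases up to `1.28995`, and its value at `a` is just above zero; this fixes
      -- `a`.
      have e0 : 0 ≤ 1 - 0.20064 - (0.63147 + φ) * q + q ^ 2 / 2 := by
        nlinarith [mul_nonneg (sub_nonneg.2 hqa.le) (by linarith : (0:ℝ) ≤ 1.28995 - (1.0326 + q) / 2)]
      have e1 : 0 ≤ 1 - 0.20064 - (0.63147 + φ) * q + q ^ 2 / 2 + φ * (q - φ / 2) := by
        nlinarith [sq_nonneg (q - 0.63147)]
      nlinarith [mul_nonneg (sub_nonneg.2 hx1) e0, mul_nonneg hx0 e1]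
    · have : 1.6208 < q := by simpa [highB] using hc
      linarith
  · rw [min_eq_right h, hss]
    have hq' : 1.4142 ≤ q := by linarith
    have h4 : 1.4142 * (q + x * φ) ≤ Real.sqrt 2 * (q + x * φ) :=
      mul_le_mul_of_nonneg_right hs0.le (by linarith)
    suffices 0.20064 + 0.63147 * q + (φ * q + φ ^ 2 * x / 2) ≤ 1.4142 * (q + x * φ) by nlinarith
    have h5 : φ ^ 2 * x ≤ 0.65848 * (x * φ) := by nlinarith
    rcases hcrit with hc | hc | hc
    · rcases lt_or_ge x theta with hx | hx
      · have hφ := hrate ⟨hc, hx⟩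
        have h2 : φ * q ≤ 0.63246 * q := mul_le_mul_of_nonneg_right (by linarith) hq
        nlinarith
      · have hx' : 0.0535 ≤ x := by simpa [theta] using hx
        have h2 : φ * q ≤ 0.65848 * q := mul_le_mul_of_nonneg_right hφu hq
        have h6 : 0.0535 * 0.63245 ≤ x * φ := mul_le_mul hx' hφl (by norm_num) hx0
        nlinarith
    · have : q < 1.0326 := by simpa [lowA] using hc
      linarith
    -- Here the condition reduces to `(1.4142 - 0.63147 - 0.65848) * q ≥ 0.20064`, which holds from
    -- about `q = b` on; this fixes `b`.
    · have hqb : 1.6208 < q := by simpa [highB] using hc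
      have h2 : φ * q ≤ 0.65848 * q := mul_le_mul_of_nonneg_right hφu hq
      nlinarith

/-- Dividing by `w²` leaves only the ratio `q`; the expected load enters through the bound by `ν /
(β + 0.003)`, which gives the coefficient `2 γ / (β + 0.003) ≤ 0.63147`. A zero weight makes both
sides vanish. -/
lemma potential_le {s : MachineState} {w x φ νf : ℝ} (hw : 0 ≤ w) (hν : 0 ≤ s.nu)
    (hℓ : (beta + 0.003) * s.expLoad ≤ s.nu) (hx0 : 0 ≤ x) (hx1 : x ≤ 1)
    (hφ : IsRate s.nu w x φ) (hνf : s.nu + w * x * φ ≤ νf) :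
    potential s w x φ ≤ w ^ 2 - 1 / 2 * (min (s.nu / w) (Real.sqrt 2) * w) ^ 2 +
      νf * (min (s.nu / w) (Real.sqrt 2) * w) := by
  rcases hw.eq_or_lt with rfl | hw
  · simp [potential]
  · obtain ⟨hφ0, hφ1⟩ := rate_bounds hφ
    have hb0 := beta_gt
    set q := s.nu / w with hq
    have hνq : s.nu = q * w := by rw [hq]; field_simp
    have hq0 : 0 ≤ q := div_nonneg hν hw.le
    set μ := beta + 0.003 with hμ
    have hμ0 : 0 < μ := by linarith
    have hcr : q ∈ Set.Icc lowA highB ∨ q < lowA ∨ highB < q := by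
      by_cases h : q ∈ Set.Icc lowA highB
      · exact Or.inl h
      · rw [Set.mem_Icc, not_and_or, not_le, not_le] at h
        exact Or.inr h
    have hK : 2 * gam / μ ≤ 0.63147 := by
      rw [div_le_iff₀ hμ0]
      norm_num [gam]
      linarith
    have h := scaled_constraint hq0 hx0 hx1 hφ0 hφ1 (fun h => hφ.2.1 ⟨h.1, h.2⟩) hK hcr
    set α := min q (Real.sqrt 2) with hα
    have hα0 : 0 ≤ α := le_min hq0 (Real.sqrt_nonneg 2)
    have h1 := mul_le_mul_of_nonneg_right h (sq_nonneg w)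
    have h2 : (s.nu + w * x * φ) * (α * w) ≤ νf * (α * w) :=
      mul_le_mul_of_nonneg_right hνf (by positivity)
    have h3 : gam * (2 * w * s.expLoad) ≤ 2 * gam / μ * q * w ^ 2 := by
      have h4 : s.expLoad ≤ s.nu / μ := by rw [le_div_iff₀ hμ0]; linarith
      have h5 : (0 : ℝ) ≤ gam * (2 * w) := by have : (0:ℝ) ≤ gam := by norm_num [gam]
                                              positivity
      calc gam * (2 * w * s.expLoad) = gam * (2 * w) * s.expLoad := by ring
        _ ≤ gam * (2 * w) * (s.nu / μ) := mul_le_mul_of_nonneg_left h4 h5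
        _ = _ := by rw [hνq]; field_simp
    unfold potential
    rw [hνq] at h2 ⊢
    nlinarith

/-! ## The dual vector dominates the expected loads -/

/-- The value of the dual variable before the current hard group. -/
def MachineState.base (s : MachineState) : ℝ := s.start.getD s.nu

/-- The invariant of a machine: `H` is the total expected load of the current hard group. -/
structure Dominates (s : MachineState) (H : ℝ) : Prop where
  nu_nonneg : 0 ≤ s.nu
  load_nonneg : 0 ≤ s.expLoad
  mass_nonneg : 0 ≤ s.mass
  base_nonneg : 0 ≤ s.base
  hard_nonneg : 0 ≤ H
  exp_le : s.nu * Real.exp (-(beta / lowA) * s.mass) ≤ s.nu - beta * H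
  base_le : s.base ≤ s.nu - beta * H
  surplus : -0.006 * H + (delta - 0.006) / (beta + delta) * (s.nu - s.base - beta * H) ≤
    s.nu - (beta + 0.006) * s.expLoad

lemma Dominates.nu_mul_le {s : MachineState} {H : ℝ} (h : Dominates s H) (hm : s.mass ≤ 1) :
    0.54 * s.nu ≤ s.nu - beta * H := by
  refine le_trans ?_ h.exp_le
  rw [mul_comm]
  refine mul_le_mul_of_nonneg_left (exp_neg_rate_gt.le.trans (Real.exp_le_exp.2 ?_)) h.nu_nonneg
  have : 0 ≤ beta / lowA := div_nonneg (by linarith [beta_gt]) (by norm_num [lowA])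
  nlinarith

/-- While a group is open, the surplus over `β + 0.006` may fall short by `0.006 * H`. Since `β * H
≤ 0.46 * ν`, this shortfall is small enough for the weaker rate `β + 0.003`. -/
lemma Dominates.load_le {s : MachineState} {H : ℝ} (h : Dominates s H) (hm : s.mass ≤ 1) :
    (beta + 0.003) * s.expLoad ≤ s.nu := by
  have h1 := h.nu_mul_le hm
  have h2 := h.surplus
  have hb0 := beta_gt
  have hb1 := beta_lt
  have h3 : 0 ≤ (delta - 0.006) / (beta + delta) * (s.nu - s.base - beta * H) :=
    mul_nonneg (div_nonneg (by norm_num [delta]) (by norm_num [delta]; linarith))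
      (by linarith [h.base_le])
  have h4 : H ≤ 0.7274 * s.nu := by nlinarith [h.hard_nonneg, h.nu_nonneg]
  have h5 : (beta + 0.006) * s.expLoad ≤ 1.0043644 * s.nu := by linarith
  have h6 := h.load_nonneg
  nlinarith [h.nu_nonneg]

lemma dominates_init : Dominates MachineState.init 0 := by
  constructor <;> simp [MachineState.init, MachineState.base]

section Step

variable {s : MachineState} {H w x φ : ℝ}

/-- An easy job adds `(δ - 0.006) * w * x` to the surplus, which is exactly the fraction `(δ -
0.006) / (β + δ)` of the growth of `ν`. The invariant records this, because the bonus depends on the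
old base and shrinks when easy jobs raise `ν` in the meantime. If no group is open, the base simply
moves along with `ν`. -/
lemma Dominates.easy (h : Dominates s H) (hs : s.start = none → H = 0) (hw : 0 ≤ w) (hx : 0 ≤ x) :
    Dominates { s with expLoad := s.expLoad + w * x, nu := s.nu + w * x * (beta + delta) } H := by
  have hb := beta_gt
  have hδ : (0.006 : ℝ) ≤ delta := by norm_num [delta]
  have hwx := mul_nonneg hw hx
  have hd : 0 ≤ w * x * (beta + delta) := mul_nonneg hwx (by linarith)
  obtain ⟨h1, h2, h3, h4, h5, h6, h7, h8⟩ := h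
  have hexp : Real.exp (-(beta / lowA) * s.mass) ≤ 1 := by
    rw [Real.exp_le_one_iff]
    have : 0 ≤ beta / lowA := div_nonneg (by linarith) (by norm_num [lowA])
    nlinarith
  rcases hst : s.start with _ | v
  · have hH := hs hst
    subst hH
    simp only [MachineState.base, hst, Option.getD_none] at *
    refine ⟨by simp; linarith, by simp; linarith, h3, by simp [MachineState.base]; linarith, h5, ?_,
      by simp [MachineState.base], ?_⟩
    · simp only [mul_zero, sub_zero]
      have : 0 ≤ s.nu + w * x * (beta + delta) := by linarith
      nlinarith
    · simp only [MachineState.base, mul_zero, Option.getD_none, sub_self, add_zero] at h8 ⊢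
      nlinarith
  · simp only [MachineState.base, hst, Option.getD_some] at *
    refine ⟨by simp; linarith, by simp; linarith, h3, by simpa [MachineState.base] using h4, h5, ?_,
      by simp [MachineState.base]; linarith, ?_⟩
    · simp only
      nlinarith
    · simp only [MachineState.base, Option.getD_some]
      have hne : beta + delta ≠ 0 := by linarith
      have e : (delta - 0.006) / (beta + delta) * (s.nu + w * x * (beta + delta) - v - beta * H) =
          (delta - 0.006) / (beta + delta) * (s.nu - v - beta * H) + (delta - 0.006) * (w * x) := by
        field_simp
        ring
      rw [e]
      nlinarith

/-- A critical ratio bounds the weight from both sides. -/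
lemma Critical.bounds {ν w : ℝ} (hw : 0 ≤ w) (h : Critical ν w) :
    0 < w ∧ 0 < ν ∧ lowA * w ≤ ν ∧ ν ≤ highB * w := by
  have hw' : 0 < w := by
    refine hw.lt_of_ne fun h0 => ?_
    rw [← h0] at h
    have := h.1
    norm_num [lowA] at this
  have h1 : lowA * w ≤ ν := (le_div_iff₀ hw').1 h.1
  have h2 : 0 < lowA * w := mul_pos (by norm_num [lowA]) hw'
  exact ⟨hw', h2.trans_le h1, h1, (div_le_iff₀ hw').1 h.2⟩

/-- A critical ratio gives `w ≤ ν / a`, so the part `β * w * x` multiplies `ν` by at most `exp (β x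
/ a)`, which the larger mass in the exponent absorbs. The surplus over `β + 0.006` drops by at most
`0.006 * w * x`, and any excess of `φ` over `β` only helps. -/
lemma Dominates.hard (h : Dominates s H) (hw : 0 ≤ w) (hc : Critical s.nu w) (hx : 0 ≤ x)
    (hφ : beta ≤ φ) :
    Dominates
      { expLoad := s.expLoad + w * x
        nu := s.nu + w * x * φ
        group := s.group
        mass := s.mass + x
        start := some s.base } (H + w * x) := by
  have hb := beta_gt
  have hδ : (0.006 : ℝ) ≤ delta := by norm_num [delta]
  obtain ⟨-, -, hwν, -⟩ := hc.bounds hw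
  have hwx := mul_nonneg hw hx
  have hd : 0 ≤ w * x * φ := mul_nonneg hwx (by linarith)
  have hd' : 0 ≤ w * x * (φ - beta) := mul_nonneg hwx (by linarith)
  obtain ⟨h1, h2, h3, h4, h5, h6, h7, h8⟩ := h
  have hk : 0 ≤ beta / lowA := div_nonneg (by linarith) (by norm_num [lowA])
  refine ⟨by simp; linarith, by simp; linarith, by simp; linarith,
    by simpa [MachineState.base] using h4, by linarith, ?_, ?_, ?_⟩
  · simp only
    have e1 : s.nu + w * x * beta ≤ s.nu * Real.exp (beta / lowA * x) := by
      have e2 : w * x * beta ≤ s.nu * (beta / lowA * x) := by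
        have ha : (0 : ℝ) < lowA := by norm_num [lowA]
        have : w ≤ s.nu / lowA := by rw [le_div_iff₀ ha]; linarith
        calc w * x * beta = w * (x * beta) := by ring
          _ ≤ s.nu / lowA * (x * beta) :=
            mul_le_mul_of_nonneg_right this (mul_nonneg hx (by linarith))
          _ = _ := by ring
      nlinarith [Real.add_one_le_exp (beta / lowA * x)]
    have e3 : Real.exp (-(beta / lowA) * (s.mass + x)) =
        Real.exp (-(beta / lowA) * s.mass) * Real.exp (-(beta / lowA * x)) := by
      rw [← Real.exp_add]; congr 1; ring
    have e4 : Real.exp (beta / lowA * x) * Real.exp (-(beta / lowA * x)) = 1 := by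
      rw [← Real.exp_add]; simp
    have e5 : Real.exp (-(beta / lowA) * (s.mass + x)) ≤ 1 := by
      rw [Real.exp_le_one_iff]; nlinarith
    have e6 : (s.nu + w * x * beta) * Real.exp (-(beta / lowA) * (s.mass + x)) ≤
        s.nu * Real.exp (-(beta / lowA) * s.mass) := by
      calc _ ≤ s.nu * Real.exp (beta / lowA * x) * Real.exp (-(beta / lowA) * (s.mass + x)) :=
            mul_le_mul_of_nonneg_right e1 (Real.exp_pos _).le
        _ = s.nu * Real.exp (-(beta / lowA) * s.mass) *
            (Real.exp (beta / lowA * x) * Real.exp (-(beta / lowA * x))) := by rw [e3]; ring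
        _ = _ := by rw [e4, mul_one]
    have e7 := mul_le_mul_of_nonneg_left e5 hd'
    nlinarith
  · simp only [MachineState.base, Option.getD_some] at *
    nlinarith
  · simp only [MachineState.base, Option.getD_some] at *
    have hρ0 : (delta - 0.006) / (beta + delta) ≤ 1 := by
      rw [div_le_one (by linarith)]; linarith
    have := mul_le_mul_of_nonneg_right hρ0 hd'
    nlinarith

/-- The bonus restores the invariant when a group is closed. -/
lemma Dominates.full (h : Dominates s H) (hν : 0 < s.nu) (hm : s.mass ≤ 1) (g : ℕ) :
    Dominates
      { expLoad := s.expLoad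
        nu := s.nu + lam * s.base ^ 2 / s.nu
        group := g
        mass := 0
        start := none } 0 := by
  have hb0 := beta_gt
  have hb1 := beta_lt
  have h9 := h.nu_mul_le hm
  obtain ⟨h1, h2, h3, h4, h5, h6, h7, h8⟩ := h
  have hbonus : 0 ≤ lam * s.base ^ 2 / s.nu :=
    div_nonneg (mul_nonneg (by norm_num [lam]) (sq_nonneg _)) h1
  have hpos : 0 ≤ s.nu + lam * s.base ^ 2 / s.nu := by linarith
  refine ⟨hpos, h2, le_rfl, hpos, le_rfl, by simp, by simp [MachineState.base], ?_⟩
  simp only [MachineState.base, mul_zero, Option.getD_none, sub_self, add_zero] at *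
  set Z := s.nu - beta * H with hZ
  set u := s.start.getD s.nu with hu
  have hρ : 0.0304 ≤ (delta - 0.006) / (beta + delta) := by
    rw [le_div_iff₀ (by norm_num [delta]; linarith)]
    norm_num [delta]
    linarith
  -- From `ν ≤ Z / 0.54`, the quotient `H / Z` is at most `(1 / 0.54 - 1) / β`.
  have hH : H ≤ 1.347 * Z := by nlinarith
  -- The inequality `u² ≥ Z (2u - Z)` linearises the bonus, so the final comparison is linear in `u`
  -- and `Z`.
  have hbon : 0.54 * lam * (2 * u - Z) ≤ lam * u ^ 2 / s.nu := by
    rw [le_div_iff₀ hν]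
    have hlam : (0 : ℝ) ≤ lam := by norm_num [lam]
    rcases le_or_gt (2 * u - Z) 0 with hn | hp
    · have : 0.54 * lam * (2 * u - Z) * s.nu ≤ 0 :=
        mul_nonpos_of_nonpos_of_nonneg (mul_nonpos_of_nonneg_of_nonpos (by linarith) hn) h1
      have := mul_nonneg hlam (sq_nonneg u)
      linarith
    · calc 0.54 * lam * (2 * u - Z) * s.nu = lam * (2 * u - Z) * (0.54 * s.nu) := by ring
        _ ≤ lam * (2 * u - Z) * Z := mul_le_mul_of_nonneg_left h9 (mul_nonneg hlam hp.le)
        _ ≤ lam * u ^ 2 := by nlinarith [mul_nonneg hlam (sq_nonneg (u - Z))]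
  have e1 : s.nu - u - beta * H = Z - u := by rw [hZ]; ring
  rw [e1] at h8
  have e2 : 0.0304 * (Z - u) ≤ (delta - 0.006) / (beta + delta) * (Z - u) :=
    mul_le_mul_of_nonneg_right hρ (by linarith)
  norm_num [lam] at hbon ⊢
  linarith

end Step

section Update

variable {m : ℕ} {s : MachineState} {job : Job m} {F : Fractional m} {i : Fin m}

lemma IsHard.bounds (h : IsHard s job F i) : 0 < job.weight i ∧ 0 < s.nu ∧
    lowA * job.weight i ≤ s.nu ∧ s.nu ≤ highB * job.weight i :=
  h.2.1.bounds (job.weight_nonneg i h.1)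

lemma IsRate.eq_of_not_hard (hr : IsRate s.nu (job.weight i) (F.x i) (F.phi i))
    (hi : i ∈ job.feasible) (h : ¬ IsHard s job F i) : F.phi i = beta + delta := by
  refine hr.1 ?_
  by_contra hc
  push Not at hc
  exact h ⟨hi, hc⟩

lemma Dominates.update {H : ℝ} (h : Dominates s H) (hs : s.start = none → H = 0)
    (hm : s.mass ≤ 1 - theta) (hx : 0 ≤ F.x i)
    (hr : i ∈ job.feasible → IsRate s.nu (job.weight i) (F.x i) (F.phi i)) :
    ∃ H', Dominates (updateMachine s job F i) H' ∧
      ((updateMachine s job F i).start = none → H' = 0) := by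
  apply updateMachine_cases (p := fun s => ∃ H', Dominates s H' ∧ (s.start = none → H' = 0))
  · exact fun _ => ⟨H, h, hs⟩
  · intro hi hh
    refine ⟨H, ?_, hs⟩
    have := h.easy hs (job.weight_nonneg i hi) hx
    rwa [← (hr hi).eq_of_not_hard hi hh] at this
  · intro hh hfull
    refine ⟨0, ?_, fun _ => rfl⟩
    obtain ⟨hφ, -⟩ := rate_bounds (hr hh.1)
    -- Closing is done in two stages: the job first joins its group, then the bonus is added and the
    -- group emptied.
    have h1 := h.hard (job.weight_nonneg i hh.1) hh.2.1 hx hφ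
    refine h1.full ?_ ?_ (s.group + 1)
    · have := mul_nonneg (mul_nonneg (job.weight_nonneg i hh.1) hx)
        (by linarith [beta_gt] : 0 ≤ F.phi i)
      have := hh.bounds.2.1
      simp only
      linarith
    · have := hh.2.2
      simp only
      linarith
  · intro hh hfull
    obtain ⟨hφ, -⟩ := rate_bounds (hr hh.1)
    exact ⟨_, h.hard (job.weight_nonneg i hh.1) hh.2.1 hx hφ, fun h' => by simp at h'⟩

/-- The dual variables do not decrease. -/
lemma nuHat_le_update (hν : 0 ≤ s.nu) (hx : 0 ≤ F.x i) (hφ : i ∈ job.feasible → beta ≤ F.phi i)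
    (hx0 : i ∉ job.feasible → F.x i = 0) :
    s.nu ≤ nuHat s job F i ∧ nuHat s job F i ≤ (updateMachine s job F i).nu := by
  have h0 : s.nu ≤ nuHat s job F i := by
    unfold nuHat
    by_cases hi : i ∈ job.feasible
    · have := mul_nonneg (mul_nonneg (job.weight_nonneg i hi) hx)
        (by linarith [beta_gt, hφ hi] : 0 ≤ F.phi i)
      linarith
    · rw [hx0 hi]; simp
  refine ⟨h0, ?_⟩
  apply updateMachine_cases (p := fun s' => nuHat s job F i ≤ s'.nu)
  · intro hi
    rw [nuHat, hx0 hi]; simp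
  · exact fun _ _ => le_rfl
  · intro _ _
    have : 0 ≤ lam * (s.start.getD s.nu) ^ 2 / nuHat s job F i :=
      div_nonneg (mul_nonneg (by norm_num [lam]) (sq_nonneg _)) (hν.trans h0)
    simp only
    linarith
  · exact fun _ _ => le_rfl

end Update

section Sequence

variable {m : ℕ} {W : FractionalRule m} {J : ℕ → Job m}

lemma exists_dominates (hW : IsWaterFilling W) (j : ℕ) (i : Fin m) :
    ∃ H, Dominates (st W J j i) H ∧ ((st W J j i).start = none → H = 0) := by
  induction j with
  | zero => exact ⟨0, dominates_init, fun _ => rfl⟩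
  | succ j ih =>
    obtain ⟨H, h, hs⟩ := ih
    rw [st_succ]
    exact h.update hs (mass_le j i) (frac_nonneg hW j i) ((hW.isEquilibrium j).rate i)

lemma nu_nonneg (hW : IsWaterFilling W) (j : ℕ) (i : Fin m) : 0 ≤ (st W J j i).nu := by
  obtain ⟨H, h, -⟩ := exists_dominates (J := J) hW j i
  exact h.nu_nonneg

lemma base_nonneg (hW : IsWaterFilling W) (j : ℕ) (i : Fin m) : 0 ≤ (st W J j i).base := by
  obtain ⟨H, h, -⟩ := exists_dominates (J := J) hW j i
  exact h.base_nonneg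

lemma base_le_nu (hW : IsWaterFilling W) (j : ℕ) (i : Fin m) :
    (st W J j i).base ≤ (st W J j i).nu := by
  obtain ⟨H, h, -⟩ := exists_dominates (J := J) hW j i
  have := mul_nonneg (by linarith [beta_gt] : 0 ≤ beta) h.hard_nonneg
  linarith [h.base_le]

lemma mass_nonneg (hW : IsWaterFilling W) (j : ℕ) (i : Fin m) : 0 ≤ (st W J j i).mass := by
  obtain ⟨H, h, -⟩ := exists_dominates (J := J) hW j i
  exact h.mass_nonneg

lemma load_le_nu (hW : IsWaterFilling W) (j : ℕ) (i : Fin m) :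
    (beta + 0.003) * (st W J j i).expLoad ≤ (st W J j i).nu := by
  obtain ⟨H, h, -⟩ := exists_dominates (J := J) hW j i
  refine h.load_le ((mass_le j i).trans ?_)
  norm_num [theta]

lemma nuHat_bounds (hW : IsWaterFilling W) (j : ℕ) (i : Fin m) :
    (st W J j i).nu ≤ nuHat (st W J j i) (J j) (sol W J j) i ∧
      nuHat (st W J j i) (J j) (sol W J j) i ≤ (st W J (j + 1) i).nu :=
  nuHat_le_update (nu_nonneg hW j i) (frac_nonneg hW j i)
    (fun hi => (rate_bounds ((hW.isEquilibrium j).rate i hi)).1) ((hW.isEquilibrium j).eq_zero i)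

lemma nuHat_le_nu (hW : IsWaterFilling W) {j n : ℕ} (hj : j < n) (i : Fin m) :
    nuHat (st W J j i) (J j) (sol W J j) i ≤ (st W J n i).nu :=
  (nuHat_bounds hW j i).2.trans (monotone_nat_of_le_succ (f := fun j => (st W J j i).nu)
    (fun j => (nuHat_bounds hW j i).1.trans (nuHat_bounds hW j i).2) hj)

lemma expLoad_eq (hW : IsWaterFilling W) (j : ℕ) (i : Fin m) :
    (st W J j i).expLoad = ∑ k ∈ Finset.range j, (J k).weight i * frac W J k i := by
  induction j with
  | zero => rfl
  | succ j ih =>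
    rw [Finset.sum_range_succ, ← ih, st_succ]
    apply updateMachine_cases (p := fun s => s.expLoad =
      (st W J j i).expLoad + (J j).weight i * frac W J j i)
    · intro hi
      rw [frac, (hW.isEquilibrium j).eq_zero i hi]; simp
    · exact fun _ _ => rfl
    · exact fun _ _ => rfl
    · exact fun _ _ => rfl

end Sequence

/-! ## The negative correlation within groups pays for the bonuses -/

section Sequence

variable {m : ℕ} {W : FractionalRule m} {J : ℕ → Job m}

/-- The expected contribution of job `j` to the load of machine `i`. -/
def loadIncrement (W : FractionalRule m) (J : ℕ → Job m) (j : ℕ) (i : Fin m) : ℝ :=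
  (J j).weight i * frac W J j i

/-- The product of the load increments of the pairs that job `j` forms with the earlier jobs of its
group. -/
def pairIncrement (W : FractionalRule m) (J : ℕ → Job m) (j : ℕ) (i : Fin m) : ℝ :=
  ∑ k ∈ Finset.range j, if grp W J k i = grp W J j i
    then loadIncrement W J k i * loadIncrement W J j i else 0

lemma loadIncrement_nonneg (hW : IsWaterFilling W) (j : ℕ) (i : Fin m) :
    0 ≤ loadIncrement W J j i := by
  unfold loadIncrement
  by_cases hi : i ∈ (J j).feasible
  · exact mul_nonneg ((J j).weight_nonneg i hi) (frac_nonneg hW j i)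
  · rw [frac, (hW.isEquilibrium j).eq_zero i hi, mul_zero]

lemma pairIncrement_nonneg (hW : IsWaterFilling W) (j : ℕ) (i : Fin m) :
    0 ≤ pairIncrement W J j i := by
  refine Finset.sum_nonneg fun k _ => ?_
  split_ifs
  · exact mul_nonneg (loadIncrement_nonneg hW k i) (loadIncrement_nonneg hW j i)
  · exact le_rfl

lemma pairIncrement_of_not_hard {j : ℕ} {i : Fin m}
    (h : ¬ IsHard (st W J j i) (J j) (sol W J j) i) : pairIncrement W J j i = 0 := by
  refine Finset.sum_eq_zero fun k hk => if_neg fun hk' => ?_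
  obtain ⟨g, _, h2⟩ := exists_inr_of_grp_eq (Finset.mem_range.1 hk).ne hk'
  rw [grp_of_not_hard h] at h2
  cases h2

lemma pairIncrement_of_hard {j : ℕ} {i : Fin m}
    (h : IsHard (st W J j i) (J j) (sol W J j) i) : pairIncrement W J j i =
      groupSum W J (fun k => loadIncrement W J k i) j i * loadIncrement W J j i := by
  unfold pairIncrement groupSum
  rw [grp_of_hard h, Finset.sum_mul]
  refine Finset.sum_congr rfl fun k _ => ?_
  rw [ite_mul, zero_mul]

lemma mass_eq_zero_of_start {j : ℕ} {i : Fin m} (h : (st W J j i).start = none) :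
    (st W J j i).mass = 0 := by
  induction j with
  | zero => rfl
  | succ j ih =>
    rw [st_succ] at h ⊢
    revert h
    exact updateMachine_cases (p := fun s => s.start = none → s.mass = 0) (fun _ => ih)
      (fun _ _ => ih) (fun _ _ _ => rfl) (fun _ _ h => by simp at h)

lemma groupSum_nonneg {f : ℕ → ℝ} (hf : ∀ k, 0 ≤ f k) (j : ℕ) (i : Fin m) :
    0 ≤ groupSum W J f j i := by
  refine Finset.sum_nonneg fun k _ => ?_
  split_ifs
  · exact hf k
  · exact le_rfl

/-- Lower bounds for the current hard group, in terms of its mass and of the dual variable at its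
start, after a hard job. -/
lemma group_bounds_step (hW : IsWaterFilling W) {j : ℕ} {i : Fin m}
    (h : IsHard (st W J j i) (J j) (sol W J j) i)
    (hU : (st W J j i).base / highB * (st W J j i).mass ≤
      groupSum W J (fun k => loadIncrement W J k i) j i)
    (hT : 1 / 2 * ((st W J j i).base / highB) ^ 2 *
        ((st W J j i).mass ^ 2 - theta * (st W J j i).mass) ≤
      groupSum W J (fun k => pairIncrement W J k i) j i) :
    (st W J j i).base / highB * ((st W J j i).mass + frac W J j i) ≤
      groupSum W J (fun k => loadIncrement W J k i) j i + loadIncrement W J j i ∧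
    1 / 2 * ((st W J j i).base / highB) ^ 2 * (((st W J j i).mass + frac W J j i) ^ 2 -
        theta * ((st W J j i).mass + frac W J j i)) ≤
      groupSum W J (fun k => pairIncrement W J k i) j i + pairIncrement W J j i := by
  have hx := frac_nonneg (J := J) hW j i
  have hx' : frac W J j i ≤ theta := h.2.2
  have hm := mass_nonneg (J := J) hW j i
  have hb := base_nonneg (J := J) hW j i
  have hB : (0 : ℝ) < highB := by norm_num [highB]
  rw [pairIncrement_of_hard h]
  have hw : (st W J j i).base / highB ≤ (J j).weight i := by
    rw [div_le_iff₀ hB, mul_comm]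
    exact (base_le_nu hW j i).trans h.bounds.2.2.2
  set c := (st W J j i).base / highB with hc
  have hc0 : 0 ≤ c := div_nonneg hb hB.le
  have hd : c * frac W J j i ≤ loadIncrement W J j i := mul_le_mul_of_nonneg_right hw hx
  have hd0 : 0 ≤ c * frac W J j i := mul_nonneg hc0 hx
  refine ⟨by linarith, ?_⟩
  have h1 : c * (st W J j i).mass * (c * frac W J j i) ≤
      groupSum W J (fun k => loadIncrement W J k i) j i * loadIncrement W J j i :=
    mul_le_mul hU hd hd0 ((mul_nonneg hc0 hm).trans hU)
  -- The sum over pairs misses the diagonal terms `x²` of the squared mass. As every fraction is at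
  -- most `θ`, they are covered by the correction `θ * mass`.
  have h2 : 0 ≤ c ^ 2 * (frac W J j i * (theta - frac W J j i)) :=
    mul_nonneg (sq_nonneg c) (mul_nonneg hx (by linarith))
  nlinarith

lemma group_bounds (hW : IsWaterFilling W) (j : ℕ) (i : Fin m) :
    (st W J j i).base / highB * (st W J j i).mass ≤
      groupSum W J (fun k => loadIncrement W J k i) j i ∧
    1 / 2 * ((st W J j i).base / highB) ^ 2 *
        ((st W J j i).mass ^ 2 - theta * (st W J j i).mass) ≤
      groupSum W J (fun k => pairIncrement W J k i) j i := by
  induction j with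
  | zero => simp [st_zero, groupSum, MachineState.init]
  | succ j ih =>
    -- An easy job can move the base only while the group is empty; then the mass is zero and the
    -- left sides vanish.
    have hnot (hh : ¬ IsHard (st W J j i) (J j) (sol W J j) i) (s : MachineState)
        (hm : s.mass = (st W J j i).mass)
        (hb : (st W J j i).start ≠ none → s.base = (st W J j i).base) :
        s.base / highB * s.mass ≤ groupSum W J (fun k => loadIncrement W J k i) (j + 1) i ∧
        1 / 2 * (s.base / highB) ^ 2 * (s.mass ^ 2 - theta * s.mass) ≤
          groupSum W J (fun k => pairIncrement W J k i) (j + 1) i := by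
      rw [groupSum_succ_of_not_hard _ hh, groupSum_succ_of_not_hard _ hh, hm]
      by_cases hs : (st W J j i).start = none
      · rw [mass_eq_zero_of_start hs]
        simpa using And.intro (groupSum_nonneg (fun k => loadIncrement_nonneg hW k i) j i)
          (groupSum_nonneg (fun k => pairIncrement_nonneg hW k i) j i)
      · rw [hb hs]
        exact ih
    rw [st_succ]
    apply updateMachine_cases (p := fun s : MachineState =>
      s.base / highB * s.mass ≤ groupSum W J (fun k => loadIncrement W J k i) (j + 1) i ∧
      1 / 2 * (s.base / highB) ^ 2 * (s.mass ^ 2 - theta * s.mass) ≤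
        groupSum W J (fun k => pairIncrement W J k i) (j + 1) i)
    · exact fun hi => hnot (fun h => hi h.1) _ rfl fun _ => rfl
    · intro _ hh
      refine hnot hh _ rfl fun hs => ?_
      obtain ⟨v, hv⟩ := Option.ne_none_iff_exists'.1 hs
      simp [MachineState.base, hv]
    · intro hh hfull
      rw [groupSum_succ_of_full _ hh hfull, groupSum_succ_of_full _ hh hfull]
      simp
    · intro hh hfull
      rw [groupSum_succ_of_not_full _ hh hfull, groupSum_succ_of_not_full _ hh hfull]
      exact group_bounds_step hW hh ih.1 ih.2

/-- The bonus of a full group is paid for by the pairs in the group. -/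
lemma half_sq_bonus_le {ν u T g : ℝ} (hν : 0 < ν) (hu : 0 ≤ u) (huν : u ≤ ν) (hg : 1 - theta < g)
    (hT : 1 / 2 * (u / highB) ^ 2 * (g ^ 2 - theta * g) ≤ T) :
    1 / 2 * (ν + lam * u ^ 2 / ν) ^ 2 ≤ 1 / 2 * ν ^ 2 + 2 * gam * (1 - groupCorr) * T := by
  have h1 : 1 / 2 * (ν + lam * u ^ 2 / ν) ^ 2 =
      1 / 2 * ν ^ 2 + lam * u ^ 2 + lam ^ 2 / 2 * (u ^ 2 * (u / ν) ^ 2) := by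
    field_simp
    ring
  have h2 : u ^ 2 * (u / ν) ^ 2 ≤ u ^ 2 * 1 := by
    refine mul_le_mul_of_nonneg_left (pow_le_one₀ (div_nonneg hu hν.le) ?_) (sq_nonneg u)
    rwa [div_le_one hν]
  -- In the factorisation `g * (g - θ)` each factor is bounded below by means of `g > 1 - θ`.
  have h3 : (1 - theta) * (1 - 2 * theta) ≤ g ^ 2 - theta * g := by
    norm_num [theta] at *
    nlinarith
  have hK : 0 ≤ 2 * gam * (1 - groupCorr) :=
    mul_nonneg (by norm_num [gam]) (by linarith [groupCorr_lt])
  have h4 : 1 / 2 * (u / highB) ^ 2 * ((1 - theta) * (1 - 2 * theta)) ≤ T :=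
    (mul_le_mul_of_nonneg_left h3 (by positivity)).trans hT
  have h5 := mul_le_mul_of_nonneg_left h4 hK
  have h6 := mul_le_mul_of_nonneg_right bonus_le_gain (sq_nonneg u)
  have h7 : 2 * gam * (1 - groupCorr) *
      (1 / 2 * (u / highB) ^ 2 * ((1 - theta) * (1 - 2 * theta))) =
      gam * (1 - groupCorr) * ((1 - theta) * (1 - 2 * theta)) / highB ^ 2 * u ^ 2 := by
    ring
  have h8 := mul_le_mul_of_nonneg_left h2 (by positivity : (0 : ℝ) ≤ lam ^ 2 / 2)
  rw [h1]
  linarith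

/-- Only pairs in closed groups are spent. The pairs of the open group are held back by the
subtracted `groupSum`, and are released when it closes and its bonus has to be paid. -/
lemma half_sq_nu_le_aux (hW : IsWaterFilling W) (n : ℕ) (i : Fin m) :
    1 / 2 * (st W J n i).nu ^ 2 ≤
      ∑ j ∈ Finset.range n, 1 / 2 * (nuHat (st W J j i) (J j) (sol W J j) i ^ 2 -
        (st W J j i).nu ^ 2) + 2 * gam * (1 - groupCorr) *
      (∑ j ∈ Finset.range n, pairIncrement W J j i -
        groupSum W J (fun k => pairIncrement W J k i) n i) := by
  induction n with
  | zero => simp [st_zero, groupSum, MachineState.init]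
  | succ j ih =>
    rw [Finset.sum_range_succ, Finset.sum_range_succ]
    have hnot (hh : ¬ IsHard (st W J j i) (J j) (sol W J j) i) :
        1 / 2 * nuHat (st W J j i) (J j) (sol W J j) i ^ 2 ≤
        ∑ j ∈ Finset.range j, 1 / 2 * (nuHat (st W J j i) (J j) (sol W J j) i ^ 2 -
          (st W J j i).nu ^ 2) + 1 / 2 * (nuHat (st W J j i) (J j) (sol W J j) i ^ 2 -
          (st W J j i).nu ^ 2) + 2 * gam * (1 - groupCorr) *
        (∑ j ∈ Finset.range j, pairIncrement W J j i + pairIncrement W J j i -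
          groupSum W J (fun k => pairIncrement W J k i) (j + 1) i) := by
      rw [groupSum_succ_of_not_hard _ hh, pairIncrement_of_not_hard hh, add_zero]
      linarith
    rw [st_succ]
    apply updateMachine_cases (p := fun s : MachineState => 1 / 2 * s.nu ^ 2 ≤
      ∑ j ∈ Finset.range j, 1 / 2 * (nuHat (st W J j i) (J j) (sol W J j) i ^ 2 -
          (st W J j i).nu ^ 2) + 1 / 2 * (nuHat (st W J j i) (J j) (sol W J j) i ^ 2 -
          (st W J j i).nu ^ 2) + 2 * gam * (1 - groupCorr) *
        (∑ j ∈ Finset.range j, pairIncrement W J j i + pairIncrement W J j i -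
          groupSum W J (fun k => pairIncrement W J k i) (j + 1) i))
    · intro hi
      have := hnot fun h => hi h.1
      have e : nuHat (st W J j i) (J j) (sol W J j) i = (st W J j i).nu := by
        rw [nuHat, (hW.isEquilibrium j).eq_zero i hi]; simp
      rwa [e] at this ⊢
    · exact fun _ hh => hnot hh
    · intro hh hfull
      have hb := group_bounds (J := J) hW j i
      have hν := nuHat_bounds (J := J) hW j i
      have h1 := half_sq_bonus_le (hh.bounds.2.1.trans_le hν.1) (base_nonneg hW j i)
        ((base_le_nu hW j i).trans hν.1) hfull (group_bounds_step hW hh hb.1 hb.2).2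
      rw [groupSum_succ_of_full _ hh hfull]
      unfold MachineState.base at h1
      linarith
    · intro hh hfull
      rw [groupSum_succ_of_not_full _ hh hfull]
      linarith

lemma half_sq_nu_le (hW : IsWaterFilling W) (n : ℕ) (i : Fin m) :
    1 / 2 * (st W J n i).nu ^ 2 ≤
      ∑ j ∈ Finset.range n, 1 / 2 * (nuHat (st W J j i) (J j) (sol W J j) i ^ 2 -
        (st W J j i).nu ^ 2) + 2 * gam * (1 - groupCorr) *
      ∑ j ∈ Finset.range n, pairIncrement W J j i := by
  have hK : 0 ≤ 2 * gam * (1 - groupCorr) :=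
    mul_nonneg (by norm_num [gam]) (by linarith [groupCorr_lt])
  have h1 := mul_nonneg hK
    (groupSum_nonneg (W := W) (J := J) (fun k => pairIncrement_nonneg (J := J) hW k i) n i)
  have h2 := half_sq_nu_le_aux (J := J) hW n i
  linarith

/-! ## The objective of the dual solution -/

/-- The dual variable of job `j`. -/
def dualY (W : FractionalRule m) (J : ℕ → Job m) (j : ℕ) : ℝ :=
  ∑ e ∈ (J j).feasible, frac W J j e *
    potential (st W J j e) ((J j).weight e) (frac W J j e) ((sol W J j).phi e)

/-- Multiplication by `x` completes the square: the second part of the potential becomes the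
increase of `ν² / 2` before the bonus. -/
lemma dualY_eq (hW : IsWaterFilling W) (j : ℕ) : dualY W J j =
    ∑ i, (gam * ((J j).weight i ^ 2 * frac W J j i +
        2 * ((st W J j i).expLoad * loadIncrement W J j i)) +
      1 / 2 * (nuHat (st W J j i) (J j) (sol W J j) i ^ 2 - (st W J j i).nu ^ 2)) := by
  unfold dualY
  rw [Finset.sum_subset (Finset.subset_univ (J j).feasible)]
  · refine Finset.sum_congr rfl fun i _ => ?_
    unfold potential nuHat loadIncrement frac
    ring
  · intro i _ hi
    rw [frac, (hW.isEquilibrium j).eq_zero i hi, zero_mul]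

lemma pair_le (hW : IsWaterFilling W) {k j : ℕ} (hkj : k < j) (i : Fin m) :
    (seedMeasure m).real ({ω | choice W J k ω = i} ∩ {ω | choice W J j ω = i}) *
        ((J k).weight i * (J j).weight i) ≤
      loadIncrement W J k i * loadIncrement W J j i - (1 - groupCorr) *
        if grp W J k i = grp W J j i then loadIncrement W J k i * loadIncrement W J j i else 0 := by
  -- Outside the feasible set the weights have no sign, so those pairs are settled by their
  -- probability being zero.
  have hzero (l : ℕ) (hi : i ∉ (J l).feasible) :
      (seedMeasure m).real {ω | choice W J l ω = i} = 0 := by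
    rw [measureReal_choice hW, frac, (hW.isEquilibrium l).eq_zero i hi]
  have hzero' (l : ℕ) (hi : i ∉ (J l).feasible) : loadIncrement W J l i = 0 := by
    rw [loadIncrement, frac, (hW.isEquilibrium l).eq_zero i hi, mul_zero]
  have hnn : 0 ≤ (seedMeasure m).real ({ω | choice W J k ω = i} ∩ {ω | choice W J j ω = i}) :=
    measureReal_nonneg
  by_cases hk : i ∈ (J k).feasible
  · by_cases hj : i ∈ (J j).feasible
    · have hw := mul_nonneg ((J k).weight_nonneg i hk) ((J j).weight_nonneg i hj)
      by_cases h : grp W J k i = grp W J j i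
      · rw [if_pos h]
        refine (mul_le_mul_of_nonneg_right
          (measureReal_choice_inter_le_of_grp_eq hW hkj i h) hw).trans_eq ?_
        unfold loadIncrement
        ring
      · rw [if_neg h]
        refine (mul_le_mul_of_nonneg_right
          (measureReal_choice_inter_le hW hkj i h) hw).trans_eq ?_
        unfold loadIncrement
        ring
    · have : (seedMeasure m).real ({ω | choice W J k ω = i} ∩ {ω | choice W J j ω = i}) = 0 :=
        le_antisymm ((measureReal_mono Set.inter_subset_right).trans_eq (hzero j hj)) hnn
      rw [this, hzero' j hj]
      simp
  · have : (seedMeasure m).real ({ω | choice W J k ω = i} ∩ {ω | choice W J j ω = i}) = 0 :=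
      le_antisymm ((measureReal_mono Set.inter_subset_left).trans_eq (hzero k hk)) hnn
    rw [this, hzero' k hk]
    simp

/-- Without correlation the cross terms of job `j` would add up to twice its load increment times
the expected load before it; the pairs within groups save the fraction `1 - groupCorr`. -/
lemma expectedCost_le (hW : IsWaterFilling W) (n : ℕ) :
    (fullAlgorithm W).expectedCost (pre J n) ≤
      ∑ i, (∑ j ∈ Finset.range n, ((J j).weight i ^ 2 * frac W J j i +
        2 * ((st W J j i).expLoad * loadIncrement W J j i)) -
        2 * (1 - groupCorr) * ∑ j ∈ Finset.range n, pairIncrement W J j i) := by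
  rw [expectedCost_eq]
  refine Finset.sum_le_sum fun i _ => ?_
  rw [Finset.sum_add_distrib, Finset.mul_sum, Finset.mul_sum, add_sub_assoc,
    ← Finset.sum_sub_distrib]
  refine add_le_add (Finset.sum_le_sum fun j _ => ?_) (Finset.sum_le_sum fun j _ => ?_)
  · rw [measureReal_choice hW, mul_comm]
  · have h := Finset.sum_le_sum fun k (hk : k ∈ Finset.range j) =>
      pair_le (J := J) hW (Finset.mem_range.1 hk) i
    rw [Finset.sum_sub_distrib, ← Finset.mul_sum, ← Finset.sum_mul] at h
    rw [expLoad_eq hW]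
    unfold pairIncrement
    unfold loadIncrement at *
    linarith

/-- The dual objective pays for the expected cost of the algorithm. -/
lemma gam_mul_expectedCost_le (hW : IsWaterFilling W) (n : ℕ) :
    gam * (fullAlgorithm W).expectedCost (pre J n) ≤
      ∑ j ∈ Finset.range n, dualY W J j - 1 / 2 * ∑ i, (st W J n i).nu ^ 2 := by
  have hg : (0 : ℝ) ≤ gam := by norm_num [gam]
  refine (mul_le_mul_of_nonneg_left (expectedCost_le hW n) hg).trans ?_
  simp_rw [dualY_eq hW]
  rw [Finset.sum_comm, Finset.mul_sum, Finset.mul_sum, ← Finset.sum_sub_distrib]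
  refine Finset.sum_le_sum fun i _ => ?_
  conv_rhs => rw [Finset.sum_add_distrib, ← Finset.mul_sum]
  have := half_sq_nu_le (J := J) hW n i
  linarith

end Sequence

/-! ## Weak duality -/

lemma cost_eq_sum_pairs {m n : ℕ} (J : Fin n → Job m) (a : Fin n → Fin m) :
    cost J a = ∑ j, ∑ k, if a j = a k then (J j).weight (a j) * (J k).weight (a k) else 0 := by
  unfold cost load
  simp_rw [sq, Finset.sum_mul_sum]
  rw [Finset.sum_comm]
  refine Finset.sum_congr rfl fun j _ => ?_
  rw [Finset.sum_comm]
  refine Finset.sum_congr rfl fun k _ => ?_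
  simp only [ite_mul, zero_mul, mul_ite, mul_zero]
  rw [Finset.sum_ite_eq Finset.univ (a k), if_pos (Finset.mem_univ _)]
  by_cases h : a j = a k
  · rw [if_pos h, if_pos h, h]
  · rw [if_neg h, if_neg h]

/-- The objective of a feasible dual solution is at most the cost of every feasible assignment. -/
lemma DualSolution.IsFeasible.objective_le_cost {m n : ℕ} {D : DualSolution m n}
    {J : Fin n → Job m} (hD : D.IsFeasible J) {a : Fin n → Fin m}
    (ha : ∀ j, a j ∈ (J j).feasible) : D.objective ≤ cost J a := by
  have hV : ‖∑ j, D.v (a j) j‖ ^ 2 = ∑ j, ∑ k, inner ℝ (D.v (a j) j) (D.v (a k) k) := by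
    rw [← real_inner_self_eq_norm_sq, sum_inner]
    simp_rw [inner_sum]
  have hνV : inner ℝ D.nu (∑ j, D.v (a j) j) ≤
      1 / 2 * ‖D.nu‖ ^ 2 + 1 / 2 * ‖∑ j, D.v (a j) j‖ ^ 2 := by
    have := norm_sub_sq_real D.nu (∑ j, D.v (a j) j)
    nlinarith [sq_nonneg ‖D.nu - ∑ j, D.v (a j) j‖]
  have hy : ∑ j, D.y j ≤ ∑ j, ((J j).weight (a j) ^ 2 - 1 / 2 * ‖D.v (a j) j‖ ^ 2) +
      inner ℝ D.nu (∑ j, D.v (a j) j) := by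
    rw [inner_sum, ← Finset.sum_add_distrib]
    exact Finset.sum_le_sum fun j _ => hD.1 j (a j) (ha j)
  -- Expanding half the squared norm of the sum of the vectors, the diagonal cancels `-‖v‖² / 2` in
  -- the constraint of the job and leaves `w²`; off the diagonal the pair constraint applies.
  have hpair (j k : Fin n) : 1 / 2 * inner ℝ (D.v (a j) j) (D.v (a k) k) +
      (if j = k then (J j).weight (a j) ^ 2 - 1 / 2 * ‖D.v (a j) j‖ ^ 2 else 0) ≤
      if a j = a k then (J j).weight (a j) * (J k).weight (a k) else 0 := by
    by_cases h : j = k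
    · subst h
      rw [if_pos rfl, if_pos rfl, real_inner_self_eq_norm_sq]
      exact le_of_eq (by ring)
    · rw [if_neg h]
      have h1 := hD.2 j k (a j) (ha j) (a k) (ha k) fun h' => h (Prod.ext_iff.1 h').2
      by_cases h2 : a j = a k
      · rw [if_pos h2] at h1 ⊢
        linarith
      · rw [if_neg h2] at h1 ⊢
        linarith
  have hsum := Finset.sum_le_sum fun j (_ : j ∈ Finset.univ) =>
    Finset.sum_le_sum fun k (_ : k ∈ Finset.univ) => hpair j k
  rw [← cost_eq_sum_pairs] at hsum
  simp_rw [Finset.sum_add_distrib, ← Finset.mul_sum, Finset.sum_ite_eq, Finset.mem_univ,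
    if_true] at hsum
  unfold DualSolution.objective
  linarith

/-! ## Feasibility of the dual solution -/

section Sequence

variable {m : ℕ} {W : FractionalRule m} {J : ℕ → Job m}

/-- The dual variable of a job is at most its potential on every feasible machine. -/
lemma dualY_le (hW : IsWaterFilling W) {j : ℕ} {i : Fin m} (hi : i ∈ (J j).feasible) :
    dualY W J j ≤
      potential (st W J j i) ((J j).weight i) (frac W J j i) ((sol W J j).phi i) := by
  have hE := hW.isEquilibrium (J := J) j
  have hsum : ∑ e ∈ (J j).feasible, frac W J j e = 1 := by
    rw [← hE.sum_eq_one]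
    exact Finset.sum_subset (Finset.subset_univ _) fun e _ he => hE.eq_zero e he
  calc dualY W J j ≤ ∑ e ∈ (J j).feasible, frac W J j e *
        potential (st W J j i) ((J j).weight i) (frac W J j i) ((sol W J j).phi i) := by
        refine Finset.sum_le_sum fun e he => ?_
        rcases (hE.nonneg e).eq_or_lt with h | h
        · rw [frac, ← h, zero_mul, zero_mul]
        · exact mul_le_mul_of_nonneg_left (hE.le_of_pos e he i hi h) h.le
    _ = _ := by rw [← Finset.sum_mul, hsum, one_mul]

lemma v_eq {n : ℕ} (i : Fin m) (j : Fin n) : (dualSolution W (pre J n)).v i j =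
    EuclideanSpace.single i
      (min ((st W J j i).nu / (J j).weight i) (Real.sqrt 2) * (J j).weight i) := rfl

/-- The cap `√2` is made for the pair constraints: on one machine the product is at most `√2 * √2 *
w * w'`. In the constraint of a job the final `ν` may replace `ν̂`, as dual variables only grow and
the entries of `v` are nonnegative. -/
lemma dualSolution_isFeasible (hW : IsWaterFilling W) (J : ℕ → Job m) (n : ℕ) :
    (dualSolution W (pre J n)).IsFeasible (pre J n) := by
  constructor
  · intro j i hi
    have h1 : dualY W J j ≤ _ := dualY_le hW hi
    have h2 := potential_le ((J j).weight_nonneg i hi) (nu_nonneg hW j i) (load_le_nu hW j i)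
      (frac_nonneg hW j i) (frac_le_one hW j i) ((hW.isEquilibrium j).rate i hi)
      (nuHat_le_nu (J := J) hW j.2 i)
    refine (h1.trans h2).trans_eq ?_
    rw [v_eq, PiLp.norm_single, EuclideanSpace.inner_single_right, Real.norm_eq_abs, sq_abs]
    change _ = (J j).weight i ^ 2 - _ + _ * (st W J n i).nu
    rw [mul_comm (st W J n i).nu]
  · intro j k i hi i' hi' _
    have hα (l : Fin n) {e : Fin m} (he : e ∈ (pre J n l).feasible) :
        0 ≤ min ((st W J l e).nu / (J l).weight e) (Real.sqrt 2) * (J l).weight e ∧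
        min ((st W J l e).nu / (J l).weight e) (Real.sqrt 2) * (J l).weight e ≤
          Real.sqrt 2 * (J l).weight e := by
      have hw := (J l).weight_nonneg e he
      exact ⟨mul_nonneg (le_min (div_nonneg (nu_nonneg hW l e) hw) (Real.sqrt_nonneg 2)) hw,
        mul_le_mul_of_nonneg_right (min_le_right _ _) hw⟩
    have e1 : inner ℝ ((dualSolution W (pre J n)).v i j) ((dualSolution W (pre J n)).v i' k) =
        if i = i' then
          (min ((st W J j i).nu / (J j).weight i) (Real.sqrt 2) * (J j).weight i) *
          (min ((st W J k i').nu / (J k).weight i') (Real.sqrt 2) * (J k).weight i') else 0 := by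
      rw [v_eq, v_eq, EuclideanSpace.inner_single_left, PiLp.single_apply]
      simp
    rw [e1]
    by_cases h : i = i'
    · rw [if_pos h, if_pos h]
      refine (mul_le_mul (hα j hi).2 (hα k hi').2 (hα k hi').1
        (mul_nonneg (Real.sqrt_nonneg 2) ((J j).weight_nonneg i hi))).trans_eq ?_
      have := Real.mul_self_sqrt (by norm_num : (0 : ℝ) ≤ 2)
      change _ = 2 * (J j).weight i * (J k).weight i'
      linear_combination (J j).weight i * (J k).weight i' * this
    · rw [if_neg h, if_neg h]

lemma dualSolution_objective (W : FractionalRule m) (J : ℕ → Job m) (n : ℕ) :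
    (dualSolution W (pre J n)).objective =
      ∑ j ∈ Finset.range n, dualY W J j - 1 / 2 * ∑ i, (st W J n i).nu ^ 2 := by
  unfold DualSolution.objective
  rw [EuclideanSpace.real_norm_sq_eq, ← Fin.sum_univ_eq_sum_range]
  rfl

end Sequence

/-! ## Existence of water-filling solutions -/

lemma exists_isRate (ν w t : ℝ) : ∃ φ, IsRate ν w t φ := by
  have hδ : (0 : ℝ) ≤ delta := by norm_num [delta]
  by_cases h : ¬ Critical ν w ∨ theta < t
  · refine ⟨beta + delta, fun _ => rfl, fun h' => ?_, fun _ => ⟨by linarith, le_rfl⟩⟩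
    rcases h with h | h
    · exact absurd h'.1 h
    · exact absurd h (not_lt.2 h'.2.le)
  · exact ⟨beta, fun h' => absurd h' h, fun _ => rfl, fun _ => ⟨le_rfl, by linarith⟩⟩

section Level

variable {s : MachineState} {w : ℝ}

/-- The fraction at which the potential with rate `φ` reaches the level `L`. -/
def fill (s : MachineState) (w φ L : ℝ) : ℝ :=
  (L - gam * (w ^ 2 + 2 * w * s.expLoad) - φ * w * s.nu) / (φ ^ 2 * w ^ 2 / 2)

lemma fill_le_iff (hw : 0 < w) {φ : ℝ} (hφ : 0 < φ) (L t : ℝ) :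
    fill s w φ L ≤ t ↔ L ≤ potential s w t φ := by
  have h : 0 < φ ^ 2 * w ^ 2 / 2 := by positivity
  unfold fill potential
  rw [div_le_iff₀ h]
  constructor <;> intro <;> linarith

lemma le_fill_iff (hw : 0 < w) {φ : ℝ} (hφ : 0 < φ) (L t : ℝ) :
    t ≤ fill s w φ L ↔ potential s w t φ ≤ L := by
  have h : 0 < φ ^ 2 * w ^ 2 / 2 := by positivity
  unfold fill potential
  rw [le_div_iff₀ h]
  constructor <;> intro <;> linarith

lemma potential_fill (hw : 0 < w) {φ : ℝ} (hφ : 0 < φ) (L : ℝ) :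
    potential s w (fill s w φ L) φ = L :=
  le_antisymm ((le_fill_iff hw hφ L _).1 le_rfl) ((fill_le_iff hw hφ L _).1 le_rfl)

lemma potential_mono {t φ φ' : ℝ} (hw : 0 ≤ w) (hν : 0 ≤ s.nu) (ht : 0 ≤ t) (hφ : 0 ≤ φ)
    (h : φ ≤ φ') : potential s w t φ ≤ potential s w t φ' := by
  unfold potential
  gcongr

lemma potential_nonneg {t φ : ℝ} (hw : 0 ≤ w) (hν : 0 ≤ s.nu) (hℓ : 0 ≤ s.expLoad) (ht : 0 ≤ t)
    (hφ : 0 ≤ φ) : 0 ≤ potential s w t φ := by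
  have hg : (0 : ℝ) ≤ gam := by norm_num [gam]
  unfold potential
  positivity

open Classical in
/-- The fraction of the job that machine `i` takes when the level of the water is `L`. -/
def water (s : MachineState) (w L : ℝ) : ℝ :=
  if Critical s.nu w
  then max 0 (max (min (fill s w beta L) theta) (fill s w (beta + delta) L))
  else max 0 (fill s w (beta + delta) L)

lemma continuous_water (s : MachineState) (w : ℝ) : Continuous (water s w) := by
  have h (φ : ℝ) : Continuous (fill s w φ) := by
    unfold fill
    fun_prop
  unfold water
  by_cases hc : Critical s.nu w
  · simp only [if_pos hc]
    exact continuous_const.max (((h _).min continuous_const).max (h _))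
  · simp only [if_neg hc]
    exact continuous_const.max (h _)

lemma water_nonneg (s : MachineState) (w L : ℝ) : 0 ≤ water s w L := by
  unfold water
  split_ifs <;> exact le_max_left _ _

lemma fill_le_water (s : MachineState) (w L : ℝ) : fill s w (beta + delta) L ≤ water s w L := by
  unfold water
  split_ifs
  · exact (le_max_right _ _).trans (le_max_right _ _)
  · exact le_max_right _ _

/-- At every level there is an admissible rate with which a machine that takes some water has
reached the level, and a machine that takes no water is not below it. -/
lemma exists_rate_water (hw : 0 < w) (hν : 0 ≤ s.nu) (L : ℝ) :
    ∃ φ, IsRate s.nu w (water s w L) φ ∧ L ≤ potential s w (water s w L) φ ∧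
      (0 < water s w L → potential s w (water s w L) φ = L) := by
  have hb : 0 < beta := by linarith [beta_gt]
  have hδ : (0 : ℝ) ≤ delta := by norm_num [delta]
  have hθ : (0 : ℝ) < theta := by norm_num [theta]
  have hbd : 0 < beta + delta := by linarith
  have hclip {φ : ℝ} (hφ : 0 < φ) : L ≤ potential s w (max 0 (fill s w φ L)) φ ∧
      (0 < max 0 (fill s w φ L) → potential s w (max 0 (fill s w φ L)) φ = L) := by
    refine ⟨(fill_le_iff hw hφ L _).1 (le_max_right _ _), fun h => ?_⟩
    rcases max_choice 0 (fill s w φ L) with h' | h'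
    · exact absurd h' h.ne'
    · rw [h', potential_fill hw hφ]
  by_cases hc : Critical s.nu w
  · have hle {t : ℝ} (ht : 0 ≤ t) (h : fill s w beta L ≤ t) : fill s w (beta + delta) L ≤ t :=
      (fill_le_iff hw hbd L t).2 (((fill_le_iff hw hb L t).1 h).trans
        (potential_mono hw.le hν ht hb.le (by linarith)))
    -- Below the threshold the level is reached with rate `β`, and the larger rate would be reached
    -- even earlier.
    rcases lt_or_ge (fill s w beta L) theta with h1 | h1
    · have e : water s w L = max 0 (fill s w beta L) := by
        rw [water, if_pos hc, min_eq_left h1.le, ← max_assoc]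
        exact max_eq_left (hle (le_max_left _ _) (le_max_right _ _))
      have hlt : max 0 (fill s w beta L) < theta := max_lt hθ h1
      rw [e]
      exact ⟨beta, ⟨fun h => absurd h (not_or.2 ⟨not_not.2 hc, not_lt.2 hlt.le⟩), fun _ => rfl,
        fun _ => ⟨le_rfl, by linarith⟩⟩, hclip hb⟩
    -- The level lies within the jump of the potential at `θ`: the fraction rests there, and the
    -- intermediate value theorem in `φ` supplies the rate that meets the level.
    · rcases le_or_gt (fill s w (beta + delta) L) theta with h2 | h2
      · have e : water s w L = theta := by
          rw [water, if_pos hc, min_eq_right h1, max_eq_left h2, max_eq_right hθ.le]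
        have hcont : ContinuousOn (fun φ => potential s w theta φ) (Set.Icc beta (beta + delta)) := by
          unfold potential
          fun_prop
        obtain ⟨φ, hφ, hφL⟩ := intermediate_value_Icc (by linarith : beta ≤ beta + delta) hcont
          ⟨(le_fill_iff hw hb L _).1 h1, (fill_le_iff hw hbd L _).1 h2⟩
        rw [e]
        exact ⟨φ, ⟨fun h => absurd h (not_or.2 ⟨not_not.2 hc, lt_irrefl _⟩),
          fun h => absurd h.2 (lt_irrefl _), fun _ => hφ⟩, hφL.ge, fun _ => hφL⟩
      · have e : water s w L = max 0 (fill s w (beta + delta) L) := by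
          rw [water, if_pos hc, min_eq_right h1, max_eq_right h2.le]
        have hlt : theta < max 0 (fill s w (beta + delta) L) := h2.trans_le (le_max_right _ _)
        rw [e]
        exact ⟨beta + delta, ⟨fun _ => rfl, fun h => absurd h.2 (not_lt.2 hlt.le),
          fun h => absurd h.2 hlt.ne'⟩, hclip hbd⟩
  · have e : water s w L = max 0 (fill s w (beta + delta) L) := by rw [water, if_neg hc]
    rw [e]
    exact ⟨beta + delta, ⟨fun _ => rfl, fun h => absurd h.1 hc, fun h => absurd h.1 hc⟩, hclip hbd⟩

lemma water_zero (hw : 0 < w) (hν : 0 ≤ s.nu) (hℓ : 0 ≤ s.expLoad) : water s w 0 = 0 := by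
  have hb : 0 < beta := by linarith [beta_gt]
  have hδ : (0 : ℝ) ≤ delta := by norm_num [delta]
  have h {φ : ℝ} (hφ : 0 < φ) : fill s w φ 0 ≤ 0 :=
    (fill_le_iff hw hφ 0 0).2 (potential_nonneg hw.le hν hℓ le_rfl hφ.le)
  unfold water
  split_ifs
  · exact max_eq_left (max_le ((min_le_left _ _).trans (h hb)) (h (by linarith)))
  · exact max_eq_left (h (by linarith))

end Level

section Equilibrium

variable {m : ℕ} {s : Fin m → MachineState} {job : Job m}

/-- A machine of weight zero has potential zero at every fraction, the least possible, so it can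
take the whole job. -/
lemma exists_isEquilibrium_of_weight_eq_zero (hν : ∀ i, 0 ≤ (s i).nu)
    (hℓ : ∀ i, 0 ≤ (s i).expLoad) {i₀ : Fin m} (hi₀ : i₀ ∈ job.feasible)
    (hw : job.weight i₀ = 0) : ∃ F, IsEquilibrium s job F := by
  classical
  choose φ hφ using fun i =>
    exists_isRate (s i).nu (job.weight i) ((Pi.single i₀ 1 : Fin m → ℝ) i)
  have hx (i : Fin m) : 0 ≤ (Pi.single i₀ 1 : Fin m → ℝ) i := by
    rw [Pi.single_apply]
    split_ifs <;> norm_num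
  refine ⟨⟨Pi.single i₀ 1, φ⟩, hx, ?_, by simp, fun i _ => hφ i, ?_⟩
  · intro i hi
    refine Pi.single_eq_of_ne ?_ 1
    rintro rfl
    exact hi hi₀
  · intro e he i hi hpos
    have he' : e = i₀ := by
      by_contra h
      simp [h] at hpos
    subst he'
    have h0 : potential (s e) (job.weight e) ((Pi.single e 1 : Fin m → ℝ) e) (φ e) = 0 := by
      simp [potential, hw]
    refine h0.le.trans (potential_nonneg (job.weight_nonneg i hi) (hν i) (hℓ i) (hx i) ?_)
    linarith [(rate_bounds (hφ i)).1, beta_gt]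

/-- The total water is continuous in the level. It is zero at level `0`, and at least one at the
level where a single machine, with the larger rate, would take the whole job; some level in between
gives exactly one. -/
lemma exists_isEquilibrium_of_weight_pos (hν : ∀ i, 0 ≤ (s i).nu)
    (hℓ : ∀ i, 0 ≤ (s i).expLoad) (hw : ∀ i ∈ job.feasible, 0 < job.weight i) :
    ∃ F, IsEquilibrium s job F := by
  classical
  have hbd : 0 < beta + delta := by
    have : (0 : ℝ) ≤ delta := by norm_num [delta]
    linarith [beta_gt]
  obtain ⟨i₀, hi₀⟩ := job.feasible_nonempty
  set L₁ := potential (s i₀) (job.weight i₀) 1 (beta + delta) with hL₁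
  have hL₁0 : 0 ≤ L₁ :=
    potential_nonneg (hw i₀ hi₀).le (hν i₀) (hℓ i₀) zero_le_one hbd.le
  have hcont : ContinuousOn (fun L => ∑ i ∈ job.feasible, water (s i) (job.weight i) L)
      (Set.Icc 0 L₁) :=
    (continuous_finsetSum _ fun i _ => continuous_water _ _).continuousOn
  have h0 : ∑ i ∈ job.feasible, water (s i) (job.weight i) 0 ≤ 1 := by
    rw [Finset.sum_eq_zero fun i hi => water_zero (hw i hi) (hν i) (hℓ i)]
    exact zero_le_one
  have h1 : 1 ≤ ∑ i ∈ job.feasible, water (s i) (job.weight i) L₁ :=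
    (((le_fill_iff (hw i₀ hi₀) hbd L₁ 1).2 le_rfl).trans (fill_le_water _ _ _)).trans
      (Finset.single_le_sum (f := fun i => water (s i) (job.weight i) L₁)
        (fun i _ => water_nonneg _ _ _) hi₀)
  obtain ⟨L, -, hL⟩ := intermediate_value_Icc hL₁0 hcont ⟨h0, h1⟩
  choose! φ hφ using fun i (hi : i ∈ job.feasible) => exists_rate_water (hw i hi) (hν i) L
  refine ⟨⟨fun i => if i ∈ job.feasible then water (s i) (job.weight i) L else 0, φ⟩,
    ?_, ?_, ?_, ?_, ?_⟩
  · intro i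
    simp only
    split_ifs
    · exact water_nonneg _ _ _
    · exact le_rfl
  · exact fun i hi => if_neg hi
  · simpa using hL
  · intro i hi
    simpa only [if_pos hi] using (hφ i hi).1
  · intro e he i hi hpos
    simp only [if_pos he, if_pos hi] at hpos ⊢
    exact ((hφ e he).2.2 hpos).le.trans (hφ i hi).2.1

lemma exists_isEquilibrium (hν : ∀ i, 0 ≤ (s i).nu) (hℓ : ∀ i, 0 ≤ (s i).expLoad)
    (job : Job m) : ∃ F, IsEquilibrium s job F := by
  by_cases h : ∃ i ∈ job.feasible, job.weight i = 0
  · obtain ⟨i, hi, hw⟩ := h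
    exact exists_isEquilibrium_of_weight_eq_zero hν hℓ hi hw
  · push Not at h
    exact exists_isEquilibrium_of_weight_pos hν hℓ fun i hi =>
      (job.weight_nonneg i hi).lt_of_ne' (h i hi)

end Equilibrium

/-! ### An online rule built from the water-filling solutions. -/

open Classical in
/-- A water-filling solution, if there is one. -/
def fillJob {m : ℕ} (s : Fin m → MachineState) (job : Job m) : Fractional m :=
  if h : ∃ F, IsEquilibrium s job F then h.choose else ⟨0, 0⟩

/-- The states of the machines if every job is filled by `fillJob`. -/
def fillState {m : ℕ} : (n : ℕ) → (Fin n → Job m) → Fin m → MachineState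
  | 0, _ => fun _ => MachineState.init
  | n + 1, J => fun i =>
      updateMachine (fillState n (fun k => J k.castSucc) i) (J (Fin.last n))
        (fillJob (fillState n fun k => J k.castSucc) (J (Fin.last n))) i

/-- The rule that fills every job by `fillJob`. -/
def fillRule (m : ℕ) : FractionalRule m := fun n J =>
  fillJob (fillState n fun k => J k.castSucc) (J (Fin.last n))

/-- The states depend on the rule and the rule on the states. `fillState` runs both in one
recursion, and this identification breaks the circle. -/
lemma state_fillRule {m : ℕ} (n : ℕ) (J : Fin n → Job m) :
    state (fillRule m) n J = fillState n J := by
  induction n with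
  | zero => rfl
  | succ n ih =>
    funext i
    rw [state, fillState, ih]
    rfl

lemma isEquilibrium_fillJob {m : ℕ} {s : Fin m → MachineState} (hν : ∀ i, 0 ≤ (s i).nu)
    (hℓ : ∀ i, 0 ≤ (s i).expLoad) (job : Job m) : IsEquilibrium s job (fillJob s job) := by
  have h := exists_isEquilibrium hν hℓ job
  rw [fillJob, dif_pos h]
  exact h.choose_spec

lemma fillState_nonneg {m : ℕ} (n : ℕ) (J : Fin n → Job m) (i : Fin m) :
    0 ≤ (fillState n J i).nu ∧ 0 ≤ (fillState n J i).expLoad := by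
  induction n generalizing i with
  | zero => exact ⟨le_rfl, le_rfl⟩
  | succ n ih =>
    have hs := ih fun k => J k.castSucc
    have hE := isEquilibrium_fillJob (fun i => (hs i).1) (fun i => (hs i).2) (J (Fin.last n))
    rw [fillState]
    refine ⟨?_, ?_⟩
    · have h := nuHat_le_update (i := i) (hs i).1 (hE.nonneg i)
        (fun hi => (rate_bounds (hE.rate i hi)).1) (hE.eq_zero i)
      exact (hs i).1.trans (h.1.trans h.2)
    · have h (hi : i ∈ (J (Fin.last n)).feasible) := add_nonneg (hs i).2
        (mul_nonneg ((J (Fin.last n)).weight_nonneg i hi) (hE.nonneg i))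
      exact updateMachine_cases (p := fun s => 0 ≤ s.expLoad) (fun _ => (hs i).2)
        (fun hi _ => h hi) (fun hh _ => h hh.1) (fun hh _ => h hh.1)

lemma isWaterFilling_fillRule (m : ℕ) : IsWaterFilling (fillRule m) := by
  intro n J
  rw [state_fillRule]
  exact isEquilibrium_fillJob (fun i => (fillState_nonneg n _ i).1)
    (fun i => (fillState_nonneg n _ i).2) _

/-! ## The guarantees of the algorithm -/

section Guarantees

variable {m : ℕ} {W : FractionalRule m}

lemma isValid_fullAlgorithm (hW : IsWaterFilling W) : (fullAlgorithm W).IsValid := by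
  intro n J
  obtain ⟨J', rfl⟩ := exists_eq_pre J
  exact ⟨measurable_choice W J' n, choice_mem_feasible hW n⟩

lemma dualSolution_guarantee (hW : IsWaterFilling W) {n : ℕ} (J : Fin n → Job m) :
    (dualSolution W J).IsFeasible J ∧
      gam * (fullAlgorithm W).expectedCost J ≤ (dualSolution W J).objective := by
  -- Without machines there are no jobs, since a feasible set is nonempty. Otherwise a trivial job
  -- extends even the empty instance to an infinite sequence.
  rcases m with _ | m
  · rcases n with _ | n
    · refine ⟨⟨fun j => j.elim0, fun j => j.elim0⟩, ?_⟩
      simp [RandomizedAlgorithm.expectedCost, cost, DualSolution.objective,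
        EuclideanSpace.real_norm_sq_eq]
    · exact (J 0).feasible_nonempty.choose.elim0
  · have hJ : ∃ J' : ℕ → Job (m + 1), J = pre J' n := by
      let d : Job (m + 1) := ⟨{0}, Finset.singleton_nonempty 0, 0, fun _ _ => le_rfl⟩
      exact ⟨fun k => if h : k < n then J ⟨k, h⟩ else d,
        by funext k; simp only [pre, dif_pos k.isLt]⟩
    obtain ⟨J', rfl⟩ := hJ
    refine ⟨dualSolution_isFeasible hW J' n, ?_⟩
    rw [dualSolution_objective]
    exact gam_mul_expectedCost_le hW n

lemma isCompetitive_fullAlgorithm (hW : IsWaterFilling W) :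
    (fullAlgorithm W).IsCompetitive 4.9843 := by
  intro n J a ha
  obtain ⟨h1, h2⟩ := dualSolution_guarantee hW J
  have h3 := h2.trans (h1.objective_le_cost ha)
  rw [gam, one_div, inv_mul_le_iff₀ (by norm_num)] at h3
  exact h3

end Guarantees

end OnlineLB

end

theorem theorem1 (m : ℕ) :
    (∃ W : OnlineLB.FractionalRule m, OnlineLB.IsWaterFilling W) ∧
    ∀ W : OnlineLB.FractionalRule m, OnlineLB.IsWaterFilling W →
      (OnlineLB.fullAlgorithm W).IsValid ∧
      (∀ (n : ℕ) (J : Fin (n + 1) → OnlineLB.Job m) (i : Fin m),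
        (OnlineLB.fullAlgorithm W).P.real
          {ω | (OnlineLB.fullAlgorithm W).choose n J ω = i} = (W n J).x i) ∧
      (OnlineLB.fullAlgorithm W).IsCompetitive 4.9843 ∧
      ∀ (n : ℕ) (J : Fin n → OnlineLB.Job m),
        (OnlineLB.dualSolution W J).IsFeasible J ∧
        1 / 4.9843 * (OnlineLB.fullAlgorithm W).expectedCost J ≤
          (OnlineLB.dualSolution W J).objective := by
  refine ⟨⟨_, OnlineLB.isWaterFilling_fillRule m⟩, fun W hW =>
    ⟨OnlineLB.isValid_fullAlgorithm hW, fun n J i => ?_, OnlineLB.isCompetitive_fullAlgorithm hW,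
      fun n J => OnlineLB.dualSolution_guarantee hW J⟩⟩
  obtain ⟨J', rfl⟩ := OnlineLB.exists_eq_pre J
  exact OnlineLB.measureReal_choice hW i n
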